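/- **Setting.** For $\varepsilon>0$ let $\Omega_\varepsilon=\{x\in\mathbb R^2: x_1^2\le x_2\le x_1^2+\varepsilon^2\}$; for $t\in\mathbb R$ a capital $T$ denotes the point $(t,t^2)$. Let $\varepsilon_\infty>0$ and let $f\in C^2(\mathbb R)$ be such that $f''$ is piecewise monotone with finitely many intervals of monotonicity and $\int_{\mathbb R} e^{-|t|/\varepsilon_\infty}\,df''(t)$ converges absolutely. *Figures.* Put $u_R(x)=x_1+\varepsilon-\sqrt{x_1^2+\varepsilon^2-x_2}$ and $u_L(x)=x_1-\varepsilon+\sqrt{x_1^2+\varepsilon^2-x_2}$. For $-\infty\le c\le d\le+\infty$ let $\Omega_R(c,d;\varepsilon)=\{x\in\Omega_\varepsilon: c\le u_R(x)\le d\}$ and $\Omega_L(c,d;\varepsilon)=\{x\in\Omega_\varepsilon: c\le u_L(x)\le d\}$ (tangent domains). The trolleybuses $\Omega_{tr,R}(a,b;\varepsilon)$ and $\Omega_{tr,L}(a,b;\varepsilon)$ are the parts of $\Omega_R(a,b;\varepsilon)$ and $\Omega_L(a,b;\varepsilon)$ where $x_2\ge(a+b)x_1-ab$, i.e. above the chord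 $[A,B]$. The angle is $\Omega_{ang}(w;\varepsilon)=\{|x_1-w|\le\varepsilon,\ 2wx_1-w^2+2\varepsilon|w-x_1|\le x_2\le x_1^2+\varepsilon^2\}$. For disjoint compact intervals $\mathfrak a_i=[\mathfrak a_i^l,\mathfrak a_i^r]$, $1\le i\le k$ (possibly single points), numbered from left to right, with $\mathfrak a_{i+1}^l-\mathfrak a_i^r\le2\varepsilon$, the multibirdie $\Omega_{Mbird}(\{\mathfrak a_i\};\varepsilon)$ is the set of $x\in\Omega_\varepsilon$ with $u_R(x)\ge\mathfrak a_1^l$, $u_L(x)\le\mathfrak a_k^r$ that lie above (or on) the line of each chord joining the points of the lower parabola over $\mathfrak a_i^r$ and $\mathfrak a_{i+1}^l$, $1\le i<k$. A chordal domain is given by continuous functions $a,b$ on an interval $[\lambda,L]$, $0\le\lambda<L$, with $b(l)-a(l)=l$, differentiable with $a'<0<b'$ on $(\lambda,L)$; for $\lambda<s\le L$, $\Omega_{ch}([a(s),b(s)],*)$ is the union of the chords $[A(l),B(l)]$, $\lambda\le l\le s$. *Standard candidates.* Write $\langle h\rangle_{[a,b]}$ for the mean value. A pair $a<b$ satisfies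 the cup equation if $\langle f'\rangle_{[a,b]}=\frac12(f'(a)+f'(b))$; put $D_L(a,b)=f''(a)-\langle f''\rangle_{[a,b]}$, $D_R(a,b)=f''(b)-\langle f''\rangle_{[a,b]}$. A function $B$ is a standard candidate - on $\Omega_R(c,d;\varepsilon)$ if $B(x)=m(u)(x_1-u)+f(u)$, $u=u_R(x)$, where $m$ is continuous on $\{c\le u\le d\}$ and $\varepsilon m'+m-f'=0$, $m''<0$ on $(c,d)$; if $c=-\infty$, moreover $m(u)=\varepsilon^{-1}e^{-u/\varepsilon}\int_{-\infty}^uf'(t)e^{t/\varepsilon}dt$; - on $\Omega_L(c,d;\varepsilon)$ if the same formula holds with $u=u_L(x)$, where $-\varepsilon m'+m-f'=0$, $m''>0$ on $(c,d)$; if $d=+\infty$, moreover $m(u)=\varepsilon^{-1}e^{u/\varepsilon}\int_u^{\infty}f'(t)e^{-t/\varepsilon}dt$; - on an angle, a trolleybus or a multibirdie if $B=\beta_0+\beta_1x_1+\beta_2x_2$ there, with $\beta_1=f'(t)-2\beta_2t$ and $\beta_0=f(t)-tf'(t)+\beta_2t^2$ for every $t$ in $\{w\}$, $\{a,b\}$,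 $\bigcup_i\mathfrak a_i$ respectively; - on the chordal domain with the functions $a,b$ on $[\lambda,s]$ if for $l\in[\lambda,s]$, $l>0$, the pair $(a(l),b(l))$ satisfies the cup equation and $D_L,D_R\le0$ at it, with $D_L,D_R<0$ for $l\in(\lambda,s)$, and $B$ is linear on each chord $[A(l),B(l)]$ with the values $f(a(l)),f(b(l))$ at its ends. The quantity $\varepsilon m''$ is called the force on the tangent domain. *Force flows.* For a pair $a<b$ satisfying the cup equation let $F_R(v)=D_R(a,b)e^{(b-v)/\varepsilon}+e^{-v/\varepsilon}\int_b^ve^{t/\varepsilon}df''(t)$, $v\ge b$, be the right force of the chord $[A,B]$; its right tail is $(b,t^R)$, $t^R=\sup\{t>b:F_R<0\text{ on }(b,t)\}$. The right force of $-\infty$ is $e^{-v/\varepsilon}\int_{-\infty}^ve^{t/\varepsilon}df''(t)$, with the tail $(-\infty,t^R)$, $t^R=\sup\{t: F_R<0\text{ on }(-\infty,t)\}$ (a non-empty tail of $-\infty$ counts as containing $-\infty$). Symmetrically, $F_L(v)=-D_L(a,b)e^{(v-a)/\varepsilon}+e^{v/\varepsilon}\int_v^ae^{-t/\varepsilon}df''(t)$,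 $v\le a$, with the left tail $(t^L,a)$, $t^L=\inf\{t<a:F_L>0\text{ on }(t,a)\}$, and $F_L(v)=e^{v/\varepsilon}\int_v^\infty e^{-t/\varepsilon}df''(t)$ for $+\infty$, with the tail $(t^L,\infty)$ (counted as containing $+\infty$ if non-empty). For $u\in\mathbb R\cup\{-\infty\}$ a right monotone force flow on $(u,\infty)\times[\varepsilon_1,\varepsilon_2]$ is a continuous function $\mathfrak F_R$ such that each $\mathfrak F_R(\cdot;\varepsilon)$ is the force (with parameter $\varepsilon$) of a chord $[A,B]$ with $b\le u$ or of $-\infty$, whose tail contains $u$ if $\varepsilon\in(\varepsilon_1,\varepsilon_2)$, and $\mathfrak F_R(v;\eta)>\mathfrak F_R(v;\eta')$ for $\varepsilon_1\le\eta<\eta'\le\varepsilon_2$, $v\in[u,t^R(\eta)]$ ($v$ real, $\mathfrak F_R(u;\cdot)$ being the value of the same force). A left monotone force flow on $(-\infty,u)\times[\varepsilon_1,\varepsilon_2]$, $u\in\mathbb R\cup\{+\infty\}$, is defined symmetrically: left forces of chords with $u\le a$ or of $+\infty$, and $\mathfrak F_L(v;\eta)<\mathfrak F_L(v;\eta')$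 for $\eta<\eta'$, $v\in[t^L(\eta),u]$. **Theorem.** Let $0<\eta_1<\eta_3<\varepsilon_\infty$ and $k\ge1$, let $\mathfrak a_1,\dots,\mathfrak a_k$ be disjoint compact intervals (possibly points), numbered from left to right, with $\mathfrak a_{i+1}^l-\mathfrak a_i^r\le2\eta_1$, and let $-\infty\le u_1<\mathfrak a_1^l$, $\mathfrak a_k^r<u_2\le+\infty$. Let $\mathfrak F_R$ be a right monotone force flow on $(u_1,\infty)\times[\eta_1,\eta_3]$ and $\mathfrak F_L$ a left monotone force flow on $(-\infty,u_2)\times[\eta_1,\eta_3]$; let $\mathfrak a_1^l$ belong to the closure of the tail of $\mathfrak F_R(\cdot;\eta_1)$ and $\mathfrak a_k^r$ to the closure of the tail of $\mathfrak F_L(\cdot;\eta_1)$. For $1\le i<k$ let $a_i,b_i$ on $[\lambda_i,\mathfrak a_{i+1}^l-\mathfrak a_i^r]$ be the functions of a chordal domain with the upper chord over $[\mathfrak a_i^r,\mathfrak a_{i+1}^l]$. Suppose that a continuous function $B$ on $$\Omega_R(u_1,\mathfrak a_1^l;\eta_1)\cup\Omega_{Mbird}(\{\mathfrak a_i\};\eta_1)\cup\bigcup_{i=1}^{k-1}\Omega_{ch}([\mathfrak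 a_i^r,\mathfrak a_{i+1}^l],*)\cup\Omega_L(\mathfrak a_k^r,u_2;\eta_1)$$ coincides with a standard candidate on each subdomain, the forces on the two tangent domains being $\mathfrak F_R(\cdot;\eta_1)$ on $(u_1,\mathfrak a_1^l)$ and $\mathfrak F_L(\cdot;\eta_1)$ on $(\mathfrak a_k^r,u_2)$. Then there exist $\eta_2\in(\eta_1,\eta_3]$ and continuous strictly decreasing functions $\mathfrak l_i:[\eta_1,\eta_2]\to(\lambda_i,\mathfrak a_{i+1}^l-\mathfrak a_i^r]$ with $\mathfrak l_i(\eta_1)=\mathfrak a_{i+1}^l-\mathfrak a_i^r$, $1\le i\le k-1$, such that for every $\varepsilon\in[\eta_1,\eta_2]$ the following holds. Write $a_i=a_i(\mathfrak l_i(\varepsilon))$, $b_i=b_i(\mathfrak l_i(\varepsilon))$ for $1\le i\le k-1$, and $b_0=u_1$, $a_k=u_2$. There are $j\in\{1,\dots,k\}$ and a real $w$ with $b_{j-1}\le w\le a_j$ and $u_1<w<u_2$, and a continuous function $B_\varepsilon$ on $$\bigcup_{i=0}^{j-2}\Omega_R(b_i,a_{i+1};\varepsilon)\cup\bigcup_{i=1}^{j-1}\Omega_{tr,R}(a_i,b_i;\varepsilon)\cup\Omega_R(b_{j-1},w;\varepsilon)\cup\Omega_{ang}(w;\varepsilon)\cup\Omega_L(w,a_j;\varepsilon)\cup\bigcup_{i=j}^{k-1}\Omega_{tr,L}(a_i,b_i;\varepsilon)\cup\bigcup_{i=j}^{k-1}\Omega_L(b_i,a_{i+1};\varepsilon)\cup\bigcup_{i=1}^{k-1}\Omega_{ch}([a_i,b_i],*)$$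 that coincides with a standard candidate on each subdomain; moreover the force on the right tangent domain starting at $u_1$ is $\mathfrak F_R(\cdot;\varepsilon)$, and the force on the left tangent domain ending at $u_2$ is $\mathfrak F_L(\cdot;\varepsilon)$. For $\varepsilon=\eta_1$ only, the strict inequalities $m''<0$, $m''>0$ in the definition of a standard candidate on a tangent domain may degenerate to non-strict ones at the points of those $\mathfrak a_i$ that have non-empty interior. -/

import Mathlib

open Set MeasureTheory Topology

noncomputable section

namespace BellmanStrip

/-! ### Stieltjes integration against a function of locally bounded variation

The (signed) measure `dg` of a continuous function `g : ℝ → ℝ` of locally bounded variation is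
given through its Jordan decomposition `g = jordanPos - jordanNeg + const`, where
`jordanPos = (V + g) / 2`, `jordanNeg = (V - g) / 2` and `V` is the variation of `g` counted from `0`.
(The measure need not be finite, only locally finite.) -/

/-- The increasing part of the Jordan decomposition of `g`. -/
def jordanPos (g : ℝ → ℝ) (x : ℝ) : ℝ := (variationOnFromTo g univ 0 x + g x) / 2

/-- The decreasing part (with the sign changed) of the Jordan decomposition of `g`. -/
def jordanNeg (g : ℝ → ℝ) (x : ℝ) : ℝ := (variationOnFromTo g univ 0 x - g x) / 2

lemma jordanPos_monotone {g : ℝ → ℝ} (hg : LocallyBoundedVariationOn g univ) :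
    Monotone (jordanPos g) := by
  intro x y hxy
  have h := variationOnFromTo.add_self_monotoneOn hg (mem_univ 0) (mem_univ x) (mem_univ y) hxy
  simp only [Pi.add_apply] at h
  unfold jordanPos
  linarith

lemma jordanNeg_monotone {g : ℝ → ℝ} (hg : LocallyBoundedVariationOn g univ) :
    Monotone (jordanNeg g) := by
  intro x y hxy
  have h := variationOnFromTo.sub_self_monotoneOn hg (mem_univ 0) (mem_univ x) (mem_univ y) hxy
  simp only [Pi.sub_apply] at h
  unfold jordanNeg
  linarith

open scoped Classical in
/-- The positive part of the measure `dg` (for `g` of locally bounded variation). -/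
def posVar (g : ℝ → ℝ) : Measure ℝ :=
  if hg : LocallyBoundedVariationOn g univ then
    (jordanPos_monotone hg).stieltjesFunction.measure else 0

open scoped Classical in
/-- The negative part of the measure `dg` (for `g` of locally bounded variation). -/
def negVar (g : ℝ → ℝ) : Measure ℝ :=
  if hg : LocallyBoundedVariationOn g univ then
    (jordanNeg_monotone hg).stieltjesFunction.measure else 0

/-- The Stieltjes integral `∫_S φ dg`. -/
def stieltjesInt (g φ : ℝ → ℝ) (S : Set ℝ) : ℝ :=
  (∫ t in S, φ t ∂(posVar g)) - ∫ t in S, φ t ∂(negVar g)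

/-! ### Standing assumptions on the boundary function -/

/-- `f ∈ C²`, and `f''` is piecewise monotone with finitely many intervals of monotonicity:
there are finitely many points such that `f''` is monotone on every interval avoiding them. -/
def Regular (f : ℝ → ℝ) : Prop :=
  ContDiff ℝ 2 f ∧ ∃ S : Finset ℝ, ∀ I : Set ℝ, I.OrdConnected → Disjoint I (S : Set ℝ) →
    MonotoneOn (deriv (deriv f)) I ∨ AntitoneOn (deriv (deriv f)) I

/-- The integral `∫ exp (-|t| / E) df''(t)` converges absolutely. -/
def Summability (f : ℝ → ℝ) (E : ℝ) : Prop :=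
  Integrable (fun t : ℝ => Real.exp (-|t| / E))
    (posVar (deriv (deriv f)) + negVar (deriv (deriv f)))

/-! ### Chords: averages, the cup equation, differentials -/

/-- The average of `h` over `[a, b]`, `a < b`. -/
def avg (h : ℝ → ℝ) (a b : ℝ) : ℝ := (∫ t in a..b, h t) / (b - a)

/-- The cup equation for the pair `(a, b)`, `a < b`. -/
def CupEquation (f : ℝ → ℝ) (a b : ℝ) : Prop :=
  avg (deriv f) a b = (deriv f a + deriv f b) / 2

/-- The left differential. -/
def DL (f : ℝ → ℝ) (a b : ℝ) : ℝ := deriv (deriv f) a - avg (deriv (deriv f)) a b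

/-- The right differential. -/
def DR (f : ℝ → ℝ) (a b : ℝ) : ℝ := deriv (deriv f) b - avg (deriv (deriv f)) a b

/-! ### Forces, tails, monotone force flows -/

/-- The right force of the chord over `[a, b]` at the point `v ≥ b`. -/
def chordForceR (f : ℝ → ℝ) (a b ε v : ℝ) : ℝ :=
  DR f a b * Real.exp ((b - v) / ε) +
    Real.exp (-v / ε) *
      stieltjesInt (deriv (deriv f)) (fun t => Real.exp (t / ε)) (Ioc b v)

/-- The left force of the chord over `[a, b]` at the point `v ≤ a`. -/
def chordForceL (f : ℝ → ℝ) (a b ε v : ℝ) : ℝ :=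
  -DL f a b * Real.exp ((v - a) / ε) +
    Real.exp (v / ε) *
      stieltjesInt (deriv (deriv f)) (fun t => Real.exp (-t / ε)) (Ioc v a)

/-- The right force coming from `-∞`. -/
def infForceR (f : ℝ → ℝ) (ε v : ℝ) : ℝ :=
  Real.exp (-v / ε) * stieltjesInt (deriv (deriv f)) (fun t => Real.exp (t / ε)) (Iic v)

/-- The left force coming from `+∞`. -/
def infForceL (f : ℝ → ℝ) (ε v : ℝ) : ℝ :=
  Real.exp (v / ε) * stieltjesInt (deriv (deriv f)) (fun t => Real.exp (-t / ε)) (Ioi v)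

/-- What generates a force: a chord over `[a, b]`, or the infinity (`-∞` for right forces,
`+∞` for left forces). -/
inductive ForceSource where
  | chord (a b : ℝ) : ForceSource
  | infinity : ForceSource

/-- The right force generated by a source. -/
def forceR (f : ℝ → ℝ) (ε : ℝ) : ForceSource → ℝ → ℝ
  | .chord a b => chordForceR f a b ε
  | .infinity => infForceR f ε

/-- The left force generated by a source. -/
def forceL (f : ℝ → ℝ) (ε : ℝ) : ForceSource → ℝ → ℝ
  | .chord a b => chordForceL f a b ε
  | .infinity => infForceL f ε

/-- The right end `t^R` of the right tail of a source. -/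
def tailEndR (f : ℝ → ℝ) (ε : ℝ) : ForceSource → EReal
  | .chord a b =>
      sSup ((fun t : ℝ => (t : EReal)) '' {t | b < t ∧ ∀ s ∈ Ioo b t, chordForceR f a b ε s < 0})
  | .infinity => sSup ((fun t : ℝ => (t : EReal)) '' {t | ∀ s < t, infForceR f ε s < 0})

/-- The left end `t^L` of the left tail of a source. -/
def tailEndL (f : ℝ → ℝ) (ε : ℝ) : ForceSource → EReal
  | .chord a b =>
      sInf ((fun t : ℝ => (t : EReal)) '' {t | t < a ∧ ∀ s ∈ Ioo t a, 0 < chordForceL f a b ε s})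
  | .infinity => sInf ((fun t : ℝ => (t : EReal)) '' {t | ∀ s, t < s → 0 < infForceL f ε s})

/-- The right tail of a source: `(b, t^R)` for a chord and `(-∞, t^R)` for `-∞`. The tail of `-∞`,
when it is not empty, is regarded as containing `-∞`. -/
def tailR (f : ℝ → ℝ) (ε : ℝ) : ForceSource → Set EReal
  | .chord a b => Ioo (b : EReal) (tailEndR f ε (.chord a b))
  | .infinity => Iio (tailEndR f ε .infinity)

/-- The left tail of a source: `(t^L, a)` for a chord and `(t^L, +∞)` for `+∞`. The tail of `+∞`,
when it is not empty, is regarded as containing `+∞`. -/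
def tailL (f : ℝ → ℝ) (ε : ℝ) : ForceSource → Set EReal
  | .chord a b => Ioo (tailEndL f ε (.chord a b)) (a : EReal)
  | .infinity => Ioi (tailEndL f ε .infinity)

/-- An admissible source of a right force considered to the right of `u`: `-∞` or a chord lying
on the left of `u` whose ends satisfy the cup equation. -/
def SourceLeftOf (f : ℝ → ℝ) (u : EReal) : ForceSource → Prop
  | .chord a b => a < b ∧ CupEquation f a b ∧ (b : EReal) ≤ u
  | .infinity => True

/-- An admissible source of a left force considered to the left of `u`: `+∞` or a chord lying
on the right of `u` whose ends satisfy the cup equation. -/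
def SourceRightOf (f : ℝ → ℝ) (u : EReal) : ForceSource → Prop
  | .chord a b => a < b ∧ CupEquation f a b ∧ u ≤ (a : EReal)
  | .infinity => True

/-- `F v ε` is a right monotone force flow on `(u, ∞) × [ε₁, ε₂]`; `src ε` is the source of the
force `F · ε`. The values at the end `u`, if it is finite, are those of the same force. -/
structure IsRightForceFlow (f : ℝ → ℝ) (u : EReal) (ε₁ ε₂ : ℝ) (src : ℝ → ForceSource)
    (F : ℝ → ℝ → ℝ) : Prop where
  continuous : ContinuousOn (fun p : ℝ × ℝ => F p.1 p.2) {p | u < (p.1 : EReal) ∧ p.2 ∈ Icc ε₁ ε₂}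
  source : ∀ ε ∈ Icc ε₁ ε₂, SourceLeftOf f u (src ε)
  force : ∀ ε ∈ Icc ε₁ ε₂, ∀ v : ℝ, u ≤ (v : EReal) → F v ε = forceR f ε (src ε) v
  tail : ∀ ε ∈ Ioo ε₁ ε₂, u ∈ tailR f ε (src ε)
  monotone : ∀ η ∈ Icc ε₁ ε₂, ∀ η' ∈ Icc ε₁ ε₂, η < η' → ∀ v : ℝ, u ≤ (v : EReal) →
    (v : EReal) ≤ tailEndR f η (src η) → F v η' < F v η

/-- `F v ε` is a left monotone force flow on `(-∞, u) × [ε₁, ε₂]`; `src ε` is the source of the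
force `F · ε`. The values at the end `u`, if it is finite, are those of the same force. -/
structure IsLeftForceFlow (f : ℝ → ℝ) (u : EReal) (ε₁ ε₂ : ℝ) (src : ℝ → ForceSource)
    (F : ℝ → ℝ → ℝ) : Prop where
  continuous : ContinuousOn (fun p : ℝ × ℝ => F p.1 p.2) {p | (p.1 : EReal) < u ∧ p.2 ∈ Icc ε₁ ε₂}
  source : ∀ ε ∈ Icc ε₁ ε₂, SourceRightOf f u (src ε)
  force : ∀ ε ∈ Icc ε₁ ε₂, ∀ v : ℝ, (v : EReal) ≤ u → F v ε = forceL f ε (src ε) v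
  tail : ∀ ε ∈ Ioo ε₁ ε₂, u ∈ tailL f ε (src ε)
  monotone : ∀ η ∈ Icc ε₁ ε₂, ∀ η' ∈ Icc ε₁ ε₂, η < η' → ∀ v : ℝ, (v : EReal) ≤ u →
    tailEndL f η (src η) ≤ (v : EReal) → F v η < F v η'

/-! ### The parabolic strip and the figures in it -/

/-- The parabolic strip. -/
def strip (ε : ℝ) : Set (ℝ × ℝ) := {x | x.1 ^ 2 ≤ x.2 ∧ x.2 ≤ x.1 ^ 2 + ε ^ 2}

/-- The point `u` such that `x` lies on the right tangent (touching the upper parabola at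
`x₁ = u - ε`) ending at `(u, u²)`. -/
def uR (ε : ℝ) (x : ℝ × ℝ) : ℝ := x.1 + ε - √(x.1 ^ 2 + ε ^ 2 - x.2)

/-- The point `u` such that `x` lies on the left tangent (touching the upper parabola at
`x₁ = u + ε`) starting at `(u, u²)`. -/
def uL (ε : ℝ) (x : ℝ × ℝ) : ℝ := x.1 - ε + √(x.1 ^ 2 + ε ^ 2 - x.2)

/-- The right tangent domain over `[c, d]`. -/
def tangR (ε : ℝ) (c d : EReal) : Set (ℝ × ℝ) :=
  {x | x ∈ strip ε ∧ c ≤ (uR ε x : EReal) ∧ (uR ε x : EReal) ≤ d}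

/-- The left tangent domain over `[c, d]`. -/
def tangL (ε : ℝ) (c d : EReal) : Set (ℝ × ℝ) :=
  {x | x ∈ strip ε ∧ c ≤ (uL ε x : EReal) ∧ (uL ε x : EReal) ≤ d}

/-- The closed half-plane above the chord over `[a, b]`. -/
def aboveChord (a b : ℝ) : Set (ℝ × ℝ) := {x | (a + b) * x.1 - a * b ≤ x.2}

/-- The angle with the vertex `(w, w²)`. -/
def angle (ε w : ℝ) : Set (ℝ × ℝ) :=
  {x | w - ε ≤ x.1 ∧ x.1 ≤ w + ε ∧ 2 * w * x.1 - w ^ 2 + 2 * ε * |w - x.1| ≤ x.2 ∧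
    x.2 ≤ x.1 ^ 2 + ε ^ 2}

/-- The right trolleybus over `[a, b]`: between two right tangents and the chord. -/
def trolleyR (ε a b : ℝ) : Set (ℝ × ℝ) := tangR ε a b ∩ aboveChord a b

/-- The left trolleybus over `[a, b]`: between two left tangents and the chord. -/
def trolleyL (ε a b : ℝ) : Set (ℝ × ℝ) := tangL ε a b ∩ aboveChord a b

/-- The multibirdie on the arcs `[aL i, aR i]`, `1 ≤ i ≤ k`: bounded by the right tangent at
`aL 1`, the left tangent at `aR k`, the arcs, the chords connecting neighbouring arcs, and the
upper parabola. -/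
def multibirdie (ε : ℝ) (k : ℕ) (aL aR : ℕ → ℝ) : Set (ℝ × ℝ) :=
  {x | x ∈ strip ε ∧ aL 1 ≤ uR ε x ∧ uL ε x ≤ aR k ∧
    ∀ i, 1 ≤ i → i < k → x ∈ aboveChord (aR i) (aL (i + 1))}

/-- The chordal domain: the union of the chords over `[a l, b l]`, `l ∈ [l₁, l₀]`. -/
def chordal (a b : ℝ → ℝ) (l₁ l₀ : ℝ) : Set (ℝ × ℝ) :=
  ⋃ l ∈ Icc l₁ l₀, segment ℝ ((a l, a l ^ 2) : ℝ × ℝ) (b l, b l ^ 2)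

/-! ### Standard candidates -/

/-- `B` is the standard candidate with the slope function `m` on the right tangent domain over
`[c, d]`. The inequality `m'' < 0` is allowed to degenerate into `m'' ≤ 0` on the set `Z`
(`Z = ∅` gives the standard candidates in the proper sense). -/
structure IsStdTangR (f : ℝ → ℝ) (ε : ℝ) (c d : EReal) (Z : Set ℝ) (m : ℝ → ℝ)
    (B : ℝ × ℝ → ℝ) : Prop where
  formula : ∀ x ∈ tangR ε c d, B x = m (uR ε x) * (x.1 - uR ε x) + f (uR ε x)
  continuous : ContinuousOn m {u | c ≤ (u : EReal) ∧ (u : EReal) ≤ d}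
  ode : ∀ u : ℝ, c < (u : EReal) → (u : EReal) < d →
    DifferentiableAt ℝ m u ∧ ε * deriv m u + m u - deriv f u = 0
  concave : ∀ u : ℝ, c < (u : EReal) → (u : EReal) < d →
    deriv (deriv m) u ≤ 0 ∧ (u ∉ Z → deriv (deriv m) u < 0)
  atInfinity : c = ⊥ → ∀ u : ℝ, (u : EReal) ≤ d →
    m u = ε⁻¹ * Real.exp (-u / ε) * ∫ t in Iic u, deriv f t * Real.exp (t / ε)

/-- `B` is the standard candidate with the slope function `m` on the left tangent domain over
`[c, d]`. The inequality `m'' > 0` is allowed to degenerate into `m'' ≥ 0` on the set `Z`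
(`Z = ∅` gives the standard candidates in the proper sense). -/
structure IsStdTangL (f : ℝ → ℝ) (ε : ℝ) (c d : EReal) (Z : Set ℝ) (m : ℝ → ℝ)
    (B : ℝ × ℝ → ℝ) : Prop where
  formula : ∀ x ∈ tangL ε c d, B x = m (uL ε x) * (x.1 - uL ε x) + f (uL ε x)
  continuous : ContinuousOn m {u | c ≤ (u : EReal) ∧ (u : EReal) ≤ d}
  ode : ∀ u : ℝ, c < (u : EReal) → (u : EReal) < d →
    DifferentiableAt ℝ m u ∧ -ε * deriv m u + m u - deriv f u = 0
  concave : ∀ u : ℝ, c < (u : EReal) → (u : EReal) < d →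
    0 ≤ deriv (deriv m) u ∧ (u ∉ Z → 0 < deriv (deriv m) u)
  atInfinity : d = ⊤ → ∀ u : ℝ, c ≤ (u : EReal) →
    m u = ε⁻¹ * Real.exp (u / ε) * ∫ t in Ioi u, deriv f t * Real.exp (-t / ε)

/-- On the tangent domain over `[c, d]` with the slope function `m` the force is `G`. -/
def HasForce (ε : ℝ) (c d : EReal) (m G : ℝ → ℝ) : Prop :=
  ∀ u : ℝ, c < (u : EReal) → (u : EReal) < d → ε * deriv (deriv m) u = G u

/-- `B` is the standard candidate on a linearity domain `D` that meets the lower parabola over the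
set `T`: it is affine on `D`, and its graph contains the tangent vectors of the boundary curve
`(t, t², f t)` at all `t ∈ T`. -/
def IsStdLinear (f : ℝ → ℝ) (T : Set ℝ) (D : Set (ℝ × ℝ)) (B : ℝ × ℝ → ℝ) : Prop :=
  ∃ β₀ β₁ β₂ : ℝ, (∀ x ∈ D, B x = β₀ + β₁ * x.1 + β₂ * x.2) ∧
    ∀ t ∈ T, β₁ = deriv f t - 2 * β₂ * t ∧ β₀ = f t - t * deriv f t + β₂ * t ^ 2

/-- `B` is the standard candidate on the chordal domain with the functions `a`, `b` on
`[l₁, l₀]` (a cup, if `l₁ = 0`). -/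
structure IsStdChordal (f : ℝ → ℝ) (a b : ℝ → ℝ) (l₁ l₀ : ℝ) (B : ℝ × ℝ → ℝ) : Prop where
  nonneg : 0 ≤ l₁
  lt : l₁ < l₀
  length : ∀ l ∈ Icc l₁ l₀, b l - a l = l
  continuous_a : ContinuousOn a (Icc l₁ l₀)
  continuous_b : ContinuousOn b (Icc l₁ l₀)
  diff_a : ∀ l ∈ Ioo l₁ l₀, DifferentiableAt ℝ a l ∧ deriv a l < 0
  diff_b : ∀ l ∈ Ioo l₁ l₀, DifferentiableAt ℝ b l ∧ 0 < deriv b l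
  cup : ∀ l ∈ Icc l₁ l₀, 0 < l → CupEquation f (a l) (b l)
  differentials : ∀ l ∈ Icc l₁ l₀, 0 < l → DL f (a l) (b l) ≤ 0 ∧ DR f (a l) (b l) ≤ 0
  differentials_strict : ∀ l ∈ Ioo l₁ l₀, DL f (a l) (b l) < 0 ∧ DR f (a l) (b l) < 0
  linear : ∀ l ∈ Icc l₁ l₀, ∀ s ∈ Icc (0 : ℝ) 1,
    B ((1 - s) * a l + s * b l, (1 - s) * a l ^ 2 + s * b l ^ 2) = (1 - s) * f (a l) + s * f (b l)

/-! ### The multibirdie and its surroundings -/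

/-- The union of the multibirdie, the chordal domains below it, and the two tangent domains around
it. -/
def multibirdieDomain (ε : ℝ) (k : ℕ) (aL aR : ℕ → ℝ) (u₁ u₂ : EReal) (a b : ℕ → ℝ → ℝ)
    (lam : ℕ → ℝ) : Set (ℝ × ℝ) :=
  tangR ε u₁ (aL 1) ∪ multibirdie ε k aL aR ∪
    (⋃ i ∈ Ico 1 k, chordal (a i) (b i) (lam i) (aL (i + 1) - aR i)) ∪ tangL ε (aR k) u₂

/-- `B` is a continuous function on `multibirdieDomain` that coincides with the standard candidate
on each subdomain, the forces on the two tangent domains being `gR` and `gL`. The `i`-th chordal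
domain, with the functions `a i`, `b i` on `[lam i, aL (i + 1) - aR i]`, has the upper chord over
`[aR i, aL (i + 1)]`. -/
structure IsMultibirdieCandidate (f : ℝ → ℝ) (ε : ℝ) (k : ℕ) (aL aR : ℕ → ℝ) (u₁ u₂ : EReal)
    (a b : ℕ → ℝ → ℝ) (lam : ℕ → ℝ) (gR gL : ℝ → ℝ) (B : ℝ × ℝ → ℝ) : Prop where
  continuous : ContinuousOn B (multibirdieDomain ε k aL aR u₁ u₂ a b lam)
  right : ∃ m, IsStdTangR f ε u₁ (aL 1) ∅ m B ∧ HasForce ε u₁ (aL 1) m gR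
  left : ∃ m, IsStdTangL f ε (aR k) u₂ ∅ m B ∧ HasForce ε (aR k) u₂ m gL
  onMultibirdie : IsStdLinear f (⋃ i ∈ Icc 1 k, Icc (aL i) (aR i)) (multibirdie ε k aL aR) B
  top_a : ∀ i ∈ Ico 1 k, a i (aL (i + 1) - aR i) = aR i
  top_b : ∀ i ∈ Ico 1 k, b i (aL (i + 1) - aR i) = aL (i + 1)
  chordalDomains : ∀ i ∈ Ico 1 k, IsStdChordal f (a i) (b i) (lam i) (aL (i + 1) - aR i) B

/-- `b_i(l_i)`, with the agreement `b_0 = u₁`. -/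
def bExt (u₁ : EReal) (b : ℕ → ℝ → ℝ) (l : ℕ → ℝ) (i : ℕ) : EReal :=
  if i = 0 then u₁ else ((b i (l i) : ℝ) : EReal)

/-- `a_i(l_i)`, with the agreement `a_k = u₂`. -/
def aExt (k : ℕ) (u₂ : EReal) (a : ℕ → ℝ → ℝ) (l : ℕ → ℝ) (i : ℕ) : EReal :=
  if i = k then u₂ else ((a i (l i) : ℝ) : EReal)

/-- The union of the figures after the disintegration: `j - 1` right trolleybuses, an angle with
the vertex `w`, and `k - j` left trolleybuses, separated by tangent domains and sitting on chordal
domains whose upper chords have lengths `l i`. -/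
def disintegratedDomain (ε : ℝ) (k j : ℕ) (w : ℝ) (u₁ u₂ : EReal) (a b : ℕ → ℝ → ℝ)
    (lam l : ℕ → ℝ) : Set (ℝ × ℝ) :=
  (⋃ i ∈ Ico 0 (j - 1), tangR ε (bExt u₁ b l i) (aExt k u₂ a l (i + 1))) ∪
  (⋃ i ∈ Ico 1 j, trolleyR ε (a i (l i)) (b i (l i))) ∪
  tangR ε (bExt u₁ b l (j - 1)) w ∪ angle ε w ∪ tangL ε w (aExt k u₂ a l j) ∪
  (⋃ i ∈ Ico j k, trolleyL ε (a i (l i)) (b i (l i))) ∪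
  (⋃ i ∈ Ico j k, tangL ε (bExt u₁ b l i) (aExt k u₂ a l (i + 1))) ∪
  (⋃ i ∈ Ico 1 k, chordal (a i) (b i) (lam i) (l i))

/-- `B` is a continuous function on `disintegratedDomain` that coincides with the standard candidate
on each subdomain; the force on the tangent domain that starts at `u₁` is `gR`, the force on the
tangent domain that ends at `u₂` is `gL`. See `IsStdTangR` for the role of `Z`. -/
structure IsDisintegratedCandidate (f : ℝ → ℝ) (ε : ℝ) (k j : ℕ) (w : ℝ) (u₁ u₂ : EReal)
    (a b : ℕ → ℝ → ℝ) (lam l : ℕ → ℝ) (Z : Set ℝ) (gR gL : ℝ → ℝ) (B : ℝ × ℝ → ℝ) : Prop where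
  continuous : ContinuousOn B (disintegratedDomain ε k j w u₁ u₂ a b lam l)
  right : ∀ i ∈ Ico 0 (j - 1), ∃ m,
    IsStdTangR f ε (bExt u₁ b l i) (aExt k u₂ a l (i + 1)) Z m B ∧
      (i = 0 → HasForce ε (bExt u₁ b l i) (aExt k u₂ a l (i + 1)) m gR)
  rightTrolleybuses : ∀ i ∈ Ico 1 j,
    IsStdLinear f {a i (l i), b i (l i)} (trolleyR ε (a i (l i)) (b i (l i))) B
  rightOfAngle : ∃ m, IsStdTangR f ε (bExt u₁ b l (j - 1)) w Z m B ∧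
    (j = 1 → HasForce ε (bExt u₁ b l (j - 1)) w m gR)
  onAngle : IsStdLinear f {w} (angle ε w) B
  leftOfAngle : ∃ m, IsStdTangL f ε w (aExt k u₂ a l j) Z m B ∧
    (j = k → HasForce ε w (aExt k u₂ a l j) m gL)
  leftTrolleybuses : ∀ i ∈ Ico j k,
    IsStdLinear f {a i (l i), b i (l i)} (trolleyL ε (a i (l i)) (b i (l i))) B
  left : ∀ i ∈ Ico j k, ∃ m,
    IsStdTangL f ε (bExt u₁ b l i) (aExt k u₂ a l (i + 1)) Z m B ∧
      (i + 1 = k → HasForce ε (bExt u₁ b l i) (aExt k u₂ a l (i + 1)) m gL)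
  chordalDomains : ∀ i ∈ Ico 1 k, IsStdChordal f (a i) (b i) (lam i) (l i) B

/-- The points that lie in non-degenerate intervals `[aL i, aR i]`, `1 ≤ i ≤ k`. -/
def solidArcs (k : ℕ) (aL aR : ℕ → ℝ) : Set ℝ :=
  {t | ∃ i ∈ Icc 1 k, aL i < aR i ∧ t ∈ Icc (aL i) (aR i)}

end BellmanStrip

end

open Set MeasureTheory Topology

noncomputable section

namespace BellmanStrip

/-! ### Integration by parts for Stieltjes integrals -/

/-! With J(v) = ∫_0^v e^{t/ε} f''(t) dt, every right force has the form F(v) = f''(v) + e^{-v/ε} (K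
- J(v)/ε) (`frc`), an integrated version of F' = f''' - F/ε; only the constant K distinguishes the
sources. The slope is m = f' - ε (f'' - F). An affine piece with x₂-coefficient M/2, tangent to the
boundary curve at t, agrees with a right tangent domain along the tangent at t exactly when F(t) =
f''(t) - M. Hence a right force must enter a chord with the value D_L and leave it with the value
D_R. Left forces are, up to sign, right forces of t ↦ f(-t), so each left statement follows by
reflection.

The affine function on the multibirdie fixes one number M₀: f'' = M₀ on the solid arcs, ⟨f''⟩ = M₀
over every connecting chord, and the two incoming forces have the values prescribed by M₀
(`exists_isArcSystem`). So at ε = η₁ the right force, continued through the arcs, meets every upper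
chord exactly, and so does the left one.

Two monotonicity facts govern ε > η₁. If F_ε ≤ 0 on the way and ε < ε', then the inequality F_{ε'} <
F_ε is transported to the right (`frc_compare`). Along a chordal domain, the constant K of a force
that takes the value D_L at a(l), or D_R at b(l), increases strictly with l; the second case needs l
< 2ε (`strictMonoOn_kap_a`, `strictMonoOn_kap_b`). A right force that decreases in ε therefore
selects a unique chord, whose length decreases continuously in ε, and that chord emits a right force
that again decreases in ε (`exists_step`). Induction over the arcs gives lengths `lR i`; reflection
gives lengths `lL i` for the left force. The required lengths are the minima of the two.

The angle is located by the balance, the sum of the right and left forces. Its sign at the ends of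
the selected chords decides which of `lR i`, `lL i` is smaller, and nonpositivity of the balance
propagates to the left wherever the right force is negative or the left force is positive. So there
is one index j before which the right length is the smaller and from which on the left one is
(`exists_switch`); between the chords j - 1 and j the balance has a root w, where the two affine
extensions coincide.

Candidates are then glued along closed figures that overlap only where their formulas agree
(`IsForceConfig.exists_candidate`). -/

lemma monotoneOn_Icc_of_Ioo {g : ℝ → ℝ} (hg : Continuous g) {x y : ℝ}
    (h : MonotoneOn g (Ioo x y)) : MonotoneOn g (Icc x y) := by
  rcases le_or_gt y x with hxy | hxy
  · intro p hp q hq _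
    have : p = q := by
      have := hp.1; have := hp.2; have := hq.1; have := hq.2; linarith
    rw [this]
  have hmid : ∀ p ∈ Ioo x y, ∀ q ∈ Icc p y, g p ≤ g q := by
    intro p hp q hq
    have hcl : Icc p y = closure (Ioo p y) := (closure_Ioo hp.2.ne).symm
    rw [hcl] at hq
    exact closure_minimal (s := Ioo p y) (t := {q | g p ≤ g q})
      (fun r hr => h hp ⟨hp.1.trans hr.1, hr.2⟩ hr.1.le)
      (isClosed_le continuous_const hg) hq
  intro p hp q hq hpq
  rcases hpq.eq_or_lt with rfl | hlt
  · exact le_rfl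
  have hpc : p ∈ closure (Ioo p q) := by rw [closure_Ioo hlt.ne]; exact ⟨le_rfl, hlt.le⟩
  exact closure_minimal (s := Ioo p q) (t := {r | g r ≤ g q})
      (fun r hr => hmid r ⟨hp.1.trans_lt hr.1, hr.2.trans_le hq.2⟩ q ⟨hr.2.le, hq.2⟩)
      (isClosed_le hg continuous_const) hpc

/-- Induction on the exceptional set: an exceptional point inside the interval cuts it in two, and
on each half one point fewer matters. Without exceptional points the function is monotone on the
open interval, and continuity extends this to the ends. -/
lemma boundedVariationOn_Icc_of_piecewise {g : ℝ → ℝ} (hg : Continuous g) (S : Finset ℝ) :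
    ∀ x y : ℝ, x ≤ y → (∀ I ⊆ Ioo x y, I.OrdConnected → Disjoint I (S : Set ℝ) →
      MonotoneOn g I ∨ AntitoneOn g I) → BoundedVariationOn g (Icc x y) := by
  classical
  induction S using Finset.induction_on with
  | empty =>
    intro x y hxy h
    have hmono : ∀ k : ℝ → ℝ, Continuous k → MonotoneOn k (Ioo x y) →
        BoundedVariationOn k (Icc x y) := by
      intro k hk hm
      have := (monotoneOn_Icc_of_Ioo hk hm).locallyBoundedVariationOn x y
        ⟨le_rfl, hxy⟩ ⟨hxy, le_rfl⟩
      rwa [inter_self] at this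
    rcases h (Ioo x y) subset_rfl ordConnected_Ioo (by simp) with h | h
    · exact hmono g hg h
    · have := hmono (fun t => -g t) hg.neg h.neg
      rw [BoundedVariationOn, eVariationOn] at this ⊢
      simpa [edist_neg_neg] using this
  | insert m S _ ih =>
    intro x y hxy h
    by_cases hm : m ∈ Ioo x y
    · have h1 := ih x m hm.1.le (fun I hI hc hd => h I (hI.trans (Ioo_subset_Ioo_right hm.2.le)) hc
        (by
          rw [Finset.coe_insert, Set.disjoint_insert_right]
          exact ⟨fun hmI => (hI hmI).2.false, hd⟩))
      have h2 := ih m y hm.2.le (fun I hI hc hd => h I (hI.trans (Ioo_subset_Ioo_left hm.1.le)) hc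
        (by
          rw [Finset.coe_insert, Set.disjoint_insert_right]
          exact ⟨fun hmI => (hI hmI).1.false, hd⟩))
      have := eVariationOn.Icc_add_Icc g (s := univ) hm.1.le hm.2.le (mem_univ m)
      simp only [univ_inter] at this
      rw [BoundedVariationOn] at h1 h2 ⊢
      rw [← this]
      exact ENNReal.add_ne_top.2 ⟨h1, h2⟩
    · exact ih x y hxy (fun I hI hc hd => h I hI hc
        (by
          rw [Finset.coe_insert, Set.disjoint_insert_right]
          exact ⟨fun hmI => hm (hI hmI), hd⟩))

lemma Regular.contDiff_deriv {f : ℝ → ℝ} (h : Regular f) : ContDiff ℝ 1 (deriv f) := by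
  have h2 : ContDiff ℝ (1 + 1) f := by
    have := h.1
    norm_num
    exact this
  exact (contDiff_succ_iff_deriv.1 h2).2.2

lemma Regular.continuous_deriv2 {f : ℝ → ℝ} (h : Regular f) : Continuous (deriv (deriv f)) :=
  h.contDiff_deriv.continuous_deriv le_rfl

lemma Regular.locallyBoundedVariationOn {f : ℝ → ℝ} (h : Regular f) :
    LocallyBoundedVariationOn (deriv (deriv f)) univ := by
  obtain ⟨S, hS⟩ := h.2
  intro x y _ _
  rw [univ_inter]
  rcases le_or_gt x y with hxy | hxy
  · exact boundedVariationOn_Icc_of_piecewise h.continuous_deriv2 S x y hxy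
      (fun I _ hc hd => hS I hc hd)
  · rw [Icc_eq_empty hxy.not_ge, BoundedVariationOn, eVariationOn.subsingleton _ (by simp)]
    exact ENNReal.zero_ne_top

/-- Integration by parts against a Stieltjes measure. -/
lemma stieltjes_integral_by_parts (P : StieltjesFunction ℝ) {φ φ' : ℝ → ℝ}
    (hφ : ∀ t, HasDerivAt φ (φ' t) t) (hφ' : Continuous φ') {b v : ℝ} (hbv : b ≤ v) :
    ∫ t in Ioc b v, φ t ∂P.measure =
      φ v * (P v - P b) - ∫ s in Ioc b v, φ' s * (P s - P b) := by
  have hφc : Continuous φ := continuous_iff_continuousAt.2 fun t => (hφ t).continuousAt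
  have hfin : P.measure (Ioc b v) ≠ ⊤ := by rw [P.measure_Ioc]; exact ENNReal.ofReal_ne_top
  have : IsFiniteMeasure (P.measure.restrict (Ioc b v)) := ⟨by simp⟩
  have hint : IntegrableOn φ (Ioc b v) P.measure :=
    (hφc.continuousOn.integrableOn_compact isCompact_Icc).mono_set Ioc_subset_Icc_self
  have hconst : IntegrableOn (fun _ : ℝ => φ v) (Ioc b v) P.measure := integrable_const _
  have hm : P.measure.real (Ioc b v) = P v - P b := by
    rw [Measure.real, P.measure_Ioc, ENNReal.toReal_ofReal]
    exact sub_nonneg.2 (P.mono hbv)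
  -- Fubini for the kernel φ'(s) 1_{t ≤ s}: integration in s produces φ v - φ t, integration in t
  -- against dP produces φ'(s) (P s - P b).
  let F : ℝ → ℝ → ℝ := fun t s => ({p : ℝ × ℝ | p.1 ≤ p.2}).indicator (fun p => φ' p.2) (t, s)
  have hFint : Integrable (Function.uncurry F)
      ((P.measure.restrict (Ioc b v)).prod (volume.restrict (Ioc b v))) := by
    have : Integrable (fun p : ℝ × ℝ => φ' p.2)
        ((P.measure.restrict (Ioc b v)).prod (volume.restrict (Ioc b v))) := by
      have h1 : Integrable φ' (volume.restrict (Ioc b v)) :=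
        (hφ'.continuousOn.integrableOn_compact isCompact_Icc).mono_set Ioc_subset_Icc_self
      exact h1.comp_snd _
    exact this.indicator (measurableSet_le measurable_fst measurable_snd)
  have hswap := integral_integral_swap hFint
  have hleft : ∀ t ∈ Ioc b v, ∫ s in Ioc b v, F t s = φ v - φ t := by
    intro t ht
    have h1 : ∀ s, F t s = (Ici t).indicator φ' s := fun s => by
      simp only [F, indicator, mem_ofPred_eq, mem_Ici]
    simp_rw [h1]
    rw [setIntegral_indicator measurableSet_Ici]
    have h2 : Ioc b v ∩ Ici t = Icc t v := by
      ext s; simp only [mem_inter_iff, mem_Ioc, mem_Ici, mem_Icc]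
      constructor
      · rintro ⟨⟨_, h⟩, h'⟩; exact ⟨h', h⟩
      · rintro ⟨h, h'⟩; exact ⟨⟨ht.1.trans_le h, h'⟩, h⟩
    rw [h2, integral_Icc_eq_integral_Ioc, ← intervalIntegral.integral_of_le ht.2,
      intervalIntegral.integral_eq_sub_of_hasDerivAt (fun x _ => hφ x)
        (hφ'.intervalIntegrable _ _)]
  have hright : ∀ s ∈ Ioc b v, ∫ t in Ioc b v, F t s ∂P.measure = φ' s * (P s - P b) := by
    intro s hs
    have h1 : ∀ t, F t s = (Iic s).indicator (fun _ => φ' s) t := fun t => by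
      simp only [F, indicator, mem_ofPred_eq, mem_Iic]
    simp_rw [h1]
    rw [setIntegral_indicator measurableSet_Iic]
    have h2 : Ioc b v ∩ Iic s = Ioc b s := by
      ext t; simp only [mem_inter_iff, mem_Ioc, mem_Iic]
      constructor
      · rintro ⟨⟨h, _⟩, h'⟩; exact ⟨h, h'⟩
      · rintro ⟨h, h'⟩; exact ⟨⟨h, h'.trans hs.2⟩, h'⟩
    rw [h2, setIntegral_const, Measure.real, P.measure_Ioc, ENNReal.toReal_ofReal
      (sub_nonneg.2 (P.mono hs.1.le)), smul_eq_mul, mul_comm]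
  rw [setIntegral_congr_fun measurableSet_Ioc hleft,
    setIntegral_congr_fun measurableSet_Ioc hright, integral_sub hconst hint,
    setIntegral_const, hm, smul_eq_mul] at hswap
  linarith

/-- The Stieltjes functions are right limits of the Jordan parts. The two limits differ by the right
limit of g, which is g itself, so continuity of the variation function is not needed. -/
lemma jordan_rightLim_sub {g : ℝ → ℝ} (hgc : Continuous g)
    (hg : LocallyBoundedVariationOn g univ) (x : ℝ) :
    (jordanPos_monotone hg).stieltjesFunction x - (jordanNeg_monotone hg).stieltjesFunction x
      = g x := by
  rw [Monotone.stieltjesFunction_eq, Monotone.stieltjesFunction_eq]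
  have h1 := (jordanPos_monotone hg).tendsto_rightLim x
  have h2 := (jordanNeg_monotone hg).tendsto_rightLim x
  have h3 := h1.sub h2
  have h4 : (fun x => jordanPos g x - jordanNeg g x) = g := by
    funext y; simp only [jordanPos, jordanNeg]; ring
  rw [h4] at h3
  exact tendsto_nhds_unique h3 (hgc.continuousAt.continuousWithinAt)

lemma posVar_eq {g : ℝ → ℝ} (hg : LocallyBoundedVariationOn g univ) :
    posVar g = (jordanPos_monotone hg).stieltjesFunction.measure := by
  rw [posVar, dif_pos hg]

lemma negVar_eq {g : ℝ → ℝ} (hg : LocallyBoundedVariationOn g univ) :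
    negVar g = (jordanNeg_monotone hg).stieltjesFunction.measure := by
  rw [negVar, dif_pos hg]

/-- Integration by parts in the Stieltjes integral against a continuous function of locally
bounded variation. -/
lemma stieltjesInt_Ioc {g : ℝ → ℝ} (hgc : Continuous g)
    (hg : LocallyBoundedVariationOn g univ) {φ φ' : ℝ → ℝ}
    (hφ : ∀ t, HasDerivAt φ (φ' t) t) (hφ' : Continuous φ') {b v : ℝ} (hbv : b ≤ v) :
    stieltjesInt g φ (Ioc b v) = φ v * g v - φ b * g b - ∫ t in b..v, φ' t * g t := by
  rw [stieltjesInt, posVar_eq hg, negVar_eq hg, stieltjes_integral_by_parts _ hφ hφ' hbv,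
    stieltjes_integral_by_parts _ hφ hφ' hbv]
  set P := (jordanPos_monotone hg).stieltjesFunction
  set N := (jordanNeg_monotone hg).stieltjesFunction
  have hPN : ∀ x, P x - N x = g x := jordan_rightLim_sub hgc hg
  have hi : ∀ Q : StieltjesFunction ℝ,
      IntegrableOn (fun s => φ' s * (Q s - Q b)) (Ioc b v) := by
    intro Q
    have hQ : IntegrableOn (fun s => Q s - Q b) (Icc b v) :=
      ((Q.mono.monotoneOn _).integrableOn_isCompact isCompact_Icc).sub
        (integrable_const _)
    exact (hQ.continuousOn_mul hφ'.continuousOn isCompact_Icc).mono_set Ioc_subset_Icc_self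
  have h1 : (∫ s in Ioc b v, φ' s * (P s - P b)) - ∫ s in Ioc b v, φ' s * (N s - N b)
      = ∫ s in b..v, φ' s * (g s - g b) := by
    rw [← integral_sub (hi P) (hi N), intervalIntegral.integral_of_le hbv]
    congr 1; funext s
    rw [← hPN s, ← hPN b]; ring
  have h2 : ∫ s in b..v, φ' s * (g s - g b) = (∫ t in b..v, φ' t * g t) - (φ v - φ b) * g b := by
    rw [← intervalIntegral.integral_eq_sub_of_hasDerivAt (fun x _ => hφ x)
        (hφ'.intervalIntegrable b v), ← intervalIntegral.integral_mul_const,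
        ← intervalIntegral.integral_sub (f := fun t => φ' t * g t) (g := fun t => φ' t * g b)
          ((hφ'.mul hgc).intervalIntegrable _ _)
          ((hφ'.mul continuous_const).intervalIntegrable _ _)]
    congr 1; funext s; ring
  have h3 : P v - P b - (N v - N b) = g v - g b := by rw [← hPN v, ← hPN b]; ring
  have h4 : φ v * (P v - P b) - (φ v * (N v - N b)) = φ v * (g v - g b) := by
    rw [← mul_sub, h3]
  linarith

/-! ### Consequences of summability -/

/-- For t ≤ 0 one has t/ε ≤ t/E = -|t|/E, and for 0 ≤ t ≤ v the constant factor absorbs both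
exponentials. Thus summability with the parameter E dominates the kernels of all forces with ε ≤ E.
-/
lemma exp_div_le_of_le {ε E v t : ℝ} (hε : 0 < ε) (hεE : ε ≤ E) (htv : t ≤ v) :
    Real.exp (t / ε) ≤ Real.exp (|v| / ε + |v| / E) * Real.exp (-|t| / E) := by
  rw [← Real.exp_add, Real.exp_le_exp]
  have hE : 0 < E := hε.trans_le hεE
  rcases le_total t 0 with h | h
  · rw [abs_of_nonpos h, neg_neg]
    have h1 : t / ε ≤ t / E := by
      have := div_le_div_of_nonneg_left (neg_nonneg.2 h) hε hεE
      rw [neg_div, neg_div] at this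
      linarith
    have : 0 ≤ |v| / ε + |v| / E := by positivity
    linarith
  · have h2 : t ≤ |v| := htv.trans (le_abs_self v)
    rw [abs_of_nonneg h, neg_div]
    have h3 : t / ε ≤ |v| / ε := by gcongr
    have h4 : t / E ≤ |v| / E := by gcongr
    linarith

lemma Summability.integrableOn_Iic {f : ℝ → ℝ} {E ε : ℝ} (h : Summability f E) (hε : 0 < ε)
    (hεE : ε ≤ E) (v : ℝ) :
    IntegrableOn (fun t => Real.exp (t / ε)) (Iic v)
      (posVar (deriv (deriv f)) + negVar (deriv (deriv f))) := by
  refine Integrable.mono' ((h.const_mul (Real.exp (|v| / ε + |v| / E))).integrableOn (s := Iic v))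
    (by fun_prop) ?_
  filter_upwards [ae_restrict_mem measurableSet_Iic] with t ht
  rw [Real.norm_eq_abs, abs_of_pos (Real.exp_pos _)]
  exact exp_div_le_of_le hε hεE ht

lemma Summability.integrableOn_Ioi {f : ℝ → ℝ} {E ε : ℝ} (h : Summability f E) (hε : 0 < ε)
    (hεE : ε ≤ E) (v : ℝ) :
    IntegrableOn (fun t => Real.exp (-t / ε)) (Ioi v)
      (posVar (deriv (deriv f)) + negVar (deriv (deriv f))) := by
  refine Integrable.mono' ((h.const_mul (Real.exp (|v| / ε + |v| / E))).integrableOn (s := Ioi v))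
    (by fun_prop) ?_
  filter_upwards [ae_restrict_mem measurableSet_Ioi] with t ht
  rw [Real.norm_eq_abs, abs_of_pos (Real.exp_pos _)]
  have := exp_div_le_of_le hε hεE (neg_le_neg (le_of_lt ht))
  rwa [abs_neg, abs_neg] at this

lemma stieltjesInt_Iic_sub {g φ : ℝ → ℝ}
    (h : ∀ v, IntegrableOn φ (Iic v) (posVar g + negVar g)) {c v : ℝ} (hcv : c ≤ v) :
    stieltjesInt g φ (Iic v) = stieltjesInt g φ (Iic c) + stieltjesInt g φ (Ioc c v) := by
  have hv := h v
  rw [IntegrableOn, Measure.restrict_add, integrable_add_measure] at hv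
  simp only [stieltjesInt]
  rw [← Iic_union_Ioc_eq_Iic hcv, setIntegral_union (Iic_disjoint_Ioc le_rfl) measurableSet_Ioc
    (hv.1.mono_measure (Measure.restrict_mono (Iic_subset_Iic.2 hcv) le_rfl))
    (hv.1.mono_measure (Measure.restrict_mono Ioc_subset_Iic_self le_rfl)),
    setIntegral_union (Iic_disjoint_Ioc le_rfl) measurableSet_Ioc
    (hv.2.mono_measure (Measure.restrict_mono (Iic_subset_Iic.2 hcv) le_rfl))
    (hv.2.mono_measure (Measure.restrict_mono Ioc_subset_Iic_self le_rfl))]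
  ring

lemma stieltjesInt_Ioi_sub {g φ : ℝ → ℝ}
    (h : ∀ v, IntegrableOn φ (Ioi v) (posVar g + negVar g)) {c v : ℝ} (hcv : c ≤ v) :
    stieltjesInt g φ (Ioi c) = stieltjesInt g φ (Ioc c v) + stieltjesInt g φ (Ioi v) := by
  have hv := h c
  rw [IntegrableOn, Measure.restrict_add, integrable_add_measure] at hv
  simp only [stieltjesInt]
  rw [← Ioc_union_Ioi_eq_Ioi hcv, setIntegral_union (Ioc_disjoint_Ioi le_rfl) measurableSet_Ioi
    (hv.1.mono_measure (Measure.restrict_mono Ioc_subset_Ioi_self le_rfl))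
    (hv.1.mono_measure (Measure.restrict_mono (Ioi_subset_Ioi hcv) le_rfl)),
    setIntegral_union (Ioc_disjoint_Ioi le_rfl) measurableSet_Ioi
    (hv.2.mono_measure (Measure.restrict_mono Ioc_subset_Ioi_self le_rfl))
    (hv.2.mono_measure (Measure.restrict_mono (Ioi_subset_Ioi hcv) le_rfl))]
  ring

lemma tendsto_stieltjesInt_Iic {g φ : ℝ → ℝ}
    (h : ∀ v, IntegrableOn φ (Iic v) (posVar g + negVar g)) :
    Filter.Tendsto (fun c => stieltjesInt g φ (Iic c)) Filter.atBot (𝓝 0) := by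
  have hv := h 0
  rw [IntegrableOn, Measure.restrict_add, integrable_add_measure] at hv
  have h1 := (intervalIntegral_tendsto_integral_Iic 0 hv.1 Filter.tendsto_id).sub
    (intervalIntegral_tendsto_integral_Iic 0 hv.2 Filter.tendsto_id)
  have h2 := (tendsto_const_nhds (x := stieltjesInt g φ (Iic 0))).sub h1
  rw [stieltjesInt, sub_self] at h2
  refine h2.congr' ?_
  filter_upwards [Filter.eventually_le_atBot 0] with c hc
  have := stieltjesInt_Iic_sub h hc
  rw [id, intervalIntegral.integral_of_le hc, intervalIntegral.integral_of_le hc]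
  simp only [stieltjesInt] at this ⊢
  linarith

lemma tendsto_stieltjesInt_Ioi {g φ : ℝ → ℝ}
    (h : ∀ v, IntegrableOn φ (Ioi v) (posVar g + negVar g)) :
    Filter.Tendsto (fun c => stieltjesInt g φ (Ioi c)) Filter.atTop (𝓝 0) := by
  have hv := h 0
  rw [IntegrableOn, Measure.restrict_add, integrable_add_measure] at hv
  have h1 := (intervalIntegral_tendsto_integral_Ioi 0 hv.1 Filter.tendsto_id).sub
    (intervalIntegral_tendsto_integral_Ioi 0 hv.2 Filter.tendsto_id)
  have h2 := (tendsto_const_nhds (x := stieltjesInt g φ (Ioi 0))).sub h1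
  rw [stieltjesInt, sub_self] at h2
  refine h2.congr' ?_
  filter_upwards [Filter.eventually_ge_atTop 0] with c hc
  have := stieltjesInt_Ioi_sub h hc
  rw [id, intervalIntegral.integral_of_le hc, intervalIntegral.integral_of_le hc]
  simp only [stieltjesInt] at this ⊢
  linarith

/-- An increment of f'' is at most the mass of |df''| on the interval, where the weight e^{-|t|/E}
is bounded below by its value at the farther end from 0. -/
lemma exists_growth_deriv2 {f : ℝ → ℝ} {E : ℝ} (hf : Regular f) (h : Summability f E)
    (hE : 0 < E) : ∃ C, ∀ t, |deriv (deriv f) t| ≤ C * Real.exp (|t| / E) := by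
  set g := deriv (deriv f) with hg
  set μ := posVar g + negVar g with hμ
  set I := ∫ t, Real.exp (-|t| / E) ∂μ with hI
  have hbv := hf.locallyBoundedVariationOn
  have hgc : Continuous g := hf.continuous_deriv2
  have hint : Integrable (fun t : ℝ => Real.exp (-|t| / E)) μ := h
  have hint2 := integrable_add_measure.1 hint
  have key : ∀ b v, b ≤ v → |g v - g b| ≤ Real.exp (max |b| |v| / E) * I := by
    intro b v hv
    -- Integration by parts with φ = 1 identifies the increment of f'' with the df''-measure of the
    -- interval.
    have h1 := stieltjesInt_Ioc hgc hbv (φ := fun _ => 1) (φ' := fun _ => 0)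
      (fun t => hasDerivAt_const t 1) continuous_const hv
    simp only [one_mul, zero_mul, intervalIntegral.integral_zero, sub_zero, stieltjesInt] at h1
    have h2 : ∀ ν : Measure ℝ, Integrable (fun t : ℝ => Real.exp (-|t| / E)) ν →
        (0 ≤ ∫ t in Ioc b v, (1 : ℝ) ∂ν) ∧ ∫ t in Ioc b v, (1 : ℝ) ∂ν ≤
          Real.exp (max |b| |v| / E) * ∫ t, Real.exp (-|t| / E) ∂ν := by
      intro ν hν
      refine ⟨integral_nonneg fun _ => zero_le_one, ?_⟩
      have h3 : ∫ t in Ioc b v, (1 : ℝ) ∂ν ≤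
          ∫ t in Ioc b v, Real.exp (max |b| |v| / E) * Real.exp (-|t| / E) ∂ν := by
        refine integral_mono_of_nonneg (Filter.Eventually.of_forall fun _ => zero_le_one)
          (hν.const_mul _).integrableOn ?_
        filter_upwards [ae_restrict_mem measurableSet_Ioc] with t ht
        rw [← Real.exp_add, ← add_div]
        refine Real.one_le_exp (div_nonneg ?_ hE.le)
        have : |t| ≤ max |b| |v| := abs_le_max_abs_abs ht.1.le ht.2
        linarith
      refine h3.trans ?_
      rw [← integral_const_mul]
      exact setIntegral_le_integral (hν.const_mul _)
        (Filter.Eventually.of_forall fun _ => by positivity)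
    have hp := h2 _ hint2.1
    have hn := h2 _ hint2.2
    rw [hI, integral_add_measure hint2.1 hint2.2, mul_add, abs_le]
    constructor <;> linarith [hp.1, hp.2, hn.1, hn.2]
  have hI0 : 0 ≤ I := integral_nonneg fun _ => (Real.exp_pos _).le
  refine ⟨|g 0| + I, fun t => ?_⟩
  have h1 : |g t - g 0| ≤ Real.exp (|t| / E) * I := by
    rcases le_total 0 t with ht | ht
    · simpa using key 0 t ht
    · rw [abs_sub_comm]
      simpa using key t 0 ht
  have h2 : 1 ≤ Real.exp (|t| / E) := Real.one_le_exp (by positivity)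
  have h3 : |g t| ≤ |g 0| + |g t - g 0| := by
    have := abs_add_le (g 0) (g t - g 0)
    rwa [add_sub_cancel] at this
  nlinarith [abs_nonneg (g 0)]

/-! ### Forces as solutions of a linear equation -/

/-- The integral `∫_0^v exp (t / ε) f''(t) dt`. -/
def primJ (f : ℝ → ℝ) (ε v : ℝ) : ℝ := ∫ t in (0 : ℝ)..v, Real.exp (t / ε) * deriv (deriv f) t

/-- The right force with the integration constant `K`. -/
def frc (f : ℝ → ℝ) (ε K v : ℝ) : ℝ :=
  deriv (deriv f) v + Real.exp (-v / ε) * (K - primJ f ε v / ε)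

/-- The slope function whose force is `frc f ε K`. -/
def slope (f : ℝ → ℝ) (ε K v : ℝ) : ℝ :=
  deriv f v + Real.exp (-v / ε) * (ε * K - primJ f ε v)

/-- The integration constant of the force that takes the value `f''(p) - M` at `p`. -/
def kap (f : ℝ → ℝ) (ε p M : ℝ) : ℝ := -Real.exp (p / ε) * M + primJ f ε p / ε

/-! ### Regularity of forces and slopes in the point and in the parameter. -/

lemma contDiff_deriv_of_two {f : ℝ → ℝ} (hf : ContDiff ℝ 2 f) : ContDiff ℝ 1 (deriv f) := by
  have h2 : ContDiff ℝ (1 + 1) f := by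
    norm_num
    exact hf
  exact (contDiff_succ_iff_deriv.1 h2).2.2

lemma continuous_deriv_of_two {f : ℝ → ℝ} (hf : ContDiff ℝ 2 f) : Continuous (deriv f) :=
  (contDiff_deriv_of_two hf).continuous

lemma continuous_deriv2_of_two {f : ℝ → ℝ} (hf : ContDiff ℝ 2 f) : Continuous (deriv (deriv f)) :=
  (contDiff_deriv_of_two hf).continuous_deriv le_rfl

lemma hasDerivAt_of_two {f : ℝ → ℝ} (hf : ContDiff ℝ 2 f) (t : ℝ) : HasDerivAt f (deriv f t) t :=
  (hf.differentiable (by norm_num) t).hasDerivAt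

lemma hasDerivAt_deriv_of_two {f : ℝ → ℝ} (hf : ContDiff ℝ 2 f) (t : ℝ) :
    HasDerivAt (deriv f) (deriv (deriv f) t) t :=
  ((contDiff_deriv_of_two hf).differentiable (by norm_num) t).hasDerivAt

lemma hasDerivAt_primJ {f : ℝ → ℝ} (hf : ContDiff ℝ 2 f) (ε v : ℝ) :
    HasDerivAt (primJ f ε) (Real.exp (v / ε) * deriv (deriv f) v) v := by
  have hc : Continuous fun t => Real.exp (t / ε) * deriv (deriv f) t :=
    (by fun_prop : Continuous fun t : ℝ => Real.exp (t / ε)).mul (continuous_deriv2_of_two hf)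
  exact intervalIntegral.integral_hasDerivAt_right (hc.intervalIntegrable _ _)
    (hc.stronglyMeasurableAtFilter _ _) hc.continuousAt

/-- With 1/ε as the parameter the integrand is jointly continuous everywhere; the condition ε ≠ 0
enters only when 1/ε is substituted. -/
lemma continuous_primJ_inv {f : ℝ → ℝ} (hf : ContDiff ℝ 2 f) :
    Continuous fun p : ℝ × ℝ => ∫ t in (0 : ℝ)..p.2, Real.exp (t * p.1) * deriv (deriv f) t := by
  refine intervalIntegral.continuous_parametric_intervalIntegral_of_continuous
    (f := fun (p : ℝ × ℝ) (t : ℝ) => Real.exp (t * p.1) * deriv (deriv f) t) ?_ continuous_snd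
  exact (by fun_prop : Continuous fun q : (ℝ × ℝ) × ℝ => Real.exp (q.2 * q.1.1)).mul
    ((continuous_deriv2_of_two hf).comp continuous_snd)

lemma continuousOn_primJ {f : ℝ → ℝ} (hf : ContDiff ℝ 2 f) {s : Set ℝ} (hs : ∀ ε ∈ s, 0 < ε)
    {p : ℝ → ℝ} (hp : ContinuousOn p s) :
    ContinuousOn (fun ε => primJ f ε (p ε)) s := by
  have h := (continuous_primJ_inv hf).comp_continuousOn
    ((continuousOn_inv₀.mono fun ε hε => (hs ε hε).ne').prodMk hp)
  simpa only [primJ, div_eq_mul_inv, Function.comp_def] using h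

lemma continuousOn_frc {f : ℝ → ℝ} (hf : ContDiff ℝ 2 f) {s : Set ℝ} (hs : ∀ ε ∈ s, 0 < ε)
    {K p : ℝ → ℝ} (hK : ContinuousOn K s)
    (hp : ContinuousOn p s) : ContinuousOn (fun ε => frc f ε (K ε) (p ε)) s := by
  have hid : ContinuousOn (fun ε : ℝ => ε) s := continuousOn_id
  have h0 : ∀ ε ∈ s, ε ≠ 0 := fun ε hε => (hs ε hε).ne'
  exact ((continuous_deriv2_of_two hf).comp_continuousOn hp).add
    ((Real.continuous_exp.comp_continuousOn (hp.neg.div hid h0)).mul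
      (hK.sub ((continuousOn_primJ hf hs hp).div hid h0)))

lemma continuousOn_kap {f : ℝ → ℝ} (hf : ContDiff ℝ 2 f) {s : Set ℝ} (hs : ∀ ε ∈ s, 0 < ε)
    {M p : ℝ → ℝ} (hM : ContinuousOn M s)
    (hp : ContinuousOn p s) : ContinuousOn (fun ε => kap f ε (p ε) (M ε)) s := by
  have hid : ContinuousOn (fun ε : ℝ => ε) s := continuousOn_id
  have h0 : ∀ ε ∈ s, ε ≠ 0 := fun ε hε => (hs ε hε).ne'
  exact ((Real.continuous_exp.comp_continuousOn (hp.div hid h0)).neg.mul hM).add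
    ((continuousOn_primJ hf hs hp).div hid h0)

lemma hasDerivAt_exp_neg_div (ε v : ℝ) :
    HasDerivAt (fun v => Real.exp (-v / ε)) (-Real.exp (-v / ε) / ε) v := by
  have := (((hasDerivAt_id' v).fun_neg).div_const ε).exp
  exact this.congr_deriv (by ring)

/-- Since f'' is only continuous, the force need not be differentiable. The difference between the
force and f'' is, with derivative -F/ε, and this replaces the differential equation throughout. -/
lemma hasDerivAt_frc_aux {f : ℝ → ℝ} (hf : ContDiff ℝ 2 f) {ε : ℝ} (hε : 0 < ε) (K v : ℝ) :
    HasDerivAt (fun v => Real.exp (-v / ε) * (K - primJ f ε v / ε)) (-frc f ε K v / ε) v := by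
  have h1 := (hasDerivAt_exp_neg_div ε v).fun_mul
    (((hasDerivAt_primJ hf ε v).div_const ε).const_sub K)
  refine h1.congr_deriv ?_
  have h2 : Real.exp (-v / ε) * Real.exp (v / ε) = 1 := by
    rw [← Real.exp_add]; simp [neg_div]
  rw [neg_div] at h2
  rw [frc]
  field_simp
  linear_combination (-ε * deriv (deriv f) v) * h2

lemma hasDerivAt_slope {f : ℝ → ℝ} (hf : ContDiff ℝ 2 f) {ε : ℝ} (hε : 0 < ε) (K v : ℝ) :
    HasDerivAt (slope f ε K) (deriv (deriv f) v - frc f ε K v) v := by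
  have h1 := (hasDerivAt_deriv_of_two hf v).fun_add ((hasDerivAt_frc_aux hf hε K v).const_mul ε)
  have e : slope f ε K = fun w =>
      deriv f w + ε * (Real.exp (-w / ε) * (K - primJ f ε w / ε)) := by
    funext w
    simp only [slope]
    field_simp
  rw [e]
  refine h1.congr_deriv ?_
  field_simp
  ring

lemma deriv_slope {f : ℝ → ℝ} (hf : ContDiff ℝ 2 f) {ε : ℝ} (hε : 0 < ε) (K : ℝ) :
    deriv (slope f ε K) = fun v => -(Real.exp (-v / ε) * (K - primJ f ε v / ε)) := by
  funext v
  rw [(hasDerivAt_slope hf hε K v).deriv, frc]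
  ring

lemma deriv_deriv_slope {f : ℝ → ℝ} (hf : ContDiff ℝ 2 f) {ε : ℝ} (hε : 0 < ε) (K v : ℝ) :
    deriv (deriv (slope f ε K)) v = frc f ε K v / ε := by
  rw [deriv_slope hf hε K, (hasDerivAt_frc_aux hf hε K v).fun_neg.deriv]
  ring

lemma slope_ode {f : ℝ → ℝ} (hf : ContDiff ℝ 2 f) {ε : ℝ} (hε : 0 < ε) (K v : ℝ) :
    ε * deriv (slope f ε K) v + slope f ε K v - deriv f v = 0 := by
  rw [(hasDerivAt_slope hf hε K v).deriv, frc, slope]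
  field_simp
  ring

lemma continuous_slope {f : ℝ → ℝ} (hf : ContDiff ℝ 2 f) {ε : ℝ} (hε : 0 < ε) (K : ℝ) :
    Continuous (slope f ε K) :=
  continuous_iff_continuousAt.2 fun v => (hasDerivAt_slope hf hε K v).continuousAt

lemma continuous_frc {f : ℝ → ℝ} (hf : ContDiff ℝ 2 f) {ε : ℝ} (hε : 0 < ε) (K : ℝ) :
    Continuous (frc f ε K) :=
  (continuous_deriv2_of_two hf).add
    (continuous_iff_continuousAt.2 fun v => (hasDerivAt_frc_aux hf hε K v).continuousAt)

lemma slope_eq {f : ℝ → ℝ} {ε : ℝ} (hε : 0 < ε) (K v : ℝ) :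
    slope f ε K v = deriv f v - ε * (deriv (deriv f) v - frc f ε K v) := by
  rw [slope, frc]; field_simp; ring

/-- For fixed ε and p the value of a force is an increasing affine function of its constant.
Comparing a force with D_L or D_R at the end of a chord thus becomes comparing two constants, which
no longer involve the point. -/
lemma frc_sub {f : ℝ → ℝ} (ε K p M : ℝ) : frc f ε K p - (deriv (deriv f) p - M) =
    Real.exp (-p / ε) * (K - kap f ε p M) := by
  have h2 : Real.exp (-p / ε) * Real.exp (p / ε) = 1 := by
    rw [← Real.exp_add]; simp [neg_div]
  rw [frc, kap]
  linear_combination (-M) * h2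

lemma frc_lt_iff {f : ℝ → ℝ} (ε K p M : ℝ) :
    frc f ε K p < deriv (deriv f) p - M ↔ K < kap f ε p M := by
  rw [← sub_neg, frc_sub, ← sub_neg (a := K)]
  exact ⟨fun h => neg_of_mul_neg_right h (Real.exp_pos _).le,
    fun h => mul_neg_of_pos_of_neg (Real.exp_pos _) h⟩

lemma frc_eq_iff {f : ℝ → ℝ} (ε K p M : ℝ) :
    frc f ε K p = deriv (deriv f) p - M ↔ K = kap f ε p M := by
  rw [← sub_eq_zero, frc_sub, mul_eq_zero, or_iff_right (Real.exp_pos _).ne', sub_eq_zero]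

lemma frc_le_iff {f : ℝ → ℝ} (ε K p M : ℝ) :
    frc f ε K p ≤ deriv (deriv f) p - M ↔ K ≤ kap f ε p M := by
  rw [le_iff_lt_or_eq, frc_lt_iff, frc_eq_iff, ← le_iff_lt_or_eq]

lemma frc_lt_frc {f : ℝ → ℝ} {ε K K' v : ℝ} (h : K < K') : frc f ε K v < frc f ε K' v := by
  have := mul_lt_mul_of_pos_left h (Real.exp_pos (-v / ε))
  rw [frc, frc]
  linarith

/-- Comparison of forces with different parameters. -/
lemma frc_compare {f : ℝ → ℝ} (hf : ContDiff ℝ 2 f) {ε ε' K K' c v : ℝ} (hε : 0 < ε)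
    (hεε : ε < ε') (hcv : c ≤ v)
    (hneg : ∀ s ∈ Ioo c v, frc f ε K s ≤ 0) :
    (frc f ε' K' v - frc f ε K v) * Real.exp (v / ε') ≤
      (frc f ε' K' c - frc f ε K c) * Real.exp (c / ε') := by
  have hε' : 0 < ε' := hε.trans hεε
  -- In the difference of two forces f'' cancels, so the product is differentiable; its derivative
  -- F_ε (1/ε - 1/ε') e^{s/ε'} involves only the force with the smaller parameter.
  have hd : ∀ s, HasDerivAt (fun s => (frc f ε' K' s - frc f ε K s) * Real.exp (s / ε'))
      (frc f ε K s * (1 / ε - 1 / ε') * Real.exp (s / ε')) s := by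
    intro s
    have h1 := ((hasDerivAt_frc_aux hf hε' K' s).fun_sub (hasDerivAt_frc_aux hf hε K s)).fun_mul
      (((hasDerivAt_id' s).div_const ε').exp)
    have e : (fun s => (frc f ε' K' s - frc f ε K s) * Real.exp (s / ε')) = fun s =>
        (Real.exp (-s / ε') * (K' - primJ f ε' s / ε') -
          Real.exp (-s / ε) * (K - primJ f ε s / ε)) * Real.exp (s / ε') := by
      funext t
      simp only [frc]
      ring
    rw [e]
    refine h1.congr_deriv ?_
    simp only [frc]
    field_simp
    ring
  have := antitoneOn_of_deriv_nonpos (convex_Icc c v)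
    (fun s _ => (hd s).continuousAt.continuousWithinAt)
    (fun s _ => (hd s).differentiableAt.differentiableWithinAt)
    (fun s hs => by
      rw [interior_Icc] at hs
      rw [(hd s).deriv]
      have h3 : 0 < 1 / ε - 1 / ε' := sub_pos.2 (one_div_lt_one_div_of_lt hε hεε)
      exact mul_nonpos_of_nonpos_of_nonneg
        (mul_nonpos_of_nonpos_of_nonneg (hneg s hs) h3.le) (Real.exp_pos _).le)
  exact this ⟨le_rfl, hcv⟩ ⟨hcv, le_rfl⟩ hcv

lemma frc_lt_of_compare {f : ℝ → ℝ} (hf : ContDiff ℝ 2 f) {ε ε' K K' c v : ℝ} (hε : 0 < ε)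
    (hεε : ε < ε') (hcv : c ≤ v)
    (hneg : ∀ s ∈ Ioo c v, frc f ε K s ≤ 0) (hc : frc f ε' K' c < frc f ε K c) :
    frc f ε' K' v < frc f ε K v := by
  have h := frc_compare hf (K' := K') hε hεε hcv hneg
  have h1 : (frc f ε' K' c - frc f ε K c) * Real.exp (c / ε') < 0 :=
    mul_neg_of_neg_of_pos (sub_neg.2 hc) (Real.exp_pos _)
  exact sub_neg.1 (neg_of_mul_neg_left (h.trans_lt h1) (Real.exp_pos _).le)

lemma frc_le_of_compare {f : ℝ → ℝ} (hf : ContDiff ℝ 2 f) {ε ε' K K' c v : ℝ} (hε : 0 < ε)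
    (hεε : ε < ε') (hcv : c ≤ v)
    (hneg : ∀ s ∈ Ioo c v, frc f ε K s ≤ 0) (hc : frc f ε' K' c ≤ frc f ε K c) :
    frc f ε' K' v ≤ frc f ε K v := by
  have h := frc_compare hf (K' := K') hε hεε hcv hneg
  have h1 : (frc f ε' K' c - frc f ε K c) * Real.exp (c / ε') ≤ 0 :=
    mul_nonpos_of_nonpos_of_nonneg (sub_nonpos.2 hc) (Real.exp_pos _).le
  exact sub_nonpos.1 (nonpos_of_mul_nonpos_left (h.trans h1) (Real.exp_pos _))

/-- On an interval where `f''` is constant the force decays exponentially. -/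
lemma frc_of_const {f : ℝ → ℝ} (hf : ContDiff ℝ 2 f) {ε K c d v : ℝ} (hε : 0 < ε) (hv : v ∈ Icc c d)
    (hconst : ∀ t ∈ Icc c d, deriv (deriv f) t = deriv (deriv f) c) :
    frc f ε K v = frc f ε K c * Real.exp ((c - v) / ε) := by
  rcases hv.1.eq_or_lt with rfl | hcv
  · simp
  -- While f'' is constant, F(s) e^{s/ε} has zero derivative.
  have hd : ∀ s ∈ Icc c d, HasDerivWithinAt (fun s =>
      (Real.exp (-s / ε) * (K - primJ f ε s / ε) + deriv (deriv f) c) * Real.exp (s / ε)) 0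
      (Icc c d) s := by
    intro s hs
    have h1 := ((hasDerivAt_frc_aux hf hε K s).add_const (deriv (deriv f) c)).fun_mul
      (((hasDerivAt_id' s).div_const ε).exp)
    refine (h1.congr_deriv ?_).hasDerivWithinAt
    simp only [frc, hconst s hs]
    field_simp
    ring
  have h := (convex_Icc c d).is_const_of_fderivWithin_eq_zero (𝕜 := ℝ)
    (fun s hs => (hd s hs).differentiableWithinAt)
    (fun s hs => by
      rw [(hd s hs).hasFDerivWithinAt.fderivWithin (uniqueDiffOn_Icc (hcv.trans_le hv.2) s hs)]
      ext; simp)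
    hv ⟨le_rfl, hv.1.trans hv.2⟩
  have e1 : Real.exp ((c - v) / ε) = Real.exp (c / ε) * Real.exp (-v / ε) := by
    rw [← Real.exp_add]; ring_nf
  have e2 : Real.exp (v / ε) * Real.exp (-v / ε) = 1 := by
    rw [← Real.exp_add]; simp [neg_div]
  rw [frc, frc, hconst v hv, e1]
  linear_combination Real.exp (-v / ε) * h -
    (Real.exp (-v / ε) * (K - primJ f ε v / ε) + deriv (deriv f) c) * e2

/-! ### Chordal domains -/

/-- The functions `a`, `b` on `[lam, L]` parametrize the chords of a chordal domain. -/
structure IsChordFamily (f : ℝ → ℝ) (a b : ℝ → ℝ) (lam L : ℝ) : Prop where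
  nonneg : 0 ≤ lam
  lt : lam < L
  length : ∀ l ∈ Icc lam L, b l - a l = l
  continuous_a : ContinuousOn a (Icc lam L)
  continuous_b : ContinuousOn b (Icc lam L)
  diff_a : ∀ l ∈ Ioo lam L, DifferentiableAt ℝ a l ∧ deriv a l < 0
  diff_b : ∀ l ∈ Ioo lam L, DifferentiableAt ℝ b l ∧ 0 < deriv b l
  cup : ∀ l ∈ Icc lam L, 0 < l → CupEquation f (a l) (b l)
  differentials : ∀ l ∈ Icc lam L, 0 < l → DL f (a l) (b l) ≤ 0 ∧ DR f (a l) (b l) ≤ 0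
  differentials_strict : ∀ l ∈ Ioo lam L, DL f (a l) (b l) < 0 ∧ DR f (a l) (b l) < 0

lemma IsStdChordal.isChordFamily {f a b : ℝ → ℝ} {lam L : ℝ} {B : ℝ × ℝ → ℝ}
    (h : IsStdChordal f a b lam L B) : IsChordFamily f a b lam L :=
  ⟨h.nonneg, h.lt, h.length, h.continuous_a, h.continuous_b, h.diff_a, h.diff_b, h.cup,
    h.differentials, h.differentials_strict⟩

/-- The mean value of `f''` over the chord of length `l`. -/
def chordMean (f a b : ℝ → ℝ) (l : ℝ) : ℝ := avg (deriv (deriv f)) (a l) (b l)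

lemma avg_deriv {f : ℝ → ℝ} (hf : ContDiff ℝ 2 f) (a b : ℝ) :
    avg (deriv f) a b = (f b - f a) / (b - a) := by
  rw [avg, intervalIntegral.integral_eq_sub_of_hasDerivAt (fun x _ => hasDerivAt_of_two hf x)
    ((continuous_deriv_of_two hf).intervalIntegrable _ _)]

lemma avg_deriv2 {f : ℝ → ℝ} (hf : ContDiff ℝ 2 f) (a b : ℝ) :
    avg (deriv (deriv f)) a b = (deriv f b - deriv f a) / (b - a) := by
  rw [avg, intervalIntegral.integral_eq_sub_of_hasDerivAt
    (fun x _ => hasDerivAt_deriv_of_two hf x)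
    ((continuous_deriv2_of_two hf).intervalIntegrable _ _)]

/-! ### Behaviour of means and differentials under t ↦ -t. -/

lemma deriv2_reflect (f : ℝ → ℝ) :
    deriv (deriv (fun t => f (-t))) = fun t => deriv (deriv f) (-t) := by
  have hd : deriv (fun t => f (-t)) = fun t => -deriv f (-t) := by
    funext t; rw [deriv_comp_neg]
  funext t; rw [hd, deriv.fun_neg, deriv_comp_neg, neg_neg]

lemma deriv2_reflect_apply (f : ℝ → ℝ) (t : ℝ) :
    deriv (deriv (fun t => f (-t))) t = deriv (deriv f) (-t) := by rw [deriv2_reflect]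

lemma deriv_reflect (f : ℝ → ℝ) : deriv (fun t => f (-t)) = fun t => -deriv f (-t) := by
  funext t; rw [deriv_comp_neg]

lemma avg_reflect (k : ℝ → ℝ) (p q : ℝ) : avg (fun t => k (-t)) (-q) (-p) = avg k p q := by
  rw [avg, avg, intervalIntegral.integral_comp_neg, neg_neg, neg_neg]
  ring_nf

lemma avg_reflect_neg (k : ℝ → ℝ) (p q : ℝ) :
    avg (fun t => -k (-t)) (-q) (-p) = -avg k p q := by
  rw [← avg_reflect k, avg, avg, intervalIntegral.integral_neg, neg_div]

lemma DL_reflect (f : ℝ → ℝ) (p q : ℝ) : DL (fun t => f (-t)) (-q) (-p) = DR f p q := by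
  simp only [DL, DR, deriv2_reflect, avg_reflect, neg_neg]

lemma DR_reflect (f : ℝ → ℝ) (p q : ℝ) : DR (fun t => f (-t)) (-q) (-p) = DL f p q := by
  simp only [DL, DR, deriv2_reflect, avg_reflect, neg_neg]

lemma chordMean_reflect (f a b : ℝ → ℝ) (l : ℝ) :
    chordMean (fun t => f (-t)) (fun l => -b l) (fun l => -a l) l = chordMean f a b l := by
  rw [chordMean, chordMean, deriv2_reflect, avg_reflect]

namespace IsChordFamily

variable {f a b : ℝ → ℝ} {lam L : ℝ}

lemma mono (h : IsChordFamily f a b lam L) {l : ℝ} (hl : l ∈ Ioc lam L) :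
    IsChordFamily f a b lam l where
  nonneg := h.nonneg
  lt := hl.1
  length s hs := h.length s ⟨hs.1, hs.2.trans hl.2⟩
  continuous_a := h.continuous_a.mono (Icc_subset_Icc_right hl.2)
  continuous_b := h.continuous_b.mono (Icc_subset_Icc_right hl.2)
  diff_a s hs := h.diff_a s ⟨hs.1, hs.2.trans_le hl.2⟩
  diff_b s hs := h.diff_b s ⟨hs.1, hs.2.trans_le hl.2⟩
  cup s hs := h.cup s ⟨hs.1, hs.2.trans hl.2⟩
  differentials s hs := h.differentials s ⟨hs.1, hs.2.trans hl.2⟩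
  differentials_strict s hs := h.differentials_strict s ⟨hs.1, hs.2.trans_le hl.2⟩

lemma strictAntiOn (h : IsChordFamily f a b lam L) : StrictAntiOn a (Icc lam L) :=
  strictAntiOn_of_deriv_neg (convex_Icc _ _) h.continuous_a
    (fun l hl => (h.diff_a l (by rwa [interior_Icc] at hl)).2)

lemma strictMonoOn (h : IsChordFamily f a b lam L) : StrictMonoOn b (Icc lam L) :=
  strictMonoOn_of_deriv_pos (convex_Icc _ _) h.continuous_b
    (fun l hl => (h.diff_b l (by rwa [interior_Icc] at hl)).2)

lemma pos (h : IsChordFamily f a b lam L) {l : ℝ} (hl : l ∈ Ioc lam L) : 0 < l :=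
  h.nonneg.trans_lt hl.1

lemma lt_of_mem (h : IsChordFamily f a b lam L) {l : ℝ} (hl : l ∈ Ioc lam L) : a l < b l := by
  have := h.length l (Ioc_subset_Icc_self hl)
  have := h.pos hl
  linarith

lemma chordMean_eq (h : IsChordFamily f a b lam L) (hf : ContDiff ℝ 2 f) {l : ℝ}
    (hl : l ∈ Icc lam L) : chordMean f a b l = (deriv f (b l) - deriv f (a l)) / l := by
  rw [chordMean, avg_deriv2 hf, h.length l hl]

lemma cup_eq (h : IsChordFamily f a b lam L) (hf : ContDiff ℝ 2 f) {l : ℝ}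
    (hl : l ∈ Ioc lam L) :
    f (b l) - f (a l) = l * ((deriv f (a l) + deriv f (b l)) / 2) := by
  have h1 := h.cup l (Ioc_subset_Icc_self hl) (h.pos hl)
  rw [CupEquation, avg_deriv hf, h.length l (Ioc_subset_Icc_self hl)] at h1
  have := (h.pos hl).ne'
  rw [← h1]
  field_simp

lemma continuousOn_chordMean (h : IsChordFamily f a b lam L) (hf : ContDiff ℝ 2 f) :
    ContinuousOn (chordMean f a b) (Ioc lam L) := by
  have hc := continuous_deriv_of_two hf
  have : ContinuousOn (fun l => (deriv f (b l) - deriv f (a l)) / l) (Ioc lam L) :=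
    ((hc.comp_continuousOn (h.continuous_b.mono Ioc_subset_Icc_self)).sub
      (hc.comp_continuousOn (h.continuous_a.mono Ioc_subset_Icc_self))).div continuousOn_id
      fun l hl => (h.pos hl).ne'
  exact this.congr fun l hl => h.chordMean_eq hf (Ioc_subset_Icc_self hl)

/-- The derivatives of the ends of the chord and of the mean value of `f''` over it. -/
lemma hasDerivAt (h : IsChordFamily f a b lam L) (hf : ContDiff ℝ 2 f) {l : ℝ}
    (hl : l ∈ Ioo lam L) :
    deriv b l - deriv a l = 1 ∧
      DL f (a l) (b l) * deriv a l + DR f (a l) (b l) * deriv b l = 0 ∧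
      HasDerivAt (chordMean f a b)
        ((DR f (a l) (b l) * deriv b l - DL f (a l) (b l) * deriv a l) / l) l := by
  have hl' : l ∈ Ioc lam L := Ioo_subset_Ioc_self hl
  have hpos := h.pos hl'
  have hnhds : Ioo lam L ∈ 𝓝 l := Ioo_mem_nhds hl.1 hl.2
  have ha := (h.diff_a l hl).1.hasDerivAt
  have hb := (h.diff_b l hl).1.hasDerivAt
  have hfa : HasDerivAt (fun s => f (a s)) (deriv f (a l) * deriv a l) l :=
    (hasDerivAt_of_two hf (a l)).comp l ha
  have hfb : HasDerivAt (fun s => f (b s)) (deriv f (b l) * deriv b l) l :=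
    (hasDerivAt_of_two hf (b l)).comp l hb
  have hga : HasDerivAt (fun s => deriv f (a s)) (deriv (deriv f) (a l) * deriv a l) l :=
    (hasDerivAt_deriv_of_two hf (a l)).comp l ha
  have hgb : HasDerivAt (fun s => deriv f (b s)) (deriv (deriv f) (b l) * deriv b l) l :=
    (hasDerivAt_deriv_of_two hf (b l)).comp l hb
  have h1 : deriv b l - deriv a l = 1 := by
    have e : (fun s => b s - a s) =ᶠ[𝓝 l] fun s => s := by
      filter_upwards [hnhds] with s hs using h.length s (Ioo_subset_Icc_self hs)
    exact ((hb.fun_sub ha).congr_of_eventuallyEq e.symm).unique (hasDerivAt_id' l)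
  have hM := h.chordMean_eq hf (Ioo_subset_Icc_self hl)
  have hM' : deriv f (b l) - deriv f (a l) = chordMean f a b l * l := by
    rw [hM]; field_simp
  -- This is the cup equation differentiated in l, after b' = 1 + a' and the formula for the mean of
  -- f'' are inserted.
  have h2 : DL f (a l) (b l) * deriv a l + DR f (a l) (b l) * deriv b l = 0 := by
    have e : (fun s => f (b s) - f (a s)) =ᶠ[𝓝 l]
        fun s => s * ((deriv f (a s) + deriv f (b s)) / 2) := by
      filter_upwards [hnhds] with s hs using h.cup_eq hf (Ioo_subset_Ioc_self hs)
    have h3 := ((hfb.fun_sub hfa).congr_of_eventuallyEq e.symm).unique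
      ((hasDerivAt_id' l).fun_mul ((hga.fun_add hgb).div_const 2))
    have hb1 : deriv b l = 1 + deriv a l := by linarith
    change (deriv (deriv f) (a l) - chordMean f a b l) * deriv a l +
      (deriv (deriv f) (b l) - chordMean f a b l) * deriv b l = 0
    have h4 : l * ((deriv (deriv f) (a l) - chordMean f a b l) * deriv a l +
      (deriv (deriv f) (b l) - chordMean f a b l) * deriv b l) = 0 := by
      rw [hb1] at h3 ⊢
      linear_combination -2 * h3 + (2 * deriv a l + 1) * hM'
    exact (mul_eq_zero.1 h4).resolve_left hpos.ne'
  refine ⟨h1, h2, ?_⟩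
  have e : (fun s => (deriv f (b s) - deriv f (a s)) / s) =ᶠ[𝓝 l] chordMean f a b := by
    filter_upwards [hnhds] with s hs using (h.chordMean_eq hf (Ioo_subset_Icc_self hs)).symm
  refine (((hgb.fun_sub hga).fun_div (hasDerivAt_id' l) hpos.ne').congr_of_eventuallyEq
    e.symm).congr_deriv ?_
  change _ = ((deriv (deriv f) (b l) - chordMean f a b l) * deriv b l -
    (deriv (deriv f) (a l) - chordMean f a b l) * deriv a l) / l
  rw [hM']
  field_simp
  linear_combination chordMean f a b l * h1

lemma hasDerivAt_kap (hf : ContDiff ℝ 2 f) {p M : ℝ → ℝ} {p' M' ε l : ℝ}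
    (hp : HasDerivAt p p' l) (hM : HasDerivAt M M' l) :
    HasDerivAt (fun l => kap f ε (p l) (M l))
      (Real.exp (p l / ε) * ((deriv (deriv f) (p l) - M l) * p' / ε - M')) l := by
  have h1 := (((hp.div_const ε).exp.fun_neg).fun_mul hM).fun_add
    (((hasDerivAt_primJ hf ε (p l)).comp l hp).div_const ε)
  exact h1.congr_deriv (by ring)

lemma continuousOn_kap_comp (hf : ContDiff ℝ 2 f) {p M : ℝ → ℝ} {s : Set ℝ}
    (ε : ℝ) (hp : ContinuousOn p s) (hM : ContinuousOn M s) :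
    ContinuousOn (fun l => kap f ε (p l) (M l)) s := by
  have hJ : Continuous (primJ f ε) :=
    continuous_iff_continuousAt.2 fun v => (hasDerivAt_primJ hf ε v).continuousAt
  exact ((Real.continuous_exp.comp_continuousOn (hp.div_const ε)).neg.mul hM).add
    ((hJ.comp_continuousOn hp).div_const ε)

/-- The relation D_L a' = -D_R b' reduces the derivative to e^{a/ε} D_L a' (1/ε + 2/l), and D_L and
a' are both negative. -/
lemma strictMonoOn_kap_a (h : IsChordFamily f a b lam L) (hf : ContDiff ℝ 2 f) {ε : ℝ}
    (hε : 0 < ε) : StrictMonoOn (fun l => kap f ε (a l) (chordMean f a b l)) (Ioc lam L) := by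
  refine strictMonoOn_of_deriv_pos (convex_Ioc _ _)
    (continuousOn_kap_comp hf ε (h.continuous_a.mono Ioc_subset_Icc_self)
      (h.continuousOn_chordMean hf)) fun l hl => ?_
  rw [interior_Ioc] at hl
  obtain ⟨_, h2, h3⟩ := h.hasDerivAt hf hl
  rw [(hasDerivAt_kap hf (h.diff_a l hl).1.hasDerivAt h3).deriv]
  have hpos := h.pos (Ioo_subset_Ioc_self hl)
  have hD : 0 < DL f (a l) (b l) * deriv a l :=
    mul_pos_of_neg_of_neg (h.differentials_strict l hl).1 (h.diff_a l hl).2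
  refine mul_pos (Real.exp_pos _) ?_
  have e : (deriv (deriv f) (a l) - chordMean f a b l) * deriv a l / ε -
      (DR f (a l) (b l) * deriv b l - DL f (a l) (b l) * deriv a l) / l =
      DL f (a l) (b l) * deriv a l * (1 / ε + 2 / l) := by
    rw [eq_neg_of_add_eq_zero_right h2]
    change DL f (a l) (b l) * _ / _ - _ = _
    ring
  rw [e]
  positivity

/-- Here the derivative is e^{b/ε} D_R b' (1/ε - 2/l). The first product is negative, so the chords
must be shorter than 2ε for the last factor to be negative as well. -/
lemma strictMonoOn_kap_b (h : IsChordFamily f a b lam L) (hf : ContDiff ℝ 2 f) {ε : ℝ}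
    (hε : 0 < ε) (hL : L ≤ 2 * ε) :
    StrictMonoOn (fun l => kap f ε (b l) (chordMean f a b l)) (Ioc lam L) := by
  refine strictMonoOn_of_deriv_pos (convex_Ioc _ _)
    (continuousOn_kap_comp hf ε (h.continuous_b.mono Ioc_subset_Icc_self)
      (h.continuousOn_chordMean hf)) fun l hl => ?_
  rw [interior_Ioc] at hl
  obtain ⟨_, h2, h3⟩ := h.hasDerivAt hf hl
  rw [(hasDerivAt_kap hf (h.diff_b l hl).1.hasDerivAt h3).deriv]
  have hpos := h.pos (Ioo_subset_Ioc_self hl)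
  have hD : DR f (a l) (b l) * deriv b l < 0 :=
    mul_neg_of_neg_of_pos (h.differentials_strict l hl).2 (h.diff_b l hl).2
  refine mul_pos (Real.exp_pos _) ?_
  have e : (deriv (deriv f) (b l) - chordMean f a b l) * deriv b l / ε -
      (DR f (a l) (b l) * deriv b l - DL f (a l) (b l) * deriv a l) / l =
      DR f (a l) (b l) * deriv b l * (1 / ε - 2 / l) := by
    rw [eq_neg_of_add_eq_zero_left h2]
    change DR f (a l) (b l) * _ / _ - _ = _
    ring
  rw [e]
  refine mul_pos_of_neg_of_neg hD ?_
  have h4 : l < 2 * ε := hl.2.trans_le hL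
  rw [sub_neg, div_lt_div_iff₀ hε hpos]
  linarith

/-- The chords of a chordal domain in the reflected picture. -/
lemma reflect (h : IsChordFamily f a b lam L) :
    IsChordFamily (fun t => f (-t)) (fun l => -b l) (fun l => -a l) lam L := by
  refine ⟨h.nonneg, h.lt, fun l hl => ?_, h.continuous_b.neg, h.continuous_a.neg,
    fun l hl => ⟨(h.diff_b l hl).1.neg, ?_⟩, fun l hl => ⟨(h.diff_a l hl).1.neg, ?_⟩,
    fun l hl hl0 => ?_, fun l hl hl0 => ?_, fun l hl => ?_⟩
  · have := h.length l hl
    linarith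
  · rw [deriv.fun_neg]; linarith [(h.diff_b l hl).2]
  · rw [deriv.fun_neg]; linarith [(h.diff_a l hl).2]
  · have := h.cup l hl hl0
    rw [CupEquation] at this ⊢
    simp only [deriv_reflect, avg_reflect_neg, this, neg_neg]
    ring
  · rw [DL_reflect, DR_reflect]; exact (h.differentials l hl hl0).symm
  · rw [DL_reflect, DR_reflect]; exact (h.differentials_strict l hl).symm

end IsChordFamily

/-! ### Propagation of forces through chordal domains -/

lemma exists_Icc_of_eventually {η₁ η₃ : ℝ} (h : η₁ < η₃) {P : ℝ → Prop}
    (hP : ∀ᶠ ε in 𝓝[Icc η₁ η₃] η₁, P ε) : ∃ η₂, η₁ < η₂ ∧ η₂ ≤ η₃ ∧ ∀ ε ∈ Icc η₁ η₂, P ε := by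
  rw [nhdsWithin_Icc_eq_nhdsGE h] at hP
  obtain ⟨u, hu, hsub⟩ := mem_nhdsGE_iff_exists_Icc_subset.1 hP
  exact ⟨min u η₃, lt_min hu h, min_le_right _ _,
    fun ε hε => hsub ⟨hε.1, hε.2.trans (min_le_left _ _)⟩⟩

namespace IsChordFamily

variable {f a b : ℝ → ℝ} {lam L : ℝ}

lemma exists_eq_a (h : IsChordFamily f a b lam L) {l v : ℝ} (hl : l ∈ Icc lam L)
    (hv : v ∈ Icc (a L) (a l)) : ∃ s ∈ Icc l L, a s = v :=
  intermediate_value_Icc' hl.2 (h.continuous_a.mono (Icc_subset_Icc_left hl.1)) hv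

lemma exists_eq_b (h : IsChordFamily f a b lam L) {l v : ℝ} (hl : l ∈ Icc lam L)
    (hv : v ∈ Icc (b l) (b L)) : ∃ s ∈ Icc l L, b s = v :=
  intermediate_value_Icc hl.2 (h.continuous_b.mono (Icc_subset_Icc_left hl.1)) hv

/-- Monotonicity of the constants, read at the left ends of longer chords. Together with D_L ≤ 0 it
gives the sign of a force on its way to the chord that it selects. -/
lemma frc_a_le (h : IsChordFamily f a b lam L) (hf : ContDiff ℝ 2 f) {ε l s : ℝ} (hε : 0 < ε)
    (hl : l ∈ Ioc lam L) (hs : s ∈ Ioc lam L) (hls : l ≤ s) :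
    frc f ε (kap f ε (a l) (chordMean f a b l)) (a s) ≤ DL f (a s) (b s) :=
  (frc_le_iff ε _ (a s) (chordMean f a b s)).2 ((h.strictMonoOn_kap_a hf hε).monotoneOn hl hs hls)

lemma frc_b_le (h : IsChordFamily f a b lam L) (hf : ContDiff ℝ 2 f) {ε l s : ℝ} (hε : 0 < ε)
    (hL : L ≤ 2 * ε) (hl : l ∈ Ioc lam L) (hs : s ∈ Ioc lam L) (hls : l ≤ s) :
    frc f ε (kap f ε (b l) (chordMean f a b l)) (b s) ≤ DR f (a s) (b s) :=
  (frc_le_iff ε _ (b s) (chordMean f a b s)).2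
    ((h.strictMonoOn_kap_b hf hε hL).monotoneOn hl hs hls)

lemma frc_a (ε l : ℝ) :
    frc f ε (kap f ε (a l) (chordMean f a b l)) (a l) = DL f (a l) (b l) :=
  (frc_eq_iff ε _ (a l) (chordMean f a b l)).2 rfl

lemma frc_b (ε l : ℝ) :
    frc f ε (kap f ε (b l) (chordMean f a b l)) (b l) = DR f (a l) (b l) :=
  (frc_eq_iff ε _ (b l) (chordMean f a b l)).2 rfl

/-- A decreasing family of right forces arriving at a chordal domain determines a decreasing family
of its chords, and these chords emit a decreasing family of right forces. -/
lemma exists_step (h : IsChordFamily f a b lam L) (hf : ContDiff ℝ 2 f) {η₁ η₃ : ℝ} (hη : 0 < η₁)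
    (h13 : η₁ < η₃) (hL : L ≤ 2 * η₁) {K : ℝ → ℝ} (hKc : ContinuousOn K (Icc η₁ η₃))
    (hφ : StrictAntiOn (fun ε => frc f ε (K ε) (a L)) (Icc η₁ η₃))
    (hφ1 : frc f η₁ (K η₁) (a L) = DL f (a L) (b L)) :
    ∃ η₂, η₁ < η₂ ∧ η₂ ≤ η₃ ∧ ∃ l : ℝ → ℝ,
      ContinuousOn l (Icc η₁ η₂) ∧ StrictAntiOn l (Icc η₁ η₂) ∧ l η₁ = L ∧
      (∀ ε ∈ Icc η₁ η₂, l ε ∈ Ioc lam L ∧ kap f ε (a (l ε)) (chordMean f a b (l ε)) = K ε) ∧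
      ContinuousOn (fun ε => kap f ε (b (l ε)) (chordMean f a b (l ε))) (Icc η₁ η₂) ∧
      StrictAntiOn (fun ε => frc f ε (kap f ε (b (l ε)) (chordMean f a b (l ε))) (b L))
        (Icc η₁ η₂) := by
  classical
  have hLm : L ∈ Ioc lam L := ⟨h.lt, le_rfl⟩
  -- At η₁ the constant is that of the top chord, hence strictly above that of any shorter one, and
  -- this persists for nearby ε. A chord strictly inside the family keeps the selected lengths away
  -- from `lam`, where the chord may degenerate to a point.
  set l₀ := (lam + L) / 2 with hl₀
  have hl₀m : l₀ ∈ Ioc lam L := ⟨by have := h.lt; linarith, by have := h.lt; linarith⟩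
  have hl₀L : l₀ < L := by have := h.lt; linarith
  have hpos : ∀ ε ∈ Icc η₁ η₃, 0 < ε := fun ε hε => hη.trans_le hε.1
  have hcε : ∀ s, ContinuousOn (fun ε => kap f ε (a s) (chordMean f a b s)) (Icc η₁ η₃) :=
    fun s => continuousOn_kap hf hpos continuousOn_const continuousOn_const
  have hη₁m : η₁ ∈ Icc η₁ η₃ := ⟨le_rfl, h13.le⟩
  have hK1 : K η₁ = kap f η₁ (a L) (chordMean f a b L) := (frc_eq_iff _ _ _ _).1 hφ1
  have hev : ∀ᶠ ε in 𝓝[Icc η₁ η₃] η₁, kap f ε (a l₀) (chordMean f a b l₀) < K ε := by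
    refine ((hcε l₀) η₁ hη₁m).eventually_lt (hKc η₁ hη₁m) ?_
    rw [hK1]
    exact h.strictMonoOn_kap_a hf hη hl₀m hLm hl₀L
  obtain ⟨η₂, h12, h23, hη₂⟩ := exists_Icc_of_eventually h13 hev
  have hsub : Icc η₁ η₂ ⊆ Icc η₁ η₃ := Icc_subset_Icc_right h23
  have hex : ∀ ε ∈ Icc η₁ η₂, ∃ l, l ∈ Ioc lam L ∧
      kap f ε (a l) (chordMean f a b l) = K ε := by
    intro ε hε
    have hKle : K ε ≤ kap f ε (a L) (chordMean f a b L) := by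
      rw [← frc_le_iff]
      refine (hφ.antitoneOn hη₁m (hsub hε) hε.1).trans ?_
      exact hφ1.le
    obtain ⟨l, hl, hlK⟩ := intermediate_value_Icc hl₀L.le
      (continuousOn_kap_comp hf ε (h.continuous_a.mono (Icc_subset_Icc_left hl₀m.1.le))
        ((h.continuousOn_chordMean hf).mono fun s hs => ⟨hl₀m.1.trans_le hs.1, hs.2⟩))
      ⟨(hη₂ ε hε).le, hKle⟩
    exact ⟨l, ⟨hl₀m.1.trans_le hl.1, hl.2⟩, hlK⟩
  choose! l hlm hlK using hex
  have hη₁m' : η₁ ∈ Icc η₁ η₂ := ⟨le_rfl, h12.le⟩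
  have hl1 : l η₁ = L := (h.strictMonoOn_kap_a hf hη).injOn (hlm _ hη₁m') hLm
    ((hlK _ hη₁m').trans hK1)
  -- An implicit function argument by monotonicity: `K ε` is compared with the constants of fixed
  -- chords slightly shorter and slightly longer than the selected one, which depend continuously on
  -- ε.
  have hlc : ContinuousOn l (Icc η₁ η₂) := by
    intro ε₀ hε₀
    refine tendsto_order.2 ⟨fun l' hl' => ?_, fun l' hl' => ?_⟩
    · have hm := hlm ε₀ hε₀
      set p := max l' ((lam + l ε₀) / 2) with hp
      have hp1 : p < l ε₀ := max_lt hl' (by linarith [hm.1])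
      have hpm : p ∈ Ioc lam L :=
        ⟨lt_of_lt_of_le (by linarith [hm.1]) (le_max_right _ _), hp1.le.trans hm.2⟩
      have hev2 := (((hcε p).mono hsub) ε₀ hε₀).eventually_lt ((hKc.mono hsub) ε₀ hε₀) (by
        rw [← hlK ε₀ hε₀]
        exact h.strictMonoOn_kap_a hf (hpos _ (hsub hε₀)) hpm hm hp1)
      filter_upwards [hev2, self_mem_nhdsWithin] with ε hε hεm
      rw [← hlK ε hεm] at hε
      exact (le_max_left _ _).trans_lt
        (((h.strictMonoOn_kap_a hf (hpos _ (hsub hεm))).lt_iff_lt hpm (hlm ε hεm)).1 hε)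
    · rcases lt_or_ge L l' with hL' | hL'
      · filter_upwards [self_mem_nhdsWithin] with ε hε
        exact (hlm ε hε).2.trans_lt hL'
      have hm := hlm ε₀ hε₀
      have hpm : l' ∈ Ioc lam L := ⟨hm.1.trans hl', hL'⟩
      have hev2 := ((hKc.mono hsub) ε₀ hε₀).eventually_lt (((hcε l').mono hsub) ε₀ hε₀) (by
        rw [← hlK ε₀ hε₀]
        exact h.strictMonoOn_kap_a hf (hpos _ (hsub hε₀)) hm hpm hl')
      filter_upwards [hev2, self_mem_nhdsWithin] with ε hε hεm
      rw [← hlK ε hεm] at hε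
      exact ((h.strictMonoOn_kap_a hf (hpos _ (hsub hεm))).lt_iff_lt (hlm ε hεm) hpm).1 hε
  have hanti : StrictAntiOn l (Icc η₁ η₂) := by
    intro η hη' η' hη'' hlt
    have hm := hlm η hη'
    have hp := hpos _ (hsub hη')
    have haL : a L ≤ a (l η) := h.strictAntiOn.antitoneOn (Ioc_subset_Icc_self hm)
      (Ioc_subset_Icc_self hLm) hm.2
    -- Every point between `a L` and `a (l η)` is the left end of a longer chord.
    have hneg : ∀ s ∈ Ioo (a L) (a (l η)), frc f η (K η) s ≤ 0 := by
      intro v hv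
      obtain ⟨s, hs, rfl⟩ := h.exists_eq_a (Ioc_subset_Icc_self hm) (Ioo_subset_Icc_self hv)
      have hs' : s ∈ Ioc lam L := ⟨hm.1.trans_le hs.1, hs.2⟩
      rw [← hlK η hη']
      exact (h.frc_a_le hf hp hm hs' hs.1).trans
        (h.differentials s (Ioc_subset_Icc_self hs') (h.pos hs')).1
    have hlt2 := frc_lt_of_compare hf hp hlt haL hneg (hφ (hsub hη') (hsub hη'') hlt)
    have e : frc f η (K η) (a (l η)) =
        deriv (deriv f) (a (l η)) - chordMean f a b (l η) := by
      rw [← hlK η hη']; exact frc_a η (l η)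
    rw [e, frc_lt_iff, ← hlK η' hη''] at hlt2
    exact ((h.strictMonoOn_kap_a hf (hpos _ (hsub hη''))).lt_iff_lt (hlm _ hη'') hm).1 hlt2
  refine ⟨η₂, h12, h23, l, hlc, hanti, hl1, fun ε hε => ⟨hlm ε hε, hlK ε hε⟩, ?_, ?_⟩
  · exact continuousOn_kap hf (fun ε hε => hpos ε (hsub hε))
      ((h.continuousOn_chordMean hf).comp hlc hlm)
      (h.continuous_b.comp hlc fun ε hε => Ioc_subset_Icc_self (hlm ε hε))
  · intro η hη' η' hη'' hlt
    have hm := hlm η hη'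
    have hm' := hlm η' hη''
    have hp := hpos _ (hsub hη')
    have hL2 : L ≤ 2 * η := hL.trans (by linarith [hη'.1])
    have hll : l η' < l η := hanti hη' hη'' hlt
    -- The intermediate term is the force with parameter η emitted by the chord of length `l η'`.
    -- The strict inequality comes from the change of the chord at fixed η. The change of parameter
    -- at a fixed chord costs only ≤, since both forces start there from the same value D_R.
    have h1 := frc_lt_frc (f := f) (ε := η) (v := b L)
      (h.strictMonoOn_kap_b hf hp hL2 hm' hm hll)
    refine lt_of_le_of_lt ?_ h1
    refine frc_le_of_compare (c := b (l η')) hf hp hlt (h.strictMonoOn.monotoneOn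
      (Ioc_subset_Icc_self hm') (Ioc_subset_Icc_self hLm) hm'.2) (fun v hv => ?_) ?_
    · obtain ⟨s, hs, rfl⟩ := h.exists_eq_b (Ioc_subset_Icc_self hm') (Ioo_subset_Icc_self hv)
      have hs' : s ∈ Ioc lam L := ⟨hm'.1.trans_le hs.1, hs.2⟩
      exact (h.frc_b_le hf hp hL2 hm' hs' hs.1).trans
        (h.differentials s (Ioc_subset_Icc_self hs') (h.pos hs')).2
    · rw [frc_b, frc_b]

end IsChordFamily

/-- The configuration below a multibirdie: arcs on which `f''` equals `M₀` and chordal domains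
between them whose upper chords have the mean value `M₀` of `f''`. -/
structure IsArcSystem (f : ℝ → ℝ) (k : ℕ) (aL aR : ℕ → ℝ) (a b : ℕ → ℝ → ℝ) (lam : ℕ → ℝ)
    (M₀ : ℝ) : Prop where
  arc : ∀ i ∈ Icc 1 k, aL i ≤ aR i
  flat : ∀ i ∈ Icc 1 k, aL i < aR i → ∀ t ∈ Icc (aL i) (aR i), deriv (deriv f) t = M₀
  family : ∀ i ∈ Ico 1 k, IsChordFamily f (a i) (b i) (lam i) (aL (i + 1) - aR i)
  top_a : ∀ i ∈ Ico 1 k, a i (aL (i + 1) - aR i) = aR i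
  top_b : ∀ i ∈ Ico 1 k, b i (aL (i + 1) - aR i) = aL (i + 1)
  mean : ∀ i ∈ Ico 1 k, avg (deriv (deriv f)) (aR i) (aL (i + 1)) = M₀

/-- Right forces with the constants `K i` arriving at the arcs of the configuration, and the lengths
`l i` of the chords they select. -/
structure IsRightChain (f : ℝ → ℝ) (n : ℕ) (aL aR : ℕ → ℝ) (a b : ℕ → ℝ → ℝ) (lam : ℕ → ℝ)
    (M₀ η₁ η₂ : ℝ) (l K : ℕ → ℝ → ℝ) : Prop where
  cont : ∀ i ∈ Ico 1 n, ContinuousOn (l i) (Icc η₁ η₂)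
  anti : ∀ i ∈ Ico 1 n, StrictAntiOn (l i) (Icc η₁ η₂)
  init : ∀ i ∈ Ico 1 n, l i η₁ = aL (i + 1) - aR i
  mem : ∀ i ∈ Ico 1 n, ∀ ε ∈ Icc η₁ η₂, l i ε ∈ Ioc (lam i) (aL (i + 1) - aR i)
  eq_a : ∀ i ∈ Ico 1 n, ∀ ε ∈ Icc η₁ η₂,
    kap f ε (a i (l i ε)) (chordMean f (a i) (b i) (l i ε)) = K i ε
  eq_b : ∀ i ∈ Ico 1 n, ∀ ε ∈ Icc η₁ η₂,
    kap f ε (b i (l i ε)) (chordMean f (a i) (b i) (l i ε)) = K (i + 1) ε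
  cont_K : ∀ i ∈ Icc 1 n, ContinuousOn (K i) (Icc η₁ η₂)
  force_anti : ∀ i ∈ Icc 1 n, StrictAntiOn (fun ε => frc f ε (K i ε) (aL i)) (Icc η₁ η₂)
  force_init : ∀ i ∈ Icc 1 n, frc f η₁ (K i η₁) (aL i) = deriv (deriv f) (aL i) - M₀

lemma IsRightChain.mono {f : ℝ → ℝ} {n : ℕ} {aL aR : ℕ → ℝ} {a b : ℕ → ℝ → ℝ} {lam : ℕ → ℝ}
    {M₀ η₁ η₂ η₂' : ℝ} {l K : ℕ → ℝ → ℝ}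
    (h : IsRightChain f n aL aR a b lam M₀ η₁ η₂ l K) (hη : η₂' ≤ η₂) :
    IsRightChain f n aL aR a b lam M₀ η₁ η₂' l K :=
  have hs : Icc η₁ η₂' ⊆ Icc η₁ η₂ := Icc_subset_Icc_right hη
  ⟨fun i hi => (h.cont i hi).mono hs, fun i hi => (h.anti i hi).mono hs, h.init,
    fun i hi ε hε => h.mem i hi ε (hs hε), fun i hi ε hε => h.eq_a i hi ε (hs hε),
    fun i hi ε hε => h.eq_b i hi ε (hs hε), fun i hi => (h.cont_K i hi).mono hs,
    fun i hi => (h.force_anti i hi).mono hs, h.force_init⟩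

/-! ### Right forces passing through the arcs and chordal domains. -/

namespace IsArcSystem

variable {f : ℝ → ℝ} {k : ℕ} {aL aR : ℕ → ℝ} {a b : ℕ → ℝ → ℝ} {lam : ℕ → ℝ} {M₀ : ℝ}

/-- The force on an arc in terms of the force at its left end. -/
lemma frc_arc (h : IsArcSystem f k aL aR a b lam M₀) (hf : ContDiff ℝ 2 f) {i : ℕ}
    (hi : i ∈ Icc 1 k) {ε K v : ℝ} (hε : 0 < ε) (hv : v ∈ Icc (aL i) (aR i)) :
    frc f ε K v = frc f ε K (aL i) * Real.exp ((aL i - v) / ε) := by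
  refine frc_of_const hf hε hv fun t ht => ?_
  rcases (h.arc i hi).eq_or_lt with he | hlt
  · have : t = aL i := le_antisymm (he ▸ ht.2) ht.1
    rw [this]
  · rw [h.flat i hi hlt t ht, h.flat i hi hlt _ ⟨le_rfl, hlt.le⟩]

/-- On an arc the force keeps the nonpositive sign of its initial value, so the ordering in ε
survives. On a solid arc f'' = M₀, so the force at η₁ vanishes at the left end and hence along the
whole arc. -/
lemma frc_arc_anti (h : IsArcSystem f k aL aR a b lam M₀) (hf : ContDiff ℝ 2 f) {i : ℕ}
    (hi : i ∈ Icc 1 k) {η₁ η₂ : ℝ} (hη : 0 < η₁) {K : ℝ → ℝ}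
    (hneg : deriv (deriv f) (aL i) - M₀ ≤ 0)
    (hφ : StrictAntiOn (fun ε => frc f ε (K ε) (aL i)) (Icc η₁ η₂))
    (hφ1 : frc f η₁ (K η₁) (aL i) = deriv (deriv f) (aL i) - M₀) :
    StrictAntiOn (fun ε => frc f ε (K ε) (aR i)) (Icc η₁ η₂) ∧
      frc f η₁ (K η₁) (aR i) = deriv (deriv f) (aR i) - M₀ := by
  have harc := h.arc i hi
  constructor
  · intro η hη' η' hη'' hlt
    refine frc_lt_of_compare hf (hη.trans_le hη'.1) hlt harc (fun v hv => ?_) (hφ hη' hη'' hlt)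
    rw [h.frc_arc hf hi (hη.trans_le hη'.1) (Ioo_subset_Icc_self hv)]
    refine mul_nonpos_of_nonpos_of_nonneg ?_ (Real.exp_pos _).le
    refine le_trans (hφ.antitoneOn ⟨le_rfl, hη'.1.trans hη'.2⟩ hη' hη'.1) ?_
    exact hφ1.le.trans hneg
  · rcases harc.eq_or_lt with he | hlt
    · rw [← he, hφ1]
    · rw [h.frc_arc hf hi hη ⟨harc, le_rfl⟩, hφ1, h.flat i hi hlt _ ⟨le_rfl, harc⟩,
        h.flat i hi hlt _ ⟨harc, le_rfl⟩]
      simp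

/-- The quantity is D_R of the upper chord, whose mean of f'' is M₀. -/
lemma nonpos_b (h : IsArcSystem f k aL aR a b lam M₀) {i : ℕ} (hi : i ∈ Ico 1 k) :
    deriv (deriv f) (aL (i + 1)) - M₀ ≤ 0 := by
  have hF := h.family i hi
  have hm : aL (i + 1) - aR i ∈ Ioc (lam i) (aL (i + 1) - aR i) := ⟨hF.lt, le_rfl⟩
  have := (hF.differentials _ (Ioc_subset_Icc_self hm) (hF.pos hm)).2
  rwa [DR, h.top_a i hi, h.top_b i hi, h.mean i hi] at this

/-- Induction on the number n of arcs reached. The force crosses arc n and selects a chord by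
`exists_step`; the force emitted by that chord is the one arriving at arc n + 1, with the initial
value that M₀ requires. Each step may shorten the range of ε, but there are finitely many. -/
lemma exists_rightChain (h : IsArcSystem f k aL aR a b lam M₀) (hf : ContDiff ℝ 2 f)
    {η₁ η₃ : ℝ} (hη : 0 < η₁) (h13 : η₁ < η₃)
    (hL : ∀ i ∈ Ico 1 k, aL (i + 1) - aR i ≤ 2 * η₁)
    (hneg : deriv (deriv f) (aL 1) - M₀ ≤ 0) {K₁ : ℝ → ℝ} (hK : ContinuousOn K₁ (Icc η₁ η₃))
    (hφ : StrictAntiOn (fun ε => frc f ε (K₁ ε) (aL 1)) (Icc η₁ η₃))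
    (hφ1 : frc f η₁ (K₁ η₁) (aL 1) = deriv (deriv f) (aL 1) - M₀) :
    ∀ n, 1 ≤ n → n ≤ k → ∃ η₂, η₁ < η₂ ∧ η₂ ≤ η₃ ∧ ∃ l K : ℕ → ℝ → ℝ, K 1 = K₁ ∧
      IsRightChain f n aL aR a b lam M₀ η₁ η₂ l K := by
  classical
  intro n hn
  induction n, hn using Nat.le_induction with
  | base =>
    intro _
    -- A chain on n arcs has n - 1 chords, so for n = 1 the lengths are dummy values.
    refine ⟨η₃, h13, le_rfl, fun _ _ => 0, fun _ => K₁, rfl, ?_⟩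
    have he : ∀ i ∈ Ico 1 1, False := fun i hi => absurd hi.1 (not_le.2 hi.2)
    have he' : ∀ i ∈ Icc 1 1, i = 1 := fun i hi => le_antisymm hi.2 hi.1
    exact ⟨fun i hi => (he i hi).elim, fun i hi => (he i hi).elim, fun i hi => (he i hi).elim,
      fun i hi => (he i hi).elim, fun i hi => (he i hi).elim, fun i hi => (he i hi).elim,
      fun i hi => hK, fun i hi => by rw [he' i hi]; exact hφ,
      fun i hi => by rw [he' i hi]; exact hφ1⟩
  | succ n hn ih =>
    intro hnk
    obtain ⟨η₂, h12, h23, l, K, hK1, hch⟩ := ih (by omega)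
    have hnI : n ∈ Ico 1 k := ⟨hn, by omega⟩
    have hnI' : n ∈ Icc 1 k := ⟨hn, by omega⟩
    have hnn : n ∈ Icc 1 n := ⟨hn, le_rfl⟩
    have hnegn : deriv (deriv f) (aL n) - M₀ ≤ 0 := by
      rcases hn.eq_or_lt with he | hlt
      · rw [← he]; exact hneg
      · have := h.nonpos_b (i := n - 1) ⟨by omega, by omega⟩
        rwa [Nat.sub_add_cancel hn] at this
    obtain ⟨hφn, hφ1n⟩ := h.frc_arc_anti hf hnI' hη hnegn (hch.force_anti n hnn)
      (hch.force_init n hnn)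
    have hF := h.family n hnI
    have htop := h.top_a n hnI
    have htopb := h.top_b n hnI
    rw [← htop] at hφn hφ1n
    have hφ1n' : frc f η₁ (K n η₁) (a n (aL (n + 1) - aR n)) =
        DL f (a n (aL (n + 1) - aR n)) (b n (aL (n + 1) - aR n)) := by
      rw [hφ1n, DL, htop, htopb, h.mean n hnI]
    obtain ⟨η₂', h12', h23', l', hl'c, hl'a, hl'1, hl', hK'c, hφ'⟩ :=
      hF.exists_step hf hη h12 (hL n hnI) (hch.cont_K n hnn) hφn hφ1n'
    have hch' := hch.mono h23'
    refine ⟨η₂', h12', h23'.trans h23, fun i => if i = n then l' else l i,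
      fun i => if i = n + 1 then fun ε => kap f ε (b n (l' ε)) (chordMean f (a n) (b n) (l' ε))
        else K i, (if_neg (by omega)).trans hK1, ?_⟩
    have hlt : ∀ i ∈ Ico 1 (n + 1), i ≠ n → i ∈ Ico 1 n := fun i hi hne =>
      ⟨hi.1, lt_of_le_of_ne (Nat.lt_succ_iff.1 hi.2) hne⟩
    have hle : ∀ i ∈ Icc 1 (n + 1), i ≠ n + 1 → i ∈ Icc 1 n := fun i hi hne =>
      ⟨hi.1, Nat.lt_succ_iff.1 (lt_of_le_of_ne hi.2 hne)⟩
    refine ⟨fun i hi => ?_, fun i hi => ?_, fun i hi => ?_, fun i hi => ?_, fun i hi => ?_,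
      fun i hi => ?_, fun i hi => ?_, fun i hi => ?_, fun i hi => ?_⟩
    · split_ifs with hin
      · exact hl'c
      · exact hch'.cont i (hlt i hi hin)
    · split_ifs with hin
      · exact hl'a
      · exact hch'.anti i (hlt i hi hin)
    · split_ifs with hin
      · rw [hl'1, hin]
      · exact hch'.init i (hlt i hi hin)
    · split_ifs with hin
      · rw [hin]; exact fun ε hε => (hl' ε hε).1
      · exact hch'.mem i (hlt i hi hin)
    · have h1 : i ≠ n + 1 := by have := hi.2; omega
      simp only [if_neg h1]
      split_ifs with hin
      · rw [hin]; exact fun ε hε => (hl' ε hε).2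
      · exact hch'.eq_a i (hlt i hi hin)
    · by_cases hin : i = n
      · subst hin; simp
      · have h1 : i + 1 ≠ n + 1 := by omega
        simp only [if_neg h1, if_neg hin]
        exact hch'.eq_b i (hlt i hi hin)
    · split_ifs with hin
      · exact hK'c
      · exact hch'.cont_K i (hle i hi hin)
    · split_ifs with hin
      · rw [hin, ← htopb]; exact hφ'
      · exact hch'.force_anti i (hle i hi hin)
    · split_ifs with hin
      · rw [hin]
        simp only [hl'1]
        have := IsChordFamily.frc_b (f := f) (a := a n) (b := b n) η₁ (aL (n + 1) - aR n)
        rw [DR, htop, htopb, h.mean n hnI] at this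
        rw [htopb]
        exact this
      · exact hch'.force_init i (hle i hi hin)

end IsArcSystem

/-! ### Left forces and the balance equation -/

/-- The left force with the integration constant `K`. -/
def frcL (f : ℝ → ℝ) (ε K v : ℝ) : ℝ := -frc (fun t => f (-t)) ε K (-v)

/-- The sum of a right and a left force. -/
def balance (f : ℝ → ℝ) (ε K K' v : ℝ) : ℝ := frc f ε K v + frcL f ε K' v

lemma contDiff_reflect {f : ℝ → ℝ} (hf : ContDiff ℝ 2 f) : ContDiff ℝ 2 fun t => f (-t) :=
  hf.comp contDiff_neg

/-- The two copies of f'' enter with opposite signs, so the sum is differentiable although neither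
force need be. -/
lemma hasDerivAt_balance {f : ℝ → ℝ} (hf : ContDiff ℝ 2 f) {ε : ℝ} (hε : 0 < ε) (K K' v : ℝ) :
    HasDerivAt (balance f ε K K') ((frcL f ε K' v - frc f ε K v) / ε) v := by
  have h1 := hasDerivAt_frc_aux hf hε K v
  have h2 := (hasDerivAt_frc_aux (contDiff_reflect hf) hε K' (-v)).comp v (hasDerivAt_neg v)
  have e : balance f ε K K' = fun v => Real.exp (-v / ε) * (K - primJ f ε v / ε) -
      Real.exp (-(-v) / ε) * (K' - primJ (fun t => f (-t)) ε (-v) / ε) := by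
    funext v
    simp only [balance, frcL, frc, deriv2_reflect, neg_neg]
    ring
  rw [e]
  refine (h1.fun_sub h2).congr_deriv ?_
  rw [frcL]
  ring

lemma continuous_balance {f : ℝ → ℝ} (hf : ContDiff ℝ 2 f) {ε : ℝ} (hε : 0 < ε) (K K' : ℝ) :
    Continuous (balance f ε K K') :=
  continuous_iff_continuousAt.2 fun v => (hasDerivAt_balance hf hε K K' v).continuousAt

/-- Each exponential weight removes one of the two forces from the derivative, so the sign of the
balance can be propagated when the sign of only one force is known. -/
lemma hasDerivAt_balance_mul_exp {f : ℝ → ℝ} (hf : ContDiff ℝ 2 f) {ε : ℝ} (hε : 0 < ε)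
    (K K' v : ℝ) :
    HasDerivAt (fun v => balance f ε K K' v * Real.exp (v / ε))
      (2 * frcL f ε K' v * Real.exp (v / ε) / ε) v ∧
    HasDerivAt (fun v => balance f ε K K' v * Real.exp (-v / ε))
      (-2 * frc f ε K v * Real.exp (-v / ε) / ε) v := by
  constructor
  · refine ((hasDerivAt_balance hf hε K K' v).fun_mul
      ((hasDerivAt_id' v).div_const ε).exp).congr_deriv ?_
    rw [balance]; ring
  · refine ((hasDerivAt_balance hf hε K K' v).fun_mul
      (hasDerivAt_exp_neg_div ε v)).congr_deriv ?_
    rw [balance]; ring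

section Balance

variable {f : ℝ → ℝ} {ε K K' x y : ℝ}

lemma balance_le_of_frcL_nonneg (hf : ContDiff ℝ 2 f) (hε : 0 < ε) (hxy : x ≤ y)
    (h : ∀ v ∈ Ioo x y, 0 ≤ frcL f ε K' v) :
    balance f ε K K' x * Real.exp (x / ε) ≤ balance f ε K K' y * Real.exp (y / ε) := by
  have hd := fun v => (hasDerivAt_balance_mul_exp hf hε K K' v).1
  refine monotoneOn_of_deriv_nonneg (convex_Icc x y)
    (fun v _ => (hd v).continuousAt.continuousWithinAt)
    (fun v _ => (hd v).differentiableAt.differentiableWithinAt) (fun v hv => ?_)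
    ⟨le_rfl, hxy⟩ ⟨hxy, le_rfl⟩ hxy
  rw [interior_Icc] at hv
  rw [(hd v).deriv]
  have := h v hv
  positivity

lemma balance_le_of_frc_nonpos (hf : ContDiff ℝ 2 f) (hε : 0 < ε) (hxy : x ≤ y)
    (h : ∀ v ∈ Ioo x y, frc f ε K v ≤ 0) :
    balance f ε K K' x * Real.exp (-x / ε) ≤ balance f ε K K' y * Real.exp (-y / ε) := by
  have hd := fun v => (hasDerivAt_balance_mul_exp hf hε K K' v).2
  refine monotoneOn_of_deriv_nonneg (convex_Icc x y)
    (fun v _ => (hd v).continuousAt.continuousWithinAt)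
    (fun v _ => (hd v).differentiableAt.differentiableWithinAt) (fun v hv => ?_)
    ⟨le_rfl, hxy⟩ ⟨hxy, le_rfl⟩ hxy
  rw [interior_Icc] at hv
  rw [(hd v).deriv]
  have : 0 ≤ -2 * frc f ε K v := by linarith [h v hv]
  positivity

lemma balance_pos_of_frcL_pos (hf : ContDiff ℝ 2 f) (hε : 0 < ε) (hxy : x < y)
    (h : ∀ v ∈ Ioo x y, 0 < frcL f ε K' v) (hx : 0 ≤ balance f ε K K' x) :
    0 < balance f ε K K' y := by
  have hd := fun v => (hasDerivAt_balance_mul_exp hf hε K K' v).1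
  have h1 : balance f ε K K' x * Real.exp (x / ε) < balance f ε K K' y * Real.exp (y / ε) := by
    refine strictMonoOn_of_deriv_pos (convex_Icc x y)
      (fun v _ => (hd v).continuousAt.continuousWithinAt) (fun v hv => ?_)
      ⟨le_rfl, hxy.le⟩ ⟨hxy.le, le_rfl⟩ hxy
    rw [interior_Icc] at hv
    rw [(hd v).deriv]
    have := h v hv
    positivity
  exact pos_of_mul_pos_left ((mul_nonneg hx (Real.exp_pos _).le).trans_lt h1) (Real.exp_pos _).le

lemma balance_neg_of_frc_neg (hf : ContDiff ℝ 2 f) (hε : 0 < ε) (hxy : x < y)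
    (h : ∀ v ∈ Ioo x y, frc f ε K v < 0) (hy : balance f ε K K' y ≤ 0) :
    balance f ε K K' x < 0 := by
  have hd := fun v => (hasDerivAt_balance_mul_exp hf hε K K' v).2
  have h1 : balance f ε K K' x * Real.exp (-x / ε) < balance f ε K K' y * Real.exp (-y / ε) := by
    refine strictMonoOn_of_deriv_pos (convex_Icc x y)
      (fun v _ => (hd v).continuousAt.continuousWithinAt) (fun v hv => ?_)
      ⟨le_rfl, hxy.le⟩ ⟨hxy.le, le_rfl⟩ hxy
    rw [interior_Icc] at hv
    rw [(hd v).deriv]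
    have : 0 < -2 * frc f ε K v := by linarith [h v hv]
    positivity
  exact neg_of_mul_neg_left
    (h1.trans_le (mul_nonpos_of_nonpos_of_nonneg hy (Real.exp_pos _).le)) (Real.exp_pos _).le

lemma balance_nonpos_of_frcL_nonneg (hf : ContDiff ℝ 2 f) (hε : 0 < ε) (hxy : x ≤ y)
    (h : ∀ v ∈ Ioo x y, 0 ≤ frcL f ε K' v) (hy : balance f ε K K' y ≤ 0) :
    balance f ε K K' x ≤ 0 :=
  nonpos_of_mul_nonpos_left ((balance_le_of_frcL_nonneg hf hε hxy h).trans
    (mul_nonpos_of_nonpos_of_nonneg hy (Real.exp_pos _).le)) (Real.exp_pos _)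

lemma balance_nonpos_of_frc_nonpos (hf : ContDiff ℝ 2 f) (hε : 0 < ε) (hxy : x ≤ y)
    (h : ∀ v ∈ Ioo x y, frc f ε K v ≤ 0) (hy : balance f ε K K' y ≤ 0) :
    balance f ε K K' x ≤ 0 :=
  nonpos_of_mul_nonpos_left ((balance_le_of_frc_nonpos hf hε hxy h).trans
    (mul_nonpos_of_nonpos_of_nonneg hy (Real.exp_pos _).le)) (Real.exp_pos _)

lemma balance_nonneg_of_frc_nonpos (hf : ContDiff ℝ 2 f) (hε : 0 < ε) (hxy : x ≤ y)
    (h : ∀ v ∈ Ioo x y, frc f ε K v ≤ 0) (hx : 0 ≤ balance f ε K K' x) :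
    0 ≤ balance f ε K K' y :=
  nonneg_of_mul_nonneg_left ((mul_nonneg hx (Real.exp_pos _).le).trans
    (balance_le_of_frc_nonpos hf hε hxy h)) (Real.exp_pos _)

/-- The balance equation has a root with negative right forces before it and positive left forces
after it. -/
lemma exists_balance_eq_zero (hf : ContDiff ℝ 2 f) (hε : 0 < ε) {c : ℝ} (hxc : x ≤ c) (hcy : c ≤ y)
    (hR : ∀ v ∈ Icc x c, frc f ε K v < 0) (hL : ∀ v ∈ Icc c y, 0 < frcL f ε K' v)
    (hx : balance f ε K K' x ≤ 0) (hy : 0 ≤ balance f ε K K' y) :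
    ∃ w ∈ Icc x y, balance f ε K K' w = 0 ∧ (∀ v ∈ Ico x w, frc f ε K v < 0) ∧
      ∀ v ∈ Ioc w y, 0 < frcL f ε K' v := by
  rcases le_total 0 (balance f ε K K' c) with hc | hc
  · obtain ⟨w, hw, hw0⟩ := intermediate_value_Icc hxc
      (continuous_balance hf hε K K').continuousOn ⟨hx, hc⟩
    refine ⟨w, ⟨hw.1, hw.2.trans hcy⟩, hw0, fun v hv => hR v ⟨hv.1, hv.2.le.trans hw.2⟩,
      fun v hv => ?_⟩
    rcases le_total c v with hcv | hvc
    · exact hL v ⟨hcv, hv.2⟩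
    -- The sign of the left force is not assumed between the root and c. It follows there: the
    -- balance is nonnegative to the right of the root while the right force is negative.
    · have h1 : 0 ≤ balance f ε K K' v := balance_nonneg_of_frc_nonpos hf hε hv.1.le
        (fun s hs => (hR s ⟨hw.1.trans hs.1.le, hs.2.le.trans hvc⟩).le) hw0.ge
      have h2 := hR v ⟨hw.1.trans hv.1.le, hvc⟩
      rw [balance] at h1
      linarith
  · obtain ⟨w, hw, hw0⟩ := intermediate_value_Icc hcy
      (continuous_balance hf hε K K').continuousOn ⟨hc, hy⟩
    refine ⟨w, ⟨hxc.trans hw.1, hw.2⟩, hw0, fun v hv => ?_,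
      fun v hv => hL v ⟨hw.1.trans hv.1.le, hv.2⟩⟩
    rcases le_total v c with hvc | hcv
    · exact hR v ⟨hv.1, hvc⟩
    · have h1 : balance f ε K K' v ≤ 0 := balance_nonpos_of_frcL_nonneg hf hε hv.2.le
        (fun s hs => (hL s ⟨hcv.trans hs.1.le, hs.2.le.trans hw.2⟩).le) hw0.le
      have h2 := hL v ⟨hcv, hv.2.le.trans hw.2⟩
      rw [balance] at h1
      linarith

end Balance

/-! ### Signs of the forces along a chain -/

/-- A decreasing family of right forces that are negative on the way from `u` to `c`. -/
structure IsRightInput (f : ℝ → ℝ) (u : EReal) (c M₀ η₁ η₂ : ℝ) (K : ℝ → ℝ) : Prop where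
  lt : u < c
  cont : ContinuousOn K (Icc η₁ η₂)
  anti : StrictAntiOn (fun ε => frc f ε (K ε) c) (Icc η₁ η₂)
  init : frc f η₁ (K η₁) c = deriv (deriv f) c - M₀
  neg_init : ∀ v : ℝ, u < v → v < c → frc f η₁ (K η₁) v < 0
  neg : ∀ ε ∈ Ioc η₁ η₂, ∀ v : ℝ, u < v → v ≤ c → frc f ε (K ε) v < 0

lemma IsRightInput.mono {f : ℝ → ℝ} {u : EReal} {c M₀ η₁ η₂ η₂' : ℝ} {K : ℝ → ℝ}
    (h : IsRightInput f u c M₀ η₁ η₂ K) (hη : η₂' ≤ η₂) : IsRightInput f u c M₀ η₁ η₂' K :=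
  ⟨h.lt, h.cont.mono (Icc_subset_Icc_right hη), h.anti.mono (Icc_subset_Icc_right hη), h.init,
    h.neg_init, fun ε hε => h.neg ε ⟨hε.1, hε.2.trans hη⟩⟩

lemma IsRightInput.nonpos {f : ℝ → ℝ} (hf : ContDiff ℝ 2 f) {u : EReal} {c M₀ η₁ η₂ : ℝ}
    {K : ℝ → ℝ} (hη : 0 < η₁) (h : IsRightInput f u c M₀ η₁ η₂ K) :
    deriv (deriv f) c - M₀ ≤ 0 := by
  rw [← h.init]
  obtain ⟨q, hq1, hq2⟩ := EReal.lt_iff_exists_real_btwn.1 h.lt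
  have hq2' : q < c := EReal.coe_lt_coe_iff.1 hq2
  have hc : c ∈ closure (Ioo q c) := by rw [closure_Ioo hq2'.ne]; exact ⟨hq2'.le, le_rfl⟩
  exact closure_minimal (s := Ioo q c) (t := {v | frc f η₁ (K η₁) v ≤ 0})
    (fun v hv => (h.neg_init v (hq1.trans (EReal.coe_lt_coe_iff.2 hv.1)) hv.2).le)
    (isClosed_le (continuous_frc hf hη _) continuous_const) hc

namespace IsRightChain

variable {f : ℝ → ℝ} {k : ℕ} {aL aR : ℕ → ℝ} {a b : ℕ → ℝ → ℝ} {lam : ℕ → ℝ}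
  {M₀ η₁ η₂ : ℝ} {l K : ℕ → ℝ → ℝ}

lemma nonpos_left (H : IsArcSystem f k aL aR a b lam M₀)
    (hneg : deriv (deriv f) (aL 1) - M₀ ≤ 0) {i : ℕ} (hi : i ∈ Icc 1 k) :
    deriv (deriv f) (aL i) - M₀ ≤ 0 := by
  rcases hi.1.eq_or_lt with he | hlt
  · rw [← he]; exact hneg
  · have := H.nonpos_b (i := i - 1) ⟨by omega, by have := hi.2; omega⟩
    rwa [Nat.sub_add_cancel hi.1] at this

/-- The value at the left end is nonpositive at η₁ and decreases strictly in ε, so for ε > η₁ the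
sign is strict even on solid arcs, where the force at η₁ vanishes. -/
lemma neg_arc (h : IsRightChain f k aL aR a b lam M₀ η₁ η₂ l K)
    (H : IsArcSystem f k aL aR a b lam M₀) (hf : ContDiff ℝ 2 f) (hη : 0 < η₁)
    (hneg : deriv (deriv f) (aL 1) - M₀ ≤ 0) {i : ℕ} (hi : i ∈ Icc 1 k) {ε v : ℝ}
    (hε : ε ∈ Ioc η₁ η₂) (hv : v ∈ Icc (aL i) (aR i)) : frc f ε (K i ε) v < 0 := by
  rw [H.frc_arc hf hi (hη.trans hε.1) hv]
  refine mul_neg_of_neg_of_pos ?_ (Real.exp_pos _)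
  refine (h.force_anti i hi ⟨le_rfl, hε.1.le.trans hε.2⟩ (Ioc_subset_Icc_self hε) hε.1).trans_le ?_
  exact (h.force_init i hi).le.trans (nonpos_left H hneg hi)

/-- The points in question are left ends of chords at least as long as the selected one, where the
force is at most D_L. At the upper chord D_L may vanish, and `neg_arc` is used instead. -/
lemma neg_after (h : IsRightChain f k aL aR a b lam M₀ η₁ η₂ l K)
    (H : IsArcSystem f k aL aR a b lam M₀) (hf : ContDiff ℝ 2 f) (hη : 0 < η₁)
    (hneg : deriv (deriv f) (aL 1) - M₀ ≤ 0) {i : ℕ} (hi : i ∈ Ico 1 k) {ε v : ℝ}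
    (hε : ε ∈ Ioc η₁ η₂) (hv : v ∈ Icc (aR i) (a i (l i ε))) : frc f ε (K i ε) v < 0 := by
  have hi' : i ∈ Icc 1 k := ⟨hi.1, hi.2.le⟩
  have hF := H.family i hi
  have hm := h.mem i hi ε (Ioc_subset_Icc_self hε)
  rw [← H.top_a i hi] at hv
  obtain ⟨s, hs, rfl⟩ := hF.exists_eq_a (Ioc_subset_Icc_self hm) hv
  rcases hs.2.eq_or_lt with he | hlt
  · rw [he, H.top_a i hi]
    exact h.neg_arc H hf hη hneg hi' hε ⟨H.arc i hi', le_rfl⟩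
  · rw [← h.eq_a i hi ε (Ioc_subset_Icc_self hε)]
    exact (hF.frc_a_le hf (hη.trans hε.1) hm ⟨hm.1.trans_le hs.1, hs.2⟩ hs.1).trans_lt
      (hF.differentials_strict s ⟨hm.1.trans_le hs.1, hlt⟩).1

lemma neg_before (h : IsRightChain f k aL aR a b lam M₀ η₁ η₂ l K)
    (H : IsArcSystem f k aL aR a b lam M₀) (hf : ContDiff ℝ 2 f) (hη : 0 < η₁)
    (hneg : deriv (deriv f) (aL 1) - M₀ ≤ 0) {i : ℕ} (hi : i ∈ Ico 1 k)
    (hL : aL (i + 1) - aR i ≤ 2 * η₁) {ε v : ℝ}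
    (hε : ε ∈ Ioc η₁ η₂) (hv : v ∈ Icc (b i (l i ε)) (aL (i + 1))) :
    frc f ε (K (i + 1) ε) v < 0 := by
  have hi' : i + 1 ∈ Icc 1 k := ⟨by omega, hi.2⟩
  have hF := H.family i hi
  have hm := h.mem i hi ε (Ioc_subset_Icc_self hε)
  rw [← H.top_b i hi] at hv
  obtain ⟨s, hs, rfl⟩ := hF.exists_eq_b (Ioc_subset_Icc_self hm) hv
  rcases hs.2.eq_or_lt with he | hlt
  · rw [he, H.top_b i hi]
    exact h.neg_arc H hf hη hneg hi' hε ⟨le_rfl, H.arc _ hi'⟩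
  · rw [← h.eq_b i hi ε (Ioc_subset_Icc_self hε)]
    exact (hF.frc_b_le hf (hη.trans hε.1) (by linarith [hε.1]) hm
      ⟨hm.1.trans_le hs.1, hs.2⟩ hs.1).trans_lt
      (hF.differentials_strict s ⟨hm.1.trans_le hs.1, hlt⟩).2

end IsRightChain

/-- The reflected configuration. -/
lemma IsArcSystem.reflect {f : ℝ → ℝ} {k : ℕ} {aL aR : ℕ → ℝ} {a b : ℕ → ℝ → ℝ} {lam : ℕ → ℝ}
    {M₀ : ℝ} (h : IsArcSystem f k aL aR a b lam M₀) :
    IsArcSystem (fun t => f (-t)) k (fun i => -aR (k + 1 - i)) (fun i => -aL (k + 1 - i))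
      (fun i l => -b (k - i) l) (fun i l => -a (k - i) l) (fun i => lam (k - i)) M₀ := by
  -- Reflection exchanges the arcs i and k + 1 - i, but the chords i and k - i, as there is one
  -- chord fewer.
  have hidx : ∀ i ∈ Ico 1 k, k - i ∈ Ico 1 k ∧ k + 1 - (i + 1) = k - i ∧ k + 1 - i = k - i + 1 :=
    fun i hi => ⟨⟨by have := hi.2; omega, by have := hi.1; have := hi.2; omega⟩, by omega,
      by have := hi.2; omega⟩
  have hidx' : ∀ i ∈ Icc 1 k, k + 1 - i ∈ Icc 1 k := fun i hi =>
    ⟨by have := hi.2; omega, by have := hi.1; omega⟩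
  refine ⟨fun i hi => neg_le_neg (h.arc _ (hidx' i hi)), fun i hi hlt t ht => ?_,
    fun i hi => ?_, fun i hi => ?_, fun i hi => ?_, fun i hi => ?_⟩
  · rw [deriv2_reflect]
    exact h.flat _ (hidx' i hi) (neg_lt_neg_iff.1 hlt) _ ⟨le_neg.1 ht.2, neg_le.1 ht.1⟩
  · obtain ⟨h1, h2, h3⟩ := hidx i hi
    rw [h2, h3, neg_sub_neg]
    exact (h.family _ h1).reflect
  · obtain ⟨h1, h2, h3⟩ := hidx i hi
    rw [h2, h3, neg_sub_neg, h.top_b _ h1]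
  · obtain ⟨h1, h2, h3⟩ := hidx i hi
    rw [h2, h3, neg_sub_neg, h.top_a _ h1]
  · obtain ⟨h1, h2, h3⟩ := hidx i hi
    rw [h2, h3, deriv2_reflect, avg_reflect, h.mean _ h1]

/-! ### Chains of left forces -/

/-- Left forces with the constants `K i` arriving at the arcs of the configuration, and the lengths
`l i` of the chords they select. -/
structure IsLeftChain (f : ℝ → ℝ) (k : ℕ) (aL aR : ℕ → ℝ) (a b : ℕ → ℝ → ℝ) (lam : ℕ → ℝ)
    (M₀ η₁ η₂ : ℝ) (l K : ℕ → ℝ → ℝ) : Prop where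
  cont : ∀ i ∈ Ico 1 k, ContinuousOn (l i) (Icc η₁ η₂)
  anti : ∀ i ∈ Ico 1 k, StrictAntiOn (l i) (Icc η₁ η₂)
  init : ∀ i ∈ Ico 1 k, l i η₁ = aL (i + 1) - aR i
  mem : ∀ i ∈ Ico 1 k, ∀ ε ∈ Icc η₁ η₂, l i ε ∈ Ioc (lam i) (aL (i + 1) - aR i)
  eq_b : ∀ i ∈ Ico 1 k, ∀ ε ∈ Icc η₁ η₂,
    kap (fun t => f (-t)) ε (-b i (l i ε)) (chordMean f (a i) (b i) (l i ε)) = K (i + 1) ε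
  eq_a : ∀ i ∈ Ico 1 k, ∀ ε ∈ Icc η₁ η₂,
    kap (fun t => f (-t)) ε (-a i (l i ε)) (chordMean f (a i) (b i) (l i ε)) = K i ε
  cont_K : ∀ i ∈ Icc 1 k, ContinuousOn (K i) (Icc η₁ η₂)
  pos_arc : ∀ i ∈ Icc 1 k, ∀ ε ∈ Ioc η₁ η₂, ∀ v ∈ Icc (aL i) (aR i), 0 < frcL f ε (K i ε) v
  pos_before : ∀ i ∈ Ico 1 k, ∀ ε ∈ Ioc η₁ η₂, ∀ v ∈ Icc (aR i) (a i (l i ε)),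
    0 < frcL f ε (K i ε) v
  pos_after : ∀ i ∈ Ico 1 k, ∀ ε ∈ Ioc η₁ η₂, ∀ v ∈ Icc (b i (l i ε)) (aL (i + 1)),
    0 < frcL f ε (K (i + 1) ε) v
  init_arc : 1 ≤ k → frcL f η₁ (K 1 η₁) (aL 1) = M₀ - deriv (deriv f) (aL 1)

section LeftChain

variable {f : ℝ → ℝ} {k : ℕ} {aL aR : ℕ → ℝ} {a b : ℕ → ℝ → ℝ} {lam : ℕ → ℝ} {M₀ η₁ η₂ : ℝ}

lemma IsRightChain.isLeftChain {l K : ℕ → ℝ → ℝ}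
    (h : IsRightChain (fun t => f (-t)) k (fun i => -aR (k + 1 - i)) (fun i => -aL (k + 1 - i))
      (fun i l => -b (k - i) l) (fun i l => -a (k - i) l) (fun i => lam (k - i)) M₀ η₁ η₂ l K)
    (H : IsArcSystem f k aL aR a b lam M₀) (hf : ContDiff ℝ 2 f) (hη : 0 < η₁)
    (hL : ∀ i ∈ Ico 1 k, aL (i + 1) - aR i ≤ 2 * η₁)
    (hneg : deriv (deriv f) (aR k) - M₀ ≤ 0) :
    IsLeftChain f k aL aR a b lam M₀ η₁ η₂ (fun i => l (k - i)) (fun i => K (k + 1 - i)) := by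
  have hf' := contDiff_reflect hf
  have H' := H.reflect
  have hneg' : deriv (deriv fun t => f (-t)) (-aR (k + 1 - 1)) - M₀ ≤ 0 := by
    rw [deriv2_reflect_apply, neg_neg, Nat.add_sub_cancel]; exact hneg
  have hidx : ∀ i ∈ Ico 1 k, k - i ∈ Ico 1 k ∧ k + 1 - (k - i) = i + 1 ∧ k - (k - i) = i ∧
      k + 1 - (k - i + 1) = i ∧ k + 1 - i = k - i + 1 ∧ k + 1 - (i + 1) = k - i := fun i hi => by
    have h1 := hi.1; have h2 := hi.2
    exact ⟨⟨by omega, by omega⟩, by omega, by omega, by omega, by omega, by omega⟩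
  have hidx' : ∀ i ∈ Icc 1 k, k + 1 - i ∈ Icc 1 k ∧ k + 1 - (k + 1 - i) = i := fun i hi => by
    have h1 := hi.1; have h2 := hi.2
    exact ⟨⟨by omega, by omega⟩, by omega⟩
  refine ⟨fun i hi => h.cont _ (hidx i hi).1, fun i hi => h.anti _ (hidx i hi).1,
    fun i hi => ?_, fun i hi ε hε => ?_, fun i hi ε hε => ?_, fun i hi ε hε => ?_,
    fun i hi => h.cont_K _ (hidx' i hi).1, fun i hi ε hε v hv => ?_, fun i hi ε hε v hv => ?_,
    fun i hi ε hε v hv => ?_, fun hk => ?_⟩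
  · obtain ⟨h1, h2, h3, h4, h5, h6⟩ := hidx i hi
    have := h.init _ h1
    rwa [h2, h4, neg_sub_neg] at this
  · obtain ⟨h1, h2, h3, h4, h5, h6⟩ := hidx i hi
    have := h.mem _ h1 ε hε
    rwa [h2, h3, h4, neg_sub_neg] at this
  · obtain ⟨h1, h2, h3, h4, h5, h6⟩ := hidx i hi
    have := h.eq_a _ h1 ε hε
    simp only [h3] at this
    rw [h6]; rwa [chordMean_reflect] at this
  · obtain ⟨h1, h2, h3, h4, h5, h6⟩ := hidx i hi
    have := h.eq_b _ h1 ε hε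
    simp only [h3] at this
    rw [h5]; rwa [chordMean_reflect] at this
  · obtain ⟨h1, h2⟩ := hidx' i hi
    have := h.neg_arc H' hf' hη hneg' h1 hε (v := -v) (by
      simp only [h2]; exact ⟨neg_le_neg hv.2, neg_le_neg hv.1⟩)
    rw [frcL]
    exact neg_pos.2 this
  · obtain ⟨h1, h2, h3, h4, h5, h6⟩ := hidx i hi
    have := h.neg_before H' hf' hη hneg' h1 (by
      simp only [h2, h4]; rw [neg_sub_neg]; exact hL i hi) hε (v := -v) (by
      simp only [h3, h4]; exact ⟨neg_le_neg hv.2, neg_le_neg hv.1⟩)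
    rw [frcL, h5]
    exact neg_pos.2 this
  · obtain ⟨h1, h2, h3, h4, h5, h6⟩ := hidx i hi
    have := h.neg_after H' hf' hη hneg' h1 hε (v := -v) (by
      simp only [h2, h3]; exact ⟨neg_le_neg hv.2, neg_le_neg hv.1⟩)
    rw [frcL, h6]
    exact neg_pos.2 this
  -- The last arc of the reflected chain is arc 1. The chain gives the force where it enters this
  -- arc, at `aR 1`; one more crossing carries the value to `aL 1`.
  · have hkk : k ∈ Icc 1 k := ⟨hk, le_rfl⟩
    have h0 : deriv (deriv fun t => f (-t)) (-aR (k + 1 - k)) - M₀ ≤ 0 :=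
      IsRightChain.nonpos_left H' hneg' hkk
    have := (H'.frc_arc_anti hf' hkk hη h0 (h.force_anti k hkk) (h.force_init k hkk)).2
    have h1 : k + 1 - k = 1 := by omega
    simp only [h1] at this
    rw [frcL, Nat.add_sub_cancel, this, deriv2_reflect_apply, neg_neg]
    ring

lemma IsLeftChain.mono {η₂' : ℝ} {l K : ℕ → ℝ → ℝ}
    (h : IsLeftChain f k aL aR a b lam M₀ η₁ η₂ l K) (hη : η₂' ≤ η₂) :
    IsLeftChain f k aL aR a b lam M₀ η₁ η₂' l K :=
  have hs : Icc η₁ η₂' ⊆ Icc η₁ η₂ := Icc_subset_Icc_right hη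
  have hs' : Ioc η₁ η₂' ⊆ Ioc η₁ η₂ := Ioc_subset_Ioc_right hη
  ⟨fun i hi => (h.cont i hi).mono hs, fun i hi => (h.anti i hi).mono hs, h.init,
    fun i hi ε hε => h.mem i hi ε (hs hε), fun i hi ε hε => h.eq_b i hi ε (hs hε),
    fun i hi ε hε => h.eq_a i hi ε (hs hε), fun i hi => (h.cont_K i hi).mono hs,
    fun i hi ε hε => h.pos_arc i hi ε (hs' hε), fun i hi ε hε => h.pos_before i hi ε (hs' hε),
    fun i hi ε hε => h.pos_after i hi ε (hs' hε), h.init_arc⟩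

lemma frcL_a (f a b : ℝ → ℝ) (ε l : ℝ) :
    frcL f ε (kap (fun t => f (-t)) ε (-a l) (chordMean f a b l)) (a l) =
      -DL f (a l) (b l) := by
  rw [frcL, (frc_eq_iff ε _ (-a l) (chordMean f a b l)).2 rfl, deriv2_reflect_apply, neg_neg]
  rfl

lemma frcL_b (f a b : ℝ → ℝ) (ε l : ℝ) :
    frcL f ε (kap (fun t => f (-t)) ε (-b l) (chordMean f a b l)) (b l) =
      -DR f (a l) (b l) := by
  rw [frcL, (frc_eq_iff ε _ (-b l) (chordMean f a b l)).2 rfl, deriv2_reflect_apply, neg_neg]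
  rfl

variable {l K l' K' : ℕ → ℝ → ℝ}

/-- At the left end of the chord selected by the left force, that force equals -D_L. A nonpositive
balance there says that the right force is at most D_L, which compares the constants belonging to
the two lengths. -/
lemma balance_a_nonpos_iff (hR : IsRightChain f k aL aR a b lam M₀ η₁ η₂ l K)
    (hL : IsLeftChain f k aL aR a b lam M₀ η₁ η₂ l' K')
    (H : IsArcSystem f k aL aR a b lam M₀) (hf : ContDiff ℝ 2 f) (hη : 0 < η₁) {i : ℕ}
    (hi : i ∈ Ico 1 k) {ε : ℝ} (hε : ε ∈ Icc η₁ η₂) :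
    balance f ε (K i ε) (K' i ε) (a i (l' i ε)) ≤ 0 ↔ l i ε ≤ l' i ε := by
  have h1 := frc_le_iff (f := f) ε (K i ε) (a i (l' i ε)) (chordMean f (a i) (b i) (l' i ε))
  rw [← hR.eq_a i hi ε hε, ((H.family i hi).strictMonoOn_kap_a hf
    (hη.trans_le hε.1)).le_iff_le (hR.mem i hi ε hε) (hL.mem i hi ε hε), hR.eq_a i hi ε hε] at h1
  rw [← h1, balance, ← hL.eq_a i hi ε hε, frcL_a, ← sub_eq_add_neg, sub_nonpos]
  rfl

/-- The mirror comparison at the right end of the chord selected by the right force. After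
reflection this is a left end, so `strictMonoOn_kap_a` applies and no bound on the length is needed.
-/
lemma balance_b_nonpos_iff (hR : IsRightChain f k aL aR a b lam M₀ η₁ η₂ l K)
    (hL : IsLeftChain f k aL aR a b lam M₀ η₁ η₂ l' K')
    (H : IsArcSystem f k aL aR a b lam M₀) (hf : ContDiff ℝ 2 f) (hη : 0 < η₁) {i : ℕ}
    (hi : i ∈ Ico 1 k) {ε : ℝ} (hε : ε ∈ Icc η₁ η₂) :
    balance f ε (K (i + 1) ε) (K' (i + 1) ε) (b i (l i ε)) ≤ 0 ↔ l i ε ≤ l' i ε := by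
  have h1 := frc_lt_iff (f := fun t => f (-t)) ε (K' (i + 1) ε) (-b i (l i ε))
    (chordMean f (a i) (b i) (l i ε))
  have h2 := ((H.family i hi).reflect.strictMonoOn_kap_a (contDiff_reflect hf)
    (hη.trans_le hε.1)).lt_iff_lt (hL.mem i hi ε hε) (hR.mem i hi ε hε)
  simp only [chordMean_reflect] at h2
  rw [← hL.eq_b i hi ε hε, h2, hL.eq_b i hi ε hε, deriv2_reflect_apply, neg_neg] at h1
  rw [← not_lt, ← not_lt, ← h1, balance, ← hR.eq_b i hi ε hε, IsChordFamily.frc_b, frcL,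
    ← sub_eq_add_neg, sub_pos]
  rfl

end LeftChain

/-- The switch is the least index at which the downward closed property fails, or k if it never
fails. -/
lemma exists_switch (k : ℕ) (hk : 1 ≤ k) (P : ℕ → Prop)
    (hP : ∀ i, 1 ≤ i → i + 1 < k → P (i + 1) → P i) :
    ∃ j ∈ Icc 1 k, (∀ i ∈ Ico 1 j, P i) ∧ ∀ i ∈ Ico j k, ¬P i := by
  classical
  have hex : ∃ j, 1 ≤ j ∧ (j = k ∨ ¬P j) := ⟨k, hk, Or.inl rfl⟩
  have hs := Nat.find_spec hex
  refine ⟨Nat.find hex, ⟨hs.1, Nat.find_min' hex ⟨hk, Or.inl rfl⟩⟩, fun i hi => ?_, fun i hi => ?_⟩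
  · have := Nat.find_min hex hi.2
    by_contra hPi
    exact this ⟨hi.1, Or.inr hPi⟩
  · obtain ⟨h1, h2⟩ := hi
    induction i, h1 using Nat.le_induction with
    | base => exact hs.2.resolve_left h2.ne
    | succ i hji ih => exact fun hPi => ih (by omega) (hP i (hs.1.trans hji) h2 hPi)

/-! ### The configuration of forces after the disintegration -/

/-- The forces on the figures after the disintegration: right forces with the constants `KR i` before
the vertex `w` of the angle, left forces with the constants `KL i` after it. -/
structure IsForceConfig (f : ℝ → ℝ) (ε : ℝ) (k j : ℕ) (w : ℝ) (u₁ u₂ : EReal) (a b : ℕ → ℝ → ℝ)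
    (l KR KL : ℕ → ℝ) (Z : Set ℝ) : Prop where
  left_le : bExt u₁ b l (j - 1) ≤ w
  le_right : (w : EReal) ≤ aExt k u₂ a l j
  lt_w : u₁ < w
  w_lt : (w : EReal) < u₂
  balanced : balance f ε (KR j) (KL j) w = 0
  right_a : ∀ i ∈ Ico 1 j, frc f ε (KR i) (a i (l i)) = DL f (a i (l i)) (b i (l i))
  right_b : ∀ i ∈ Ico 1 j, frc f ε (KR (i + 1)) (b i (l i)) = DR f (a i (l i)) (b i (l i))
  left_b : ∀ i ∈ Ico j k, frcL f ε (KL (i + 1)) (b i (l i)) = -DR f (a i (l i)) (b i (l i))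
  left_a : ∀ i ∈ Ico j k, frcL f ε (KL i) (a i (l i)) = -DL f (a i (l i)) (b i (l i))
  sign_right : ∀ i ∈ Ico 1 j, ∀ v : ℝ, bExt u₁ b l (i - 1) < v → v < a i (l i) →
    frc f ε (KR i) v ≤ 0 ∧ (v ∉ Z → frc f ε (KR i) v < 0)
  sign_right_last : ∀ v : ℝ, bExt u₁ b l (j - 1) < v → v < w →
    frc f ε (KR j) v ≤ 0 ∧ (v ∉ Z → frc f ε (KR j) v < 0)
  sign_left_first : ∀ v : ℝ, w < v → (v : EReal) < aExt k u₂ a l j →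
    0 ≤ frcL f ε (KL j) v ∧ (v ∉ Z → 0 < frcL f ε (KL j) v)
  sign_left : ∀ i ∈ Ico j k, ∀ v : ℝ, b i (l i) < v → (v : EReal) < aExt k u₂ a l (i + 1) →
    0 ≤ frcL f ε (KL (i + 1)) v ∧ (v ∉ Z → 0 < frcL f ε (KL (i + 1)) v)

section Config

variable {f : ℝ → ℝ} {k : ℕ} {aL aR : ℕ → ℝ} {a b : ℕ → ℝ → ℝ} {lam : ℕ → ℝ} {M₀ η₁ η₂ : ℝ}

lemma IsArcSystem.aL_le (H : IsArcSystem f k aL aR a b lam M₀) {i : ℕ} (hi : 1 ≤ i) (hik : i ≤ k) :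
    aL 1 ≤ aL i := by
  induction i, hi using Nat.le_induction with
  | base => exact le_rfl
  | succ i h1 ih =>
    have h2 := H.family i ⟨h1, hik⟩
    have := h2.lt
    have := h2.nonneg
    have := H.arc i ⟨h1, by omega⟩
    linarith [ih (by omega)]

lemma IsArcSystem.le_aR (H : IsArcSystem f k aL aR a b lam M₀) {i : ℕ} (hi : 1 ≤ i) (hik : i ≤ k) :
    aR i ≤ aR k := by
  induction hik using Nat.decreasingInduction with
  | of_succ m hm ih =>
    have h2 := H.family m ⟨hi, hm⟩
    have := h2.lt
    have := h2.nonneg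
    have := H.arc (m + 1) ⟨by omega, hm⟩
    linarith [ih (by omega)]
  | self => exact le_rfl

lemma bExt_zero (u₁ : EReal) (b : ℕ → ℝ → ℝ) (l : ℕ → ℝ) : bExt u₁ b l 0 = u₁ := if_pos rfl

lemma bExt_of_pos (u₁ : EReal) (b : ℕ → ℝ → ℝ) (l : ℕ → ℝ) {i : ℕ} (hi : 1 ≤ i) :
    bExt u₁ b l i = (b i (l i) : ℝ) := if_neg (by omega)

lemma aExt_self (k : ℕ) (u₂ : EReal) (a : ℕ → ℝ → ℝ) (l : ℕ → ℝ) : aExt k u₂ a l k = u₂ :=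
  if_pos rfl

lemma aExt_of_lt {k : ℕ} (u₂ : EReal) (a : ℕ → ℝ → ℝ) (l : ℕ → ℝ) {i : ℕ} (hi : i < k) :
    aExt k u₂ a l i = (a i (l i) : ℝ) := if_neg hi.ne

variable {KR KL lR lL : ℕ → ℝ → ℝ} {u₁ u₂ : EReal}

/-- The configuration of forces at the initial moment. -/
lemma isForceConfig_init (hk : 1 ≤ k) (hR : IsRightChain f k aL aR a b lam M₀ η₁ η₂ lR KR)
    (H : IsArcSystem f k aL aR a b lam M₀) (hf : ContDiff ℝ 2 f) (hη : 0 < η₁) (h12 : η₁ ≤ η₂)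
    (IR : IsRightInput f u₁ (aL 1) M₀ η₁ η₂ (KR 1))
    (IL : IsRightInput (fun t => f (-t)) (-u₂) (-aR k) M₀ η₁ η₂ (KL k))
    {l : ℕ → ℝ} (hl : ∀ i ∈ Ico 1 k, l i = aL (i + 1) - aR i) :
    IsForceConfig f η₁ k k (aR k) u₁ u₂ a b l (fun i => KR i η₁) (fun i => KL i η₁)
      (solidArcs k aL aR) := by
  have hη₁ : η₁ ∈ Icc η₁ η₂ := ⟨le_rfl, h12⟩
  have hkk : k ∈ Icc 1 k := ⟨hk, le_rfl⟩
  have hneg := IR.nonpos hf hη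
  have hk' : k = 1 ∨ (1 ≤ k - 1 ∧ k - 1 + 1 = k) := by omega
  have hu₁ : u₁ < (aR k : EReal) := IR.lt.trans_le
    (EReal.coe_le_coe_iff.2 ((H.aL_le hk le_rfl).trans (H.arc k hkk)))
  have hsign : ∀ i ∈ Icc 1 k, ∀ v : ℝ, bExt u₁ b l (i - 1) < v → v < aR i →
      frc f η₁ (KR i η₁) v ≤ 0 ∧ (v ∉ solidArcs k aL aR → frc f η₁ (KR i η₁) v < 0) := by
    intro i hi v hv1 hv2
    rcases lt_or_ge v (aL i) with hva | hva
    · have : i = 1 := by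
        by_contra hne
        have hi' : i - 1 ∈ Ico 1 k := ⟨by have := hi.1; omega, by have := hi.1; have := hi.2; omega⟩
        rw [bExt_of_pos _ _ _ hi'.1, hl _ hi', H.top_b _ hi',
          Nat.sub_add_cancel hi.1, EReal.coe_lt_coe_iff] at hv1
        exact lt_asymm hva hv1
      subst this
      have := IR.neg_init v hv1 hva
      exact ⟨this.le, fun _ => this⟩
    -- Such a point lies on a solid arc, where at the initial moment the strict inequality is not
    -- required.
    · refine ⟨?_, fun hn => (hn ⟨i, hi, hva.trans_lt hv2, hva, hv2.le⟩).elim⟩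
      rw [H.frc_arc hf hi hη ⟨hva, hv2.le⟩, hR.force_init i hi]
      exact mul_nonpos_of_nonpos_of_nonneg (IsRightChain.nonpos_left H hneg hi) (Real.exp_pos _).le
  have hempty : ∀ i ∈ Ico k k, False := fun i hi => absurd hi.1 (not_le.2 hi.2)
  refine ⟨?_, ?_, hu₁, ?_, ?_, fun i hi => ?_, fun i hi => ?_, fun i hi => (hempty i hi).elim,
    fun i hi => (hempty i hi).elim, fun i hi v hv1 hv2 => ?_, fun v hv1 hv2 => ?_,
    fun v hv1 hv2 => ?_, fun i hi => (hempty i hi).elim⟩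
  · rcases hk' with rfl | hk'
    · exact hu₁.le
    · have hi' : k - 1 ∈ Ico 1 k := ⟨by omega, by omega⟩
      rw [bExt_of_pos _ _ _ hk'.1, hl _ hi', H.top_b _ hi', hk'.2, EReal.coe_le_coe_iff]
      exact H.arc k hkk
  · rw [aExt_self]
    exact (EReal.neg_lt_neg_iff.1 (by simpa using IL.lt)).le
  · exact EReal.neg_lt_neg_iff.1 (by simpa using IL.lt)
  · have h1 := (H.frc_arc_anti hf hkk hη (IsRightChain.nonpos_left H hneg hkk)
      (hR.force_anti k hkk) (hR.force_init k hkk)).2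
    have h2 := IL.init
    rw [deriv2_reflect_apply, neg_neg] at h2
    rw [balance, frcL, h1, h2]
    ring
  · have := IsChordFamily.frc_a (f := f) (a := a i) (b := b i) η₁ (lR i η₁)
    rwa [hR.eq_a i hi η₁ hη₁, hR.init i hi, ← hl i hi] at this
  · have := IsChordFamily.frc_b (f := f) (a := a i) (b := b i) η₁ (lR i η₁)
    rwa [hR.eq_b i hi η₁ hη₁, hR.init i hi, ← hl i hi] at this
  · refine hsign i ⟨hi.1, hi.2.le⟩ v hv1 ?_
    rwa [hl i hi, H.top_a i hi] at hv2
  · exact hsign k hkk v hv1 hv2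
  · rw [aExt_self] at hv2
    have := IL.neg_init (-v) (by rw [EReal.coe_neg]; exact EReal.neg_lt_neg_iff.2 hv2)
      (neg_lt_neg hv1)
    have h3 : 0 < frcL f η₁ (KL k η₁) v := by rw [frcL]; exact neg_pos.2 this
    exact ⟨h3.le, fun _ => h3⟩

/-- The configuration of forces after the initial moment. -/
lemma exists_isForceConfig (hk : 1 ≤ k) (hR : IsRightChain f k aL aR a b lam M₀ η₁ η₂ lR KR)
    (hL : IsLeftChain f k aL aR a b lam M₀ η₁ η₂ lL KL)
    (H : IsArcSystem f k aL aR a b lam M₀) (hf : ContDiff ℝ 2 f) (hη : 0 < η₁)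
    (hlen : ∀ i ∈ Ico 1 k, aL (i + 1) - aR i ≤ 2 * η₁)
    (IR : IsRightInput f u₁ (aL 1) M₀ η₁ η₂ (KR 1))
    (IL : IsRightInput (fun t => f (-t)) (-u₂) (-aR k) M₀ η₁ η₂ (KL k))
    {wm wp : ℝ} (hwm : u₁ < wm) (hwm1 : wm < aL 1) (hwp : aR k < wp) (hwp1 : (wp : EReal) < u₂)
    {ε : ℝ} (hε : ε ∈ Ioc η₁ η₂) (hbm : balance f ε (KR 1 ε) (KL 1 ε) wm < 0)
    (hbp : 0 < balance f ε (KR k ε) (KL k ε) wp) (Z : Set ℝ) :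
    ∃ j ∈ Icc 1 k, ∃ w, IsForceConfig f ε k j w u₁ u₂ a b (fun i => min (lR i ε) (lL i ε))
      (fun i => KR i ε) (fun i => KL i ε) Z := by
  have hε' : ε ∈ Icc η₁ η₂ := Ioc_subset_Icc_self hε
  have hε0 : 0 < ε := hη.trans hε.1
  have hneg := IR.nonpos hf hη
  have ILpos : ∀ v : ℝ, aR k ≤ v → (v : EReal) < u₂ → 0 < frcL f ε (KL k ε) v := by
    intro v h1 h2
    rw [frcL]
    exact neg_pos.2 (IL.neg ε hε (-v) (by rw [EReal.coe_neg]; exact EReal.neg_lt_neg_iff.2 h2)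
      (neg_le_neg h1))
  -- Nonpositivity of the balance travels from the left end of chord i + 1 to the right end of chord
  -- i: back to `aL (i + 1)` because left forces are positive, from there on because right forces
  -- are negative.
  obtain ⟨j, hj, hjR, hjL⟩ := exists_switch k hk (fun i => lR i ε ≤ lL i ε) (by
    intro i h1 hik hle
    have hi : i ∈ Ico 1 k := ⟨h1, by omega⟩
    have hi1 : i + 1 ∈ Ico 1 k := ⟨by omega, hik⟩
    have hi1' : i + 1 ∈ Icc 1 k := ⟨by omega, hik.le⟩
    rw [← balance_a_nonpos_iff hR hL H hf hη hi1 hε'] at hle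
    rw [← balance_b_nonpos_iff hR hL H hf hη hi hε']
    have harc := H.arc (i + 1) hi1'
    have hF := H.family (i + 1) hi1
    have hm := hL.mem (i + 1) hi1 ε hε'
    have h2 : aR (i + 1) ≤ a (i + 1) (lL (i + 1) ε) := by
      rw [← H.top_a _ hi1]
      exact hF.strictAntiOn.antitoneOn (Ioc_subset_Icc_self hm) ⟨hF.lt.le, le_rfl⟩ hm.2
    have hmid : balance f ε (KR (i + 1) ε) (KL (i + 1) ε) (aL (i + 1)) ≤ 0 := by
      refine balance_nonpos_of_frcL_nonneg hf hε0 (harc.trans h2) (fun v hv => ?_) hle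
      rcases le_total v (aR (i + 1)) with hv' | hv'
      · exact (hL.pos_arc _ hi1' ε hε v ⟨hv.1.le, hv'⟩).le
      · exact (hL.pos_before _ hi1 ε hε v ⟨hv', hv.2.le⟩).le
    have hF' := H.family i hi
    have hm' := hR.mem i hi ε hε'
    have h3 : b i (lR i ε) ≤ aL (i + 1) := by
      rw [← H.top_b _ hi]
      exact hF'.strictMonoOn.monotoneOn (Ioc_subset_Icc_self hm') ⟨hF'.lt.le, le_rfl⟩ hm'.2
    exact balance_nonpos_of_frc_nonpos hf hε0 h3 (fun v hv =>
      (hR.neg_before H hf hη hneg hi (hlen i hi) hε (Ioo_subset_Icc_self hv)).le) hmid)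
  set l : ℕ → ℝ := fun i => min (lR i ε) (lL i ε) with hl
  have hlR : ∀ i ∈ Ico 1 j, l i = lR i ε := fun i hi => min_eq_left (hjR i hi)
  have hlL : ∀ i ∈ Ico j k, l i = lL i ε := fun i hi => min_eq_right (not_le.1 (hjL i hi)).le
  have hIR : ∀ i ∈ Ico 1 j, i ∈ Ico 1 k := fun i hi => ⟨hi.1, hi.2.trans_le hj.2⟩
  have hIL : ∀ i ∈ Ico j k, i ∈ Ico 1 k := fun i hi => ⟨hj.1.trans hi.1, hi.2⟩
  have hneg_to : ∀ i ∈ Icc 1 j, ∀ v : ℝ, bExt u₁ b l (i - 1) < v → v ≤ aL i →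
      frc f ε (KR i ε) v < 0 := by
    intro i hi v hv1 hv2
    rcases hi.1.eq_or_lt with he | hlt
    · subst he
      exact IR.neg ε hε v hv1 hv2
    · have hi' : i - 1 ∈ Ico 1 j := ⟨by omega, by have := hi.2; omega⟩
      rw [bExt_of_pos _ _ _ hi'.1, hlR _ hi', EReal.coe_lt_coe_iff] at hv1
      have := hR.neg_before H hf hη hneg (hIR _ hi') (hlen _ (hIR _ hi')) hε
        (v := v) ⟨hv1.le, by rwa [Nat.sub_add_cancel hi.1]⟩
      rwa [Nat.sub_add_cancel hi.1] at this
  -- A point before arc j with nonpositive balance: the right end of chord j - 1, by the choice of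
  -- j, or the auxiliary point `wm` if j = 1.
  have hxm : ∃ xm : ℝ, bExt u₁ b l (j - 1) ≤ xm ∧ u₁ < xm ∧ xm ≤ aL j ∧
      balance f ε (KR j ε) (KL j ε) xm ≤ 0 ∧ (∀ v ∈ Icc xm (aL j), frc f ε (KR j ε) v < 0) := by
    rcases hj.1.eq_or_lt with he | hlt
    · subst he
      exact ⟨wm, hwm.le, hwm, hwm1.le, hbm.le, fun v hv =>
        IR.neg ε hε v (hwm.trans_le (EReal.coe_le_coe_iff.2 hv.1)) hv.2⟩
    · have hi' : j - 1 ∈ Ico 1 j := ⟨by omega, by omega⟩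
      have hsub : j - 1 + 1 = j := Nat.sub_add_cancel hj.1
      have hik := hIR _ hi'
      have hF := H.family _ hik
      have hm := hR.mem _ hik ε hε'
      have htopm : aL (j - 1 + 1) - aR (j - 1) ∈ Icc (lam (j - 1)) (aL (j - 1 + 1) - aR (j - 1)) :=
        ⟨hF.lt.le, le_rfl⟩
      refine ⟨b (j - 1) (lR (j - 1) ε), ?_, ?_, ?_, ?_, fun v hv => ?_⟩
      · rw [bExt_of_pos _ _ _ hi'.1, hlR _ hi']
      · refine IR.lt.trans (EReal.coe_lt_coe_iff.2 ?_)
        have h1 := H.aL_le hik.1 hik.2.le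
        have h2 := H.arc (j - 1) ⟨hik.1, hik.2.le⟩
        have h3 := hF.strictAntiOn.antitoneOn (Ioc_subset_Icc_self hm) htopm hm.2
        rw [H.top_a _ hik] at h3
        have h4 := hF.lt_of_mem hm
        linarith
      · have := hF.strictMonoOn.monotoneOn (Ioc_subset_Icc_self hm) htopm hm.2
        rwa [H.top_b _ hik, hsub] at this
      · have := (balance_b_nonpos_iff hR hL H hf hη hik hε').2 (hjR _ hi')
        rwa [hsub] at this
      · have := hR.neg_before H hf hη hneg hik (hlen _ hik) hε (v := v) (by rwa [hsub])
        rwa [hsub] at this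
  -- Likewise a point after `aL j` with nonnegative balance: the left end of chord j, or `wp` if j =
  -- k.
  have hxp : ∃ xp : ℝ, (xp : EReal) ≤ aExt k u₂ a l j ∧ (xp : EReal) < u₂ ∧ aL j ≤ xp ∧
      0 ≤ balance f ε (KR j ε) (KL j ε) xp ∧ (∀ v ∈ Icc (aL j) xp, 0 < frcL f ε (KL j ε) v) ∧
      ∀ v : ℝ, xp < v → (v : EReal) < aExt k u₂ a l j → 0 < frcL f ε (KL j ε) v := by
    have harc := H.arc j hj
    rcases hj.2.eq_or_lt with he | hlt
    · subst he
      rw [aExt_self]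
      refine ⟨wp, hwp1.le, hwp1, harc.trans hwp.le, hbp.le, fun v hv => ?_,
        fun v hv1 hv2 => ILpos v (hwp.le.trans hv1.le) hv2⟩
      rcases le_total v (aR j) with hv' | hv'
      · exact hL.pos_arc j hj ε hε v ⟨hv.1, hv'⟩
      · exact ILpos v hv' ((EReal.coe_le_coe_iff.2 hv.2).trans_lt hwp1)
    · have hi' : j ∈ Ico j k := ⟨le_rfl, hlt⟩
      have hik := hIL _ hi'
      have hF := H.family _ hik
      have hm := hL.mem _ hik ε hε'
      have htopm : aL (j + 1) - aR j ∈ Icc (lam j) (aL (j + 1) - aR j) := ⟨hF.lt.le, le_rfl⟩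
      have h3 := hF.strictAntiOn.antitoneOn (Ioc_subset_Icc_self hm) htopm hm.2
      rw [H.top_a _ hik] at h3
      rw [aExt_of_lt _ _ _ hlt, hlL _ hi']
      refine ⟨a j (lL j ε), le_rfl, ?_, harc.trans h3, ?_, fun v hv => ?_, fun v hv1 hv2 =>
        absurd (EReal.coe_lt_coe_iff.1 hv2) hv1.not_gt⟩
      · refine lt_trans (EReal.coe_lt_coe_iff.2 ?_) (hwp1)
        have h1 := H.le_aR (i := j + 1) (by omega) hlt
        have h2 := H.arc (j + 1) ⟨by omega, hlt⟩
        have h5 := hF.strictMonoOn.monotoneOn (Ioc_subset_Icc_self hm) htopm hm.2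
        rw [H.top_b _ hik] at h5
        have h4 := hF.lt_of_mem hm
        linarith
      · exact (not_le.1 fun hle => hjL _ hi'
          ((balance_a_nonpos_iff hR hL H hf hη hik hε').1 hle)).le
      · rcases le_total v (aR j) with hv' | hv'
        · exact hL.pos_arc j hj ε hε v ⟨hv.1, hv'⟩
        · exact hL.pos_before j hik ε hε v ⟨hv', hv.2⟩
  obtain ⟨xm, hxm1, hxm2, hxm3, hxm4, hxm5⟩ := hxm
  obtain ⟨xp, hxp1, hxp2, hxp3, hxp4, hxp5, hxp6⟩ := hxp
  obtain ⟨w, hw, hw0, hwR, hwL⟩ := exists_balance_eq_zero hf hε0 hxm3 hxp3 hxm5 hxp5 hxm4 hxp4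
  have hwm' : (xm : EReal) ≤ w := EReal.coe_le_coe_iff.2 hw.1
  have hwp' : (w : EReal) ≤ xp := EReal.coe_le_coe_iff.2 hw.2
  refine ⟨j, hj, w, hxm1.trans hwm', hwp'.trans hxp1, hxm2.trans_le hwm', hwp'.trans_lt hxp2, hw0,
    fun i hi => ?_, fun i hi => ?_, fun i hi => ?_, fun i hi => ?_, fun i hi v hv1 hv2 => ?_,
    fun v hv1 hv2 => ?_, fun v hv1 hv2 => ?_, fun i hi v hv1 hv2 => ?_⟩
  · have := IsChordFamily.frc_a (f := f) (a := a i) (b := b i) ε (lR i ε)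
    rw [hR.eq_a i (hIR i hi) ε hε'] at this
    simp only [hlR i hi]
    exact this
  · have := IsChordFamily.frc_b (f := f) (a := a i) (b := b i) ε (lR i ε)
    rw [hR.eq_b i (hIR i hi) ε hε'] at this
    simp only [hlR i hi]
    exact this
  · have := frcL_b f (a i) (b i) ε (lL i ε)
    rw [hL.eq_b i (hIL i hi) ε hε'] at this
    simp only [hlL i hi]
    exact this
  · have := frcL_a f (a i) (b i) ε (lL i ε)
    rw [hL.eq_a i (hIL i hi) ε hε'] at this
    simp only [hlL i hi]
    exact this
  · have : frc f ε (KR i ε) v < 0 := by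
      rcases le_total v (aL i) with h1 | h1
      · exact hneg_to i ⟨hi.1, hi.2.le⟩ v hv1 h1
      rcases le_total v (aR i) with h2 | h2
      · exact hR.neg_arc H hf hη hneg ⟨hi.1, (hIR i hi).2.le⟩ hε ⟨h1, h2⟩
      · simp only [hlR i hi] at hv2
        exact hR.neg_after H hf hη hneg (hIR i hi) hε ⟨h2, hv2.le⟩
    exact ⟨this.le, fun _ => this⟩
  · have : frc f ε (KR j ε) v < 0 := by
      rcases le_total xm v with h1 | h1
      · exact hwR v ⟨h1, hv2⟩
      · exact hneg_to j ⟨hj.1, le_rfl⟩ v hv1 (h1.trans hxm3)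
    exact ⟨this.le, fun _ => this⟩
  · have : 0 < frcL f ε (KL j ε) v := by
      rcases le_or_gt v xp with h1 | h1
      · exact hwL v ⟨hv1, h1⟩
      · exact hxp6 v h1 hv2
    exact ⟨this.le, fun _ => this⟩
  · have : 0 < frcL f ε (KL (i + 1) ε) v := by
      have hik := hIL i hi
      have hi1 : i + 1 ∈ Icc 1 k := ⟨by omega, hi.2⟩
      simp only [hlL i hi] at hv1
      rcases le_total v (aL (i + 1)) with h1 | h1
      · exact hL.pos_after i hik ε hε v ⟨hv1.le, h1⟩
      rcases le_total v (aR (i + 1)) with h2 | h2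
      · exact hL.pos_arc (i + 1) hi1 ε hε v ⟨h1, h2⟩
      rcases hi1.2.eq_or_lt with he | hlt
      · rw [he] at h2 ⊢
        rw [he, aExt_self] at hv2
        exact ILpos v h2 hv2
      · have hi' : i + 1 ∈ Ico j k := ⟨by have := hi.1; omega, hlt⟩
        rw [aExt_of_lt _ _ _ hlt, hlL _ hi', EReal.coe_lt_coe_iff] at hv2
        exact hL.pos_before (i + 1) (hIL _ hi') ε hε v ⟨h2, hv2.le⟩
    exact ⟨this.le, fun _ => this⟩

end Config

lemma continuousOn_balance {f : ℝ → ℝ} (hf : ContDiff ℝ 2 f) {s : Set ℝ} (hs : ∀ ε ∈ s, 0 < ε)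
    {K K' : ℝ → ℝ} (hK : ContinuousOn K s) (hK' : ContinuousOn K' s) (v : ℝ) :
    ContinuousOn (fun ε => balance f ε (K ε) (K' ε) v) s :=
  (continuousOn_frc hf hs hK continuousOn_const).add
    (continuousOn_frc (contDiff_reflect hf) hs hK' continuousOn_const).neg

/-- The lengths of the chords and the forces of the disintegrating multibirdie. -/
theorem exists_forceConfigs {f : ℝ → ℝ} {k : ℕ} {aL aR : ℕ → ℝ} {a b : ℕ → ℝ → ℝ} {lam : ℕ → ℝ}
    {M₀ η₁ η₃ : ℝ} {u₁ u₂ : EReal} {K₁ K₂ : ℝ → ℝ} (hk : 1 ≤ k)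
    (H : IsArcSystem f k aL aR a b lam M₀) (hf : ContDiff ℝ 2 f) (hη : 0 < η₁) (h13 : η₁ < η₃)
    (hlen : ∀ i ∈ Ico 1 k, aL (i + 1) - aR i ≤ 2 * η₁)
    (IR : IsRightInput f u₁ (aL 1) M₀ η₁ η₃ K₁)
    (IL : IsRightInput (fun t => f (-t)) (-u₂) (-aR k) M₀ η₁ η₃ K₂) :
    ∃ η₂, η₁ < η₂ ∧ η₂ ≤ η₃ ∧ ∃ l : ℕ → ℝ → ℝ,
      (∀ i ∈ Ico 1 k, ContinuousOn (l i) (Icc η₁ η₂) ∧ StrictAntiOn (l i) (Icc η₁ η₂) ∧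
        l i η₁ = aL (i + 1) - aR i) ∧
      ∀ ε ∈ Icc η₁ η₂, (∀ i ∈ Ico 1 k, l i ε ∈ Ioc (lam i) (aL (i + 1) - aR i)) ∧
        ∃ j ∈ Icc 1 k, ∃ w : ℝ, ∃ KR KL : ℕ → ℝ, KR 1 = K₁ ε ∧ KL k = K₂ ε ∧
          IsForceConfig f ε k j w u₁ u₂ a b (fun i => l i ε) KR KL
            {t | ε = η₁ ∧ t ∈ solidArcs k aL aR} := by
  have hf' := contDiff_reflect hf
  have hk1 : 1 ∈ Icc 1 k := ⟨le_rfl, hk⟩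
  have hkk : k ∈ Icc 1 k := ⟨hk, le_rfl⟩
  obtain ⟨ηR, hR1, hR3, lR, KR, hKR1, hR⟩ := H.exists_rightChain hf hη h13 hlen
    (IR.nonpos hf hη) IR.cont IR.anti IR.init k hk le_rfl
  have h1k : k + 1 - 1 = k := by omega
  obtain ⟨ηL, hL1, hL3, lL, KL, hKL1, hL⟩ := H.reflect.exists_rightChain hf' hη h13
    (fun i hi => by
      have h1 : k + 1 - (i + 1) = k - i := by omega
      have h2 : k + 1 - i = k - i + 1 := by have := hi.2; omega
      rw [h1, h2, neg_sub_neg]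
      exact hlen _ ⟨by have := hi.2; omega, by have := hi.1; have := hi.2; omega⟩)
    (by simp only [h1k]; exact IL.nonpos hf' hη) IL.cont (by simp only [h1k]; exact IL.anti)
    (by simp only [h1k]; exact IL.init) k hk le_rfl
  have hnegk : deriv (deriv f) (aR k) - M₀ ≤ 0 := by
    have := IL.nonpos hf' hη
    rwa [deriv2_reflect_apply, neg_neg] at this
  set η₀ := min ηR ηL with hη₀
  have h10 : η₁ < η₀ := lt_min hR1 hL1
  replace hR := hR.mono (min_le_left ηR ηL)
  have hLc := (hL.isLeftChain H hf hη hlen hnegk).mono (min_le_right ηR ηL)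
  set lL' : ℕ → ℝ → ℝ := fun i => lL (k - i) with hlL'
  set KL' : ℕ → ℝ → ℝ := fun i => KL (k + 1 - i) with hKL'
  have hKLk : KL' k = K₂ := by
    have : k + 1 - k = 1 := by omega
    rw [hKL']; simp only [this]; exact hKL1
  have h03 : η₀ ≤ η₃ := (min_le_left _ _).trans hR3
  have IR0 := IR.mono h03
  have IL0 := IL.mono h03
  have hpos : ∀ ε ∈ Icc η₁ η₀, 0 < ε := fun ε hε => hη.trans_le hε.1
  have hη₁m : η₁ ∈ Icc η₁ η₀ := ⟨le_rfl, h10.le⟩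
  obtain ⟨wm, hwm, hwm1⟩ := EReal.lt_iff_exists_real_btwn.1 IR.lt
  replace hwm1 := EReal.coe_lt_coe_iff.1 hwm1
  have hlt2 : (aR k : EReal) < u₂ := EReal.neg_lt_neg_iff.1 (by simpa using IL.lt)
  obtain ⟨wp, hwp, hwp1⟩ := EReal.lt_iff_exists_real_btwn.1 hlt2
  replace hwp := EReal.coe_lt_coe_iff.1 hwp
  -- At η₁ the balance vanishes at `aL 1` and at `aR k`. It is therefore strictly negative before
  -- the first arc and strictly positive after the last one, and at two fixed points these signs
  -- survive for ε close to η₁.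
  have hm0 : balance f η₁ (KR 1 η₁) (KL' 1 η₁) wm < 0 := by
    refine balance_neg_of_frc_neg hf hη hwm1 (fun v hv => ?_) ?_
    · rw [hKR1]
      exact IR.neg_init v (hwm.trans (EReal.coe_lt_coe_iff.2 hv.1)) hv.2
    · rw [balance, hLc.init_arc hk, hR.force_init 1 hk1]
      linarith
  have hp0 : 0 < balance f η₁ (KR k η₁) (KL' k η₁) wp := by
    refine balance_pos_of_frcL_pos hf hη hwp (fun v hv => ?_) ?_
    · rw [hKLk, frcL]
      exact neg_pos.2 (IL.neg_init (-v) (by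
        rw [EReal.coe_neg]
        exact EReal.neg_lt_neg_iff.2 ((EReal.coe_lt_coe_iff.2 hv.2).trans hwp1))
        (neg_lt_neg hv.1))
    · have h1 := (H.frc_arc_anti hf hkk hη (IsRightChain.nonpos_left H (IR.nonpos hf hη) hkk)
        (hR.force_anti k hkk) (hR.force_init k hkk)).2
      have h2 := IL.init
      rw [deriv2_reflect_apply, neg_neg] at h2
      rw [balance, frcL, h1, hKLk, h2]
      linarith
  have hev1 := ((continuousOn_balance hf hpos (hR.cont_K 1 hk1) (hLc.cont_K 1 hk1) wm)
    η₁ hη₁m).eventually_lt continuousWithinAt_const hm0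
  have hev2 := (continuousWithinAt_const (b := (0 : ℝ))).eventually_lt
    ((continuousOn_balance hf hpos (hR.cont_K k hkk) (hLc.cont_K k hkk) wp) η₁ hη₁m) hp0
  obtain ⟨η₂, h12, h20, hη₂⟩ := exists_Icc_of_eventually h10 (hev1.and hev2)
  have hsub : Icc η₁ η₂ ⊆ Icc η₁ η₀ := Icc_subset_Icc_right h20
  refine ⟨η₂, h12, h20.trans h03, fun i ε => min (lR i ε) (lL' i ε), fun i hi => ⟨?_, ?_, ?_⟩,
    fun ε hε => ⟨fun i hi => ?_, ?_⟩⟩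
  · exact (continuous_min.comp_continuousOn ((hR.cont i hi).prodMk (hLc.cont i hi))).mono hsub
  · exact fun x hx y hy hxy => min_lt_min (hR.anti i hi (hsub hx) (hsub hy) hxy)
      (hLc.anti i hi (hsub hx) (hsub hy) hxy)
  · simp only [hR.init i hi, hLc.init i hi, min_self]
  · have h1 := hR.mem i hi ε (hsub hε)
    have h2 := hLc.mem i hi ε (hsub hε)
    exact ⟨lt_min h1.1 h2.1, (min_le_left _ _).trans h1.2⟩
  · rcases hε.1.eq_or_lt with he | hlt
    · subst he
      -- At η₁ the multibirdie is cut by right tangents only, and the vertex of the angle is its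
      -- right end.
      refine ⟨k, hkk, aR k, fun i => KR i η₁, fun i => KL' i η₁, congrFun hKR1 η₁, congrFun hKLk η₁, ?_⟩
      have hZ : {t | η₁ = η₁ ∧ t ∈ solidArcs k aL aR} = solidArcs k aL aR := by
        ext t; simp
      rw [hZ]
      refine isForceConfig_init hk hR H hf hη h10.le (by rw [hKR1]; exact IR0)
        (by rw [hKLk]; exact IL0) fun i hi => ?_
      simp only [hR.init i hi, hLc.init i hi, min_self]
    · obtain ⟨j, hj, w, hw⟩ := exists_isForceConfig hk hR hLc H hf hη hlen
        (by rw [hKR1]; exact IR0) (by rw [hKLk]; exact IL0) hwm hwm1 hwp hwp1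
        ⟨hlt, hε.2.trans h20⟩ (hη₂ ε hε).1 (hη₂ ε hε).2 {t | ε = η₁ ∧ t ∈ solidArcs k aL aR}
      exact ⟨j, hj, w, fun i => KR i ε, fun i => KL' i ε, congrFun hKR1 ε, congrFun hKLk ε, hw⟩

/-! ### Geometry of the strip -/

lemma continuous_uR (ε : ℝ) : Continuous (uR ε) := by unfold uR; fun_prop

lemma isClosed_strip (ε : ℝ) : IsClosed (strip ε) := by
  have h1 : IsClosed {x : ℝ × ℝ | x.1 ^ 2 ≤ x.2} := isClosed_le (by fun_prop) (by fun_prop)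
  have h2 : IsClosed {x : ℝ × ℝ | x.2 ≤ x.1 ^ 2 + ε ^ 2} :=
    isClosed_le (by fun_prop) (by fun_prop)
  exact h1.inter h2

lemma isClosed_tangR (ε : ℝ) (c d : EReal) : IsClosed (tangR ε c d) := by
  have h : Continuous fun x => (uR ε x : EReal) := continuous_coe_real_ereal.comp (continuous_uR ε)
  exact (isClosed_strip ε).inter
    ((isClosed_le continuous_const h).inter (isClosed_le h continuous_const))

lemma isClosed_trolleyR (ε a b : ℝ) : IsClosed (trolleyR ε a b) :=
  (isClosed_tangR ε a b).inter (isClosed_le (by fun_prop) (by fun_prop))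

lemma isClosed_angle (ε w : ℝ) : IsClosed (angle ε w) := by
  have h1 : IsClosed {x : ℝ × ℝ | w - ε ≤ x.1} := isClosed_le (by fun_prop) (by fun_prop)
  have h2 : IsClosed {x : ℝ × ℝ | x.1 ≤ w + ε} := isClosed_le (by fun_prop) (by fun_prop)
  have h3 : IsClosed {x : ℝ × ℝ | 2 * w * x.1 - w ^ 2 + 2 * ε * |w - x.1| ≤ x.2} :=
    isClosed_le (by fun_prop) (by fun_prop)
  have h4 : IsClosed {x : ℝ × ℝ | x.2 ≤ x.1 ^ 2 + ε ^ 2} := isClosed_le (by fun_prop) (by fun_prop)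
  exact h1.inter (h2.inter (h3.inter h4))

lemma strip_spec {ε : ℝ} (hε : 0 < ε) {x : ℝ × ℝ} (hx : x ∈ strip ε) :
    ∃ s, 0 ≤ s ∧ s ≤ ε ∧ s ^ 2 = x.1 ^ 2 + ε ^ 2 - x.2 ∧ uR ε x = x.1 + ε - s ∧
      uL ε x = x.1 - ε + s := by
  refine ⟨√(x.1 ^ 2 + ε ^ 2 - x.2), Real.sqrt_nonneg _, ?_, Real.sq_sqrt ?_, rfl, rfl⟩
  · rw [Real.sqrt_le_left hε.le]
    linarith [hx.1]
  · linarith [hx.2]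

/-- The value of the affine function with the coefficient `β` at `x₂` whose graph is tangent to the
boundary curve at `t`. -/
def tangentLin (f : ℝ → ℝ) (t β : ℝ) (x : ℝ × ℝ) : ℝ :=
  f t + (deriv f t - 2 * β * t) * (x.1 - t) + β * (x.2 - t ^ 2)

lemma continuous_tangentLin (f : ℝ → ℝ) (t β : ℝ) : Continuous (tangentLin f t β) := by
  unfold tangentLin; fun_prop

/-- The matching condition with a right tangent domain: its slope at t must be f'(t) - 2εβ, that is,
2β must equal f'' minus the force. -/
lemma tangentLin_of_uR {f : ℝ → ℝ} {ε t β : ℝ} (hε : 0 < ε) {x : ℝ × ℝ} (hx : x ∈ strip ε)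
    (hu : uR ε x = t) :
    tangentLin f t β x = (deriv f t - ε * (2 * β)) * (x.1 - t) + f t := by
  obtain ⟨s, _, _, h3, h4, _⟩ := strip_spec hε hx
  have hs : s = x.1 + ε - t := by linarith
  rw [hs] at h3
  rw [tangentLin]
  linear_combination β * h3

lemma tangentLin_of_uL {f : ℝ → ℝ} {ε t β : ℝ} (hε : 0 < ε) {x : ℝ × ℝ} (hx : x ∈ strip ε)
    (hu : uL ε x = t) :
    tangentLin f t β x = (deriv f t + ε * (2 * β)) * (x.1 - t) + f t := by
  obtain ⟨s, _, _, h3, _, h4⟩ := strip_spec hε hx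
  have hs : s = -x.1 + ε + t := by linarith
  rw [hs] at h3
  rw [tangentLin]
  linear_combination β * h3

lemma mem_strip_of_mem_angle {ε w : ℝ} {x : ℝ × ℝ} (hx : x ∈ angle ε w) : x ∈ strip ε := by
  obtain ⟨h1, h2, h3, h4⟩ := hx
  refine ⟨?_, h4⟩
  rcases abs_cases (w - x.1) with ⟨h, _⟩ | ⟨h, _⟩ <;> rw [h] at h3 <;> nlinarith

/-- Consequently the angle meets the domains on either side of it only along its boundary tangents,
which is all that the gluing has to check. -/
lemma uR_of_mem_angle {ε w : ℝ} (hε : 0 < ε) {x : ℝ × ℝ} (hx : x ∈ angle ε w) :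
    w ≤ uR ε x ∧ uL ε x ≤ w := by
  obtain ⟨s, hs0, hsε, hs, hR, hL⟩ := strip_spec hε (mem_strip_of_mem_angle hx)
  obtain ⟨h1, h2, h3, h4⟩ := hx
  have h5 := le_abs_self (w - x.1)
  have h6 := neg_le_abs (w - x.1)
  rw [hR, hL]
  constructor
  · have : s ≤ x.1 + ε - w := by
      refine abs_le_of_sq_le_sq' ?_ (by linarith) |>.2
      nlinarith
    linarith
  · have : s ≤ w + ε - x.1 := by
      refine abs_le_of_sq_le_sq' ?_ (by linarith) |>.2
      nlinarith
    linarith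

/-! ### Pieces under a chord -/

/-- A closed set `C` between the lower parabola and the chord over `[p, q]` with a continuous function
on it that coincides on the chord with the linear function determined by the cup equation; `M` is the
mean value of `f''` over the chord. -/
structure IsChordPiece (f : ℝ → ℝ) (ε p q M : ℝ) (C : Set (ℝ × ℝ)) (B : ℝ × ℝ → ℝ) : Prop where
  lt : p < q
  length_le : q - p ≤ 2 * ε
  mean : deriv f q - deriv f p = M * (q - p)
  cup : f q - f p = (q - p) * ((deriv f p + deriv f q) / 2)
  closed : IsClosed C
  lens : ∀ x ∈ C, x.1 ^ 2 ≤ x.2 ∧ x.2 ≤ (p + q) * x.1 - p * q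
  cont : ContinuousOn B C
  top : ∀ x ∈ C, x.2 = (p + q) * x.1 - p * q → B x = tangentLin f p (M / 2) x

namespace IsChordPiece

variable {f : ℝ → ℝ} {ε p q M : ℝ} {C : Set (ℝ × ℝ)} {B : ℝ × ℝ → ℝ}

/-- The cup equation makes a single affine function, with x₂-coefficient half the mean of f'',
tangent to the boundary curve at both ends of the chord. -/
lemma tangentLin_eq (h : IsChordPiece f ε p q M C B) (x : ℝ × ℝ) :
    tangentLin f p (M / 2) x = tangentLin f q (M / 2) x := by
  rw [tangentLin, tangentLin]
  linear_combination (-1) * h.cup - (x.1 - q / 2 - p / 2) * h.mean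

lemma isStdLinear (h : IsChordPiece f ε p q M C B) {D : Set (ℝ × ℝ)} {G : ℝ × ℝ → ℝ}
    (hG : ∀ x ∈ D, G x = tangentLin f p (M / 2) x) : IsStdLinear f {p, q} D G := by
  refine ⟨f p - p * deriv f p + M / 2 * p ^ 2, deriv f p - 2 * (M / 2) * p, M / 2,
    fun x hx => ?_, fun t ht => ?_⟩
  · rw [hG x hx, tangentLin]; ring
  · rcases ht with rfl | ht
    · exact ⟨rfl, rfl⟩
    · rw [mem_singleton_iff.1 ht]
      constructor
      · linear_combination (-1) * h.mean
      · linear_combination (-1) * h.cup + (q / 2 + p / 2) * h.mean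

lemma mem_strip (h : IsChordPiece f ε p q M C B) {x : ℝ × ℝ} (hx : x ∈ C) :
    x ∈ strip ε := by
  obtain ⟨h1, h2⟩ := h.lens x hx
  have := h.length_le
  have := h.lt
  refine ⟨h1, h2.trans ?_⟩
  nlinarith [sq_nonneg (2 * x.1 - p - q), sq_nonneg (q - p)]

lemma mem_Icc (h : IsChordPiece f ε p q M C B) {x : ℝ × ℝ} (hx : x ∈ C) :
    x.1 ∈ Icc p q := by
  obtain ⟨h1, h2⟩ := h.lens x hx
  have := h.lt
  constructor
  · by_contra hc
    nlinarith
  · by_contra hc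
    nlinarith

lemma uR_mem (h : IsChordPiece f ε p q M C B) (hε : 0 < ε) {x : ℝ × ℝ} (hx : x ∈ C) :
    p ≤ uR ε x ∧ uR ε x ≤ q := by
  obtain ⟨s, hs0, hsε, hs, hR, _⟩ := strip_spec hε (h.mem_strip hx)
  obtain ⟨h1, h2⟩ := h.lens x hx
  obtain ⟨h3, h4⟩ := h.mem_Icc hx
  have h5 := h.length_le
  rw [hR]
  refine ⟨by linarith, ?_⟩
  have h6 : x.1 + ε - q ≤ s := by
    by_contra hc
    push Not at hc
    have h7 : s ^ 2 < (x.1 + ε - q) ^ 2 := by nlinarith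
    nlinarith [mul_nonneg (sub_nonneg.2 h4) (sub_nonneg.2 h5)]
  linarith

/-- The piece touches the extreme tangents only at points of its upper chord. At the tangent ending
at q this holds because (q - x₁) (2ε - (q - p)) ≥ 0. -/
lemma top_of_uR (h : IsChordPiece f ε p q M C B) (hε : 0 < ε) {x : ℝ × ℝ} (hx : x ∈ C)
    (hu : uR ε x = p ∨ uR ε x = q) : B x = tangentLin f p (M / 2) x := by
  refine h.top x hx ?_
  obtain ⟨s, hs0, hsε, hs, hR, _⟩ := strip_spec hε (h.mem_strip hx)
  obtain ⟨h1, h2⟩ := h.lens x hx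
  obtain ⟨h3, h4⟩ := h.mem_Icc hx
  have h5 := h.length_le
  refine le_antisymm h2 ?_
  rcases hu with hu | hu
  · have : x.1 = p := by linarith
    rw [this] at h1 ⊢
    linarith
  · have h6 : s = x.1 + ε - q := by linarith
    rw [h6] at hs
    nlinarith [mul_nonneg (sub_nonneg.2 h4) (sub_nonneg.2 h5)]

end IsChordPiece

lemma exists_glue {X : Type*} [TopologicalSpace X] {s t : Set X} {g h : X → ℝ} (hs : IsClosed s)
    (ht : IsClosed t) (hg : ContinuousOn g s) (hh : ContinuousOn h t)
    (hgh : ∀ x ∈ s, x ∈ t → g x = h x) :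
    ∃ k : X → ℝ, ContinuousOn k (s ∪ t) ∧ (∀ x ∈ s, k x = g x) ∧ ∀ x ∈ t, k x = h x := by
  classical
  have h1 : ∀ x ∈ s, s.piecewise g h x = g x := fun x hx => piecewise_eq_of_mem _ _ _ hx
  have h2 : ∀ x ∈ t, s.piecewise g h x = h x := fun x hx => by
    by_cases hxs : x ∈ s
    · rw [h1 x hxs, hgh x hxs hx]
    · exact piecewise_eq_of_notMem _ _ _ hxs
  exact ⟨s.piecewise g h, (hg.congr h1).union_of_isClosed (hh.congr h2) hs ht, h1, h2⟩

/-- The candidate on a chain of right tangent domains and right trolleybuses. -/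
lemma exists_right_half {f : ℝ → ℝ} {ε : ℝ} (hε : 0 < ε) (hf : Continuous f) (u₁ : EReal)
    (p q M : ℕ → ℝ) (m : ℕ → ℝ → ℝ) (hm : ∀ i, Continuous (m i)) (C : ℕ → Set (ℝ × ℝ))
    (B : ℝ × ℝ → ℝ) (n : ℕ)
    (hC : ∀ i ∈ Icc 1 n, IsChordPiece f ε (p i) (q i) (M i) (C i) B)
    (hqp : ∀ i ∈ Icc 1 n, q i ≤ p (i + 1))
    (hmp : ∀ i ∈ Icc 1 n, m i (p i) = deriv f (p i) - ε * M i)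
    (hmq : ∀ i ∈ Icc 1 n, m (i + 1) (q i) = deriv f (q i) - ε * M i) :
    ∃ (D : Set (ℝ × ℝ)) (G : ℝ × ℝ → ℝ), IsClosed D ∧ ContinuousOn G D ∧
      (∀ x ∈ D, x ∈ strip ε ∧ uR ε x ≤ p (n + 1)) ∧
      (∀ x ∈ D, uR ε x = p (n + 1) →
        G x = m (n + 1) (p (n + 1)) * (x.1 - p (n + 1)) + f (p (n + 1))) ∧
      (∀ i ∈ Icc 0 n, ∀ x ∈ tangR ε (if i = 0 then u₁ else (q i : EReal)) (p (i + 1)),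
        x ∈ D ∧ G x = m (i + 1) (uR ε x) * (x.1 - uR ε x) + f (uR ε x)) ∧
      (∀ i ∈ Icc 1 n, ∀ x ∈ trolleyR ε (p i) (q i),
        x ∈ D ∧ G x = tangentLin f (p i) (M i / 2) x) ∧
      ∀ i ∈ Icc 1 n, ∀ x ∈ C i, x ∈ D ∧ G x = B x := by
  have hcont : ∀ i, Continuous fun x => m i (uR ε x) * (x.1 - uR ε x) + f (uR ε x) := fun i =>
    (((hm i).comp (continuous_uR ε)).mul (continuous_fst.sub (continuous_uR ε))).add
      (hf.comp (continuous_uR ε))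
  induction n with
  | zero =>
    refine ⟨tangR ε u₁ (p 1), fun x => m 1 (uR ε x) * (x.1 - uR ε x) + f (uR ε x),
      isClosed_tangR _ _ _, (hcont 1).continuousOn,
      fun x hx => ⟨hx.1, EReal.coe_le_coe_iff.1 hx.2.2⟩, fun x _ hu => by simp only [hu, zero_add],
      fun i hi x hx => ?_, fun i hi => absurd hi.1 (by have := hi.2; omega),
      fun i hi => absurd hi.1 (by have := hi.2; omega)⟩
    have : i = 0 := Nat.le_zero.1 hi.2
    subst this
    exact ⟨hx, rfl⟩
  | succ n ih =>
    have hsub : ∀ i ∈ Icc 1 n, i ∈ Icc 1 (n + 1) := fun i hi => ⟨hi.1, hi.2.trans n.le_succ⟩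
    obtain ⟨D, G, hDc, hGc, hD, hGu, hGt, hGtr, hGC⟩ := ih (fun i hi => hC i (hsub i hi))
      (fun i hi => hqp i (hsub i hi)) (fun i hi => hmp i (hsub i hi)) (fun i hi => hmq i (hsub i hi))
    have hn : n + 1 ∈ Icc 1 (n + 1) := ⟨by omega, le_rfl⟩
    have hP := hC _ hn
    -- Three gluings: the trolleybus with the piece below it along the chord, their union with the
    -- next tangent domain along the tangent at q, and the result with the previous figures along
    -- the tangent at p.
    obtain ⟨G₁, hG₁c, hG₁l, hG₁B⟩ := exists_glue (isClosed_trolleyR ε (p (n + 1)) (q (n + 1)))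
      hP.closed (continuous_tangentLin f (p (n + 1)) (M (n + 1) / 2)).continuousOn hP.cont
      (fun x hx hxC => (hP.top x hxC (le_antisymm (hP.lens x hxC).2 hx.2)).symm)
    have hlq : ∀ x ∈ strip ε, uR ε x = q (n + 1) → tangentLin f (p (n + 1)) (M (n + 1) / 2) x =
        m (n + 1 + 1) (uR ε x) * (x.1 - uR ε x) + f (uR ε x) := by
      intro x hx hu
      rw [hP.tangentLin_eq, tangentLin_of_uR hε hx hu, hu, hmq _ hn]
      ring
    have hlp : ∀ x ∈ strip ε, uR ε x = p (n + 1) → tangentLin f (p (n + 1)) (M (n + 1) / 2) x =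
        m (n + 1) (p (n + 1)) * (x.1 - p (n + 1)) + f (p (n + 1)) := by
      intro x hx hu
      rw [tangentLin_of_uR hε hx hu, hmp _ hn]
      ring
    have hE₁ : ∀ x ∈ trolleyR ε (p (n + 1)) (q (n + 1)) ∪ C (n + 1),
        x ∈ strip ε ∧ p (n + 1) ≤ uR ε x ∧ uR ε x ≤ q (n + 1) ∧
        (uR ε x = p (n + 1) ∨ uR ε x = q (n + 1) →
          G₁ x = tangentLin f (p (n + 1)) (M (n + 1) / 2) x) := by
      rintro x (hx | hx)
      · exact ⟨hx.1.1, EReal.coe_le_coe_iff.1 hx.1.2.1, EReal.coe_le_coe_iff.1 hx.1.2.2,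
          fun _ => hG₁l x hx⟩
      · exact ⟨hP.mem_strip hx, (hP.uR_mem hε hx).1, (hP.uR_mem hε hx).2,
          fun hu => (hG₁B x hx).trans (hP.top_of_uR hε hx hu)⟩
    have hcl₁ := (isClosed_trolleyR ε (p (n + 1)) (q (n + 1))).union hP.closed
    have hclt := isClosed_tangR ε (q (n + 1)) (p (n + 1 + 1))
    obtain ⟨G₂, hG₂c, hG₂1, hG₂t⟩ := exists_glue hcl₁ hclt hG₁c (hcont (n + 1 + 1)).continuousOn
      (fun x hx hxt => by
        have h1 := hE₁ x hx
        have h2 : uR ε x = q (n + 1) := le_antisymm h1.2.2.1 (EReal.coe_le_coe_iff.1 hxt.2.1)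
        rw [h1.2.2.2 (Or.inr h2), hlq x h1.1 h2])
    have hE₂ : ∀ x ∈ trolleyR ε (p (n + 1)) (q (n + 1)) ∪ C (n + 1) ∪
        tangR ε (q (n + 1)) (p (n + 1 + 1)), x ∈ strip ε ∧ p (n + 1) ≤ uR ε x ∧
          uR ε x ≤ p (n + 1 + 1) ∧ (uR ε x = p (n + 1) →
          G₂ x = tangentLin f (p (n + 1)) (M (n + 1) / 2) x) := by
      rintro x (hx | hx)
      · have h1 := hE₁ x hx
        exact ⟨h1.1, h1.2.1, h1.2.2.1.trans (hqp _ hn),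
          fun hu => (hG₂1 x hx).trans (h1.2.2.2 (Or.inl hu))⟩
      · have h1 : q (n + 1) ≤ uR ε x := EReal.coe_le_coe_iff.1 hx.2.1
        have h2 := hP.lt
        exact ⟨hx.1, by linarith, EReal.coe_le_coe_iff.1 hx.2.2, fun hu => by linarith⟩
    obtain ⟨G₃, hG₃c, hG₃D, hG₃E⟩ := exists_glue hDc (hcl₁.union hclt) hGc hG₂c
      (fun x hx hxE => by
        have h1 := hE₂ x hxE
        have h2 : uR ε x = p (n + 1) := le_antisymm (hD x hx).2 h1.2.1
        rw [hGu x hx h2, h1.2.2.2 h2, hlp x h1.1 h2])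
    have hpp : p (n + 1) ≤ p (n + 1 + 1) := hP.lt.le.trans (hqp _ hn)
    have htang : ∀ x ∈ tangR ε (q (n + 1)) (p (n + 1 + 1)),
        G₃ x = m (n + 1 + 1) (uR ε x) * (x.1 - uR ε x) + f (uR ε x) := fun x hx =>
      (hG₃E x (Or.inr hx)).trans (hG₂t x hx)
    refine ⟨_, G₃, hDc.union (hcl₁.union hclt), hG₃c, ?_, ?_, ?_, ?_, ?_⟩
    · rintro x (hx | hx)
      · exact ⟨(hD x hx).1, (hD x hx).2.trans hpp⟩
      · exact ⟨(hE₂ x hx).1, (hE₂ x hx).2.2.1⟩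
    · intro x hx hu
      have hxs : x ∈ strip ε := by
        rcases hx with hx | hx
        · exact (hD x hx).1
        · exact (hE₂ x hx).1
      rw [htang x ⟨hxs, by rw [hu]; exact EReal.coe_le_coe_iff.2 (hqp _ hn), by rw [hu]⟩, hu]
    · intro i hi x hx
      rcases hi.2.eq_or_lt with he | hlt
      · subst he
        exact ⟨Or.inr (Or.inr hx), htang x hx⟩
      · have := hGt i ⟨hi.1, Nat.lt_succ_iff.1 hlt⟩ x hx
        exact ⟨Or.inl this.1, (hG₃D x this.1).trans this.2⟩
    · intro i hi x hx
      rcases hi.2.eq_or_lt with he | hlt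
      · subst he
        exact ⟨Or.inr (Or.inl (Or.inl hx)), (hG₃E x (Or.inl (Or.inl hx))).trans
          ((hG₂1 x (Or.inl hx)).trans (hG₁l x hx))⟩
      · have := hGtr i ⟨hi.1, Nat.lt_succ_iff.1 hlt⟩ x hx
        exact ⟨Or.inl this.1, (hG₃D x this.1).trans this.2⟩
    · intro i hi x hx
      rcases hi.2.eq_or_lt with he | hlt
      · subst he
        exact ⟨Or.inr (Or.inl (Or.inr hx)), (hG₃E x (Or.inl (Or.inr hx))).trans
          ((hG₂1 x (Or.inr hx)).trans (hG₁B x hx))⟩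
      · have := hGC i ⟨hi.1, Nat.lt_succ_iff.1 hlt⟩ x hx
        exact ⟨Or.inl this.1, (hG₃D x this.1).trans this.2⟩

/-! ### Chordal domains as pieces under a chord -/

lemma mem_chordal_iff {a b : ℝ → ℝ} {l₁ l₀ : ℝ} {x : ℝ × ℝ} :
    x ∈ chordal a b l₁ l₀ ↔ ∃ l ∈ Icc l₁ l₀, ∃ s ∈ Icc (0 : ℝ) 1,
      ((1 - s) * a l + s * b l, (1 - s) * a l ^ 2 + s * b l ^ 2) = x := by
  simp only [chordal, mem_iUnion, exists_prop, segment_eq_image, mem_image]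
  rfl

lemma isClosed_chordal {a b : ℝ → ℝ} {l₁ l₀ : ℝ} (ha : ContinuousOn a (Icc l₁ l₀))
    (hb : ContinuousOn b (Icc l₁ l₀)) : IsClosed (chordal a b l₁ l₀) := by
  have he : chordal a b l₁ l₀ = (fun p : ℝ × ℝ =>
      (((1 - p.2) * a p.1 + p.2 * b p.1, (1 - p.2) * a p.1 ^ 2 + p.2 * b p.1 ^ 2) : ℝ × ℝ)) ''
        (Icc l₁ l₀ ×ˢ Icc 0 1) := by
    ext x
    rw [mem_chordal_iff]
    constructor
    · rintro ⟨l, hl, s, hs, rfl⟩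
      exact ⟨(l, s), ⟨hl, hs⟩, rfl⟩
    · rintro ⟨⟨l, s⟩, ⟨hl, hs⟩, rfl⟩
      exact ⟨l, hl, s, hs, rfl⟩
  rw [he]
  refine ((isCompact_Icc.prod isCompact_Icc).image_of_continuousOn ?_).isClosed
  have ha' : ContinuousOn (fun p : ℝ × ℝ => a p.1) (Icc l₁ l₀ ×ˢ Icc 0 1) :=
    ha.comp continuousOn_fst fun p hp => hp.1
  have hb' : ContinuousOn (fun p : ℝ × ℝ => b p.1) (Icc l₁ l₀ ×ˢ Icc 0 1) :=
    hb.comp continuousOn_fst fun p hp => hp.1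
  have h2 : ContinuousOn (fun p : ℝ × ℝ => p.2) (Icc l₁ l₀ ×ˢ Icc 0 1) := continuousOn_snd
  have h1 : ContinuousOn (fun p : ℝ × ℝ => 1 - p.2) (Icc l₁ l₀ ×ˢ Icc 0 1) :=
    continuousOn_const.sub h2
  exact ((h1.mul ha').add (h2.mul hb')).prodMk ((h1.mul (ha'.pow 2)).add (h2.mul (hb'.pow 2)))

lemma chordal_subset {a b : ℝ → ℝ} {l₁ l₀ l : ℝ} (hl : l ≤ l₀) :
    chordal a b l₁ l ⊆ chordal a b l₁ l₀ := by
  intro x hx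
  rw [mem_chordal_iff] at hx ⊢
  obtain ⟨r, hr, h⟩ := hx
  exact ⟨r, ⟨hr.1, hr.2.trans hl⟩, h⟩

lemma IsStdChordal.mono {f a b : ℝ → ℝ} {lam L l : ℝ} {B G : ℝ × ℝ → ℝ}
    (h : IsStdChordal f a b lam L B) (hl : l ∈ Ioc lam L)
    (hG : ∀ x ∈ chordal a b lam l, G x = B x) : IsStdChordal f a b lam l G := by
  have h' := h.isChordFamily.mono hl
  refine ⟨h'.nonneg, h'.lt, h'.length, h'.continuous_a, h'.continuous_b, h'.diff_a, h'.diff_b,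
    h'.cup, h'.differentials, h'.differentials_strict, fun r hr s hs => ?_⟩
  rw [hG _ (mem_chordal_iff.2 ⟨r, hr, s, hs, rfl⟩)]
  exact h.linear r ⟨hr.1, hr.2.trans hl.2⟩ s hs

lemma IsStdChordal.isChordPiece {f a b : ℝ → ℝ} {lam l ε : ℝ} {B : ℝ × ℝ → ℝ}
    (h : IsStdChordal f a b lam l B) (hf : ContDiff ℝ 2 f) (hl : l ≤ 2 * ε)
    (hB : ContinuousOn B (chordal a b lam l)) :
    IsChordPiece f ε (a l) (b l) (chordMean f a b l) (chordal a b lam l) B := by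
  have hF := h.isChordFamily
  have hm : l ∈ Ioc lam l := ⟨hF.lt, le_rfl⟩
  have hlen := hF.length l (Ioc_subset_Icc_self hm)
  have hpos := hF.pos hm
  have hmean : deriv f (b l) - deriv f (a l) = chordMean f a b l * (b l - a l) := by
    rw [hF.chordMean_eq hf (Ioc_subset_Icc_self hm), hlen]
    field_simp
  have hcup : f (b l) - f (a l) = (b l - a l) * ((deriv f (a l) + deriv f (b l)) / 2) := by
    rw [hlen]; exact hF.cup_eq hf hm
  have hends : ∀ r ∈ Icc lam l, a l ≤ a r ∧ b r ≤ b l ∧ a r ≤ b r := fun r hr =>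
    ⟨hF.strictAntiOn.antitoneOn hr (Ioc_subset_Icc_self hm) hr.2,
      hF.strictMonoOn.monotoneOn hr (Ioc_subset_Icc_self hm) hr.2, by
        have := hF.length r hr
        have := hF.nonneg.trans hr.1
        linarith⟩
  refine ⟨hF.lt_of_mem hm, by rw [hlen]; exact hl, hmean, hcup,
    isClosed_chordal hF.continuous_a hF.continuous_b, fun x hx => ?_, hB, fun x hx htop => ?_⟩
  · obtain ⟨r, hr, s, hs, rfl⟩ := mem_chordal_iff.1 hx
    obtain ⟨h1, h2, h3⟩ := hends r hr
    constructor
    · nlinarith [mul_nonneg (mul_nonneg hs.1 (sub_nonneg.2 hs.2)) (sq_nonneg (b r - a r))]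
    · have e1 := mul_nonneg (sub_nonneg.2 hs.2) (mul_nonneg (sub_nonneg.2 h1)
        (sub_nonneg.2 (h3.trans h2)))
      have e2 := mul_nonneg hs.1 (mul_nonneg (sub_nonneg.2 (h1.trans h3)) (sub_nonneg.2 h2))
      simp only
      linarith
  · obtain ⟨r, hr, s, hs, rfl⟩ := mem_chordal_iff.1 hx
    -- Both ends of a shorter chord lie strictly inside the parameter interval of the longest one,
    -- hence strictly below its line, so only the longest chord reaches the top.
    have hrl : r = l := by
      by_contra hne
      have hlt : r < l := lt_of_le_of_ne hr.2 hne
      have h1 := hF.strictAntiOn hr (Ioc_subset_Icc_self hm) hlt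
      have h2 := hF.strictMonoOn hr (Ioc_subset_Icc_self hm) hlt
      have h3 := (hends r hr).2.2
      have e1 := mul_nonneg (sub_nonneg.2 hs.2) (mul_nonneg (sub_nonneg.2 h1.le)
        (sub_nonneg.2 (h3.trans h2.le)))
      have e2 := mul_nonneg hs.1 (mul_nonneg (sub_nonneg.2 (h1.le.trans h3)) (sub_nonneg.2 h2.le))
      simp only at htop
      have e3 : 0 < (1 - s) * ((a r - a l) * (b l - a r)) + s * ((b r - a l) * (b l - b r)) := by
        have p1 : 0 < (a r - a l) * (b l - a r) := mul_pos (by linarith) (by linarith)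
        have p2 : 0 < (b r - a l) * (b l - b r) := mul_pos (by linarith) (by linarith)
        rcases hs.1.eq_or_lt with h0 | h0
        · rw [← h0]; linarith
        · have := mul_pos h0 p2
          linarith
      linarith
    subst hrl
    rw [h.linear r hr s hs, tangentLin]
    simp only
    linear_combination s * hcup + s * (b r - a r) / 2 * hmean

/-! ### Reflection of the strip -/

lemma uR_reflect (ε : ℝ) (x : ℝ × ℝ) : uR ε (-x.1, x.2) = -uL ε x := by
  simp only [uR, uL, neg_sq]; ring

lemma strip_reflect {ε : ℝ} {x : ℝ × ℝ} : ((-x.1, x.2) : ℝ × ℝ) ∈ strip ε ↔ x ∈ strip ε := by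
  simp only [strip, mem_ofPred_eq, neg_sq]

lemma tangR_reflect {ε : ℝ} {c d : EReal} {x : ℝ × ℝ} :
    ((-x.1, x.2) : ℝ × ℝ) ∈ tangR ε (-d) (-c) ↔ x ∈ tangL ε c d := by
  simp only [tangR, tangL, mem_ofPred_eq, strip_reflect, uR_reflect, EReal.coe_neg,
    EReal.neg_le_neg_iff]
  tauto

lemma trolleyR_reflect {ε p q : ℝ} {x : ℝ × ℝ} :
    ((-x.1, x.2) : ℝ × ℝ) ∈ trolleyR ε (-q) (-p) ↔ x ∈ trolleyL ε p q := by
  simp only [trolleyR, trolleyL, mem_inter_iff, EReal.coe_neg, tangR_reflect, aboveChord,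
    mem_ofPred_eq]
  have : (-q + -p) * -x.1 - -q * -p = (p + q) * x.1 - p * q := by ring
  rw [this]

lemma continuous_reflect : Continuous fun x : ℝ × ℝ => ((-x.1, x.2) : ℝ × ℝ) := by fun_prop

lemma tangentLin_reflect (f : ℝ → ℝ) (t β : ℝ) (x : ℝ × ℝ) :
    tangentLin (fun t => f (-t)) (-t) β (-x.1, x.2) = tangentLin f t β x := by
  simp only [tangentLin, deriv_reflect, neg_neg]; ring

lemma IsChordPiece.reflect {f : ℝ → ℝ} {ε p q M : ℝ} {C : Set (ℝ × ℝ)} {B : ℝ × ℝ → ℝ}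
    (h : IsChordPiece f ε p q M C B) :
    IsChordPiece (fun t => f (-t)) ε (-q) (-p) M ((fun x => (-x.1, x.2)) ⁻¹' C)
      (fun x => B (-x.1, x.2)) := by
  refine ⟨neg_lt_neg h.lt, by linarith [h.length_le], ?_, ?_, h.closed.preimage continuous_reflect,
    fun x hx => ?_, h.cont.comp continuous_reflect.continuousOn fun x hx => hx, fun x hx hx2 => ?_⟩
  · simp only [deriv_reflect, neg_neg]
    linear_combination h.mean
  · simp only [deriv_reflect, neg_neg]
    linear_combination (-1) * h.cup
  · have := h.lens _ hx
    simp only [neg_sq] at this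
    exact ⟨this.1, by linarith [this.2]⟩
  · have h1 := h.top _ hx (by simp only; linarith)
    rw [h1, h.tangentLin_eq, ← tangentLin_reflect f q, neg_neg]

/-- The candidate on a chain of left trolleybuses and left tangent domains. -/
lemma exists_left_half {f : ℝ → ℝ} {ε : ℝ} (hε : 0 < ε) (hf : Continuous f) (u₂ : EReal)
    (p q M : ℕ → ℝ) (m : ℕ → ℝ → ℝ) (hm : ∀ i, Continuous (m i)) (C : ℕ → Set (ℝ × ℝ))
    (B : ℝ × ℝ → ℝ) {j k : ℕ} (hj : 1 ≤ j) (hjk : j ≤ k)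
    (hC : ∀ i ∈ Ico j k, IsChordPiece f ε (p i) (q i) (M i) (C i) B)
    (hqp : ∀ i ∈ Ico j k, q (i - 1) ≤ p i)
    (hmp : ∀ i ∈ Ico j k, m i (p i) = deriv f (p i) + ε * M i)
    (hmq : ∀ i ∈ Ico j k, m (i + 1) (q i) = deriv f (q i) + ε * M i) :
    ∃ (D : Set (ℝ × ℝ)) (G : ℝ × ℝ → ℝ), IsClosed D ∧ ContinuousOn G D ∧
      (∀ x ∈ D, x ∈ strip ε ∧ q (j - 1) ≤ uL ε x) ∧
      (∀ x ∈ D, uL ε x = q (j - 1) →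
        G x = m j (q (j - 1)) * (x.1 - q (j - 1)) + f (q (j - 1))) ∧
      (∀ i ∈ Icc j k, ∀ x ∈ tangL ε (q (i - 1)) (if i = k then u₂ else (p i : EReal)),
        x ∈ D ∧ G x = m i (uL ε x) * (x.1 - uL ε x) + f (uL ε x)) ∧
      (∀ i ∈ Ico j k, ∀ x ∈ trolleyL ε (p i) (q i),
        x ∈ D ∧ G x = tangentLin f (p i) (M i / 2) x) ∧
      ∀ i ∈ Ico j k, ∀ x ∈ C i, x ∈ D ∧ G x = B x := by
  -- The left half is the reflection of a right half in which the pieces are counted from the right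
  -- end: piece i becomes piece k - i.
  have hidx : ∀ i ∈ Icc 1 (k - j), k - i ∈ Ico j k := fun i hi =>
    ⟨by have := hi.2; omega, by have := hi.1; have := hi.2; omega⟩
  obtain ⟨D, G, hDc, hGc, hD, hGu, hGt, hGtr, hGC⟩ := exists_right_half (f := fun t => f (-t)) hε
    (hf.comp continuous_neg) (-u₂) (fun i => -q (k - i)) (fun i => -p (k - i)) (fun i => M (k - i))
    (fun i u => -m (k + 1 - i) (-u)) (fun i => ((hm _).comp continuous_neg).neg)
    (fun i => (fun x => (-x.1, x.2)) ⁻¹' C (k - i)) (fun x => B (-x.1, x.2)) (k - j)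
    (fun i hi => (hC _ (hidx i hi)).reflect)
    (fun i hi => by
      have := hqp _ (hidx i hi)
      have e : k - i - 1 = k - (i + 1) := by omega
      rw [e] at this
      exact neg_le_neg this)
    (fun i hi => by
      have := hmq _ (hidx i hi)
      have e : k - i + 1 = k + 1 - i := by have := (hidx i hi).1; have := hi.2; omega
      rw [e] at this
      simp only [neg_neg, deriv_reflect, this]
      ring)
    (fun i hi => by
      have := hmp _ (hidx i hi)
      have e : k + 1 - (i + 1) = k - i := by omega
      simp only [e, neg_neg, deriv_reflect, this]
      ring)
  have e1 : k - (k - j + 1) = j - 1 := by omega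
  have e2 : k + 1 - (k - j + 1) = j := by omega
  simp only [e1, e2, neg_neg] at hD hGu
  refine ⟨(fun x => (-x.1, x.2)) ⁻¹' D, fun x => G (-x.1, x.2), hDc.preimage continuous_reflect,
    hGc.comp continuous_reflect.continuousOn fun x hx => hx, fun x hx => ?_, fun x hx hu => ?_,
    fun i hi x hx => ?_, fun i hi x hx => ?_, fun i hi x hx => ?_⟩
  · have := hD _ hx
    rw [strip_reflect, uR_reflect] at this
    exact ⟨this.1, by linarith [this.2]⟩
  · refine (hGu _ hx (by rw [uR_reflect, hu])).trans ?_
    ring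
  · have h1 : k - i ∈ Icc 0 (k - j) := ⟨Nat.zero_le _, by have := hi.1; omega⟩
    have h2 : k - (k - i + 1) = i - 1 := by have := hi.1; have := hi.2; omega
    have h3 : k + 1 - (k - i + 1) = i := by have := hi.1; have := hi.2; omega
    have h4 : (if k - i = 0 then -u₂ else ((-p (k - (k - i)) : ℝ) : EReal)) =
        -(if i = k then u₂ else (p i : EReal)) := by
      have h5 : k - (k - i) = i := by have := hi.2; omega
      have h6 : k - i = 0 ↔ i = k := by have := hi.2; omega
      rw [h5]
      split_ifs with h7 h8 h8
      · rfl
      · exact absurd (h6.1 h7) h8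
      · exact absurd (h6.2 h8) h7
      · rw [EReal.coe_neg]
    have h5 := hGt _ h1 (-x.1, x.2)
    rw [h2, h3, h4, EReal.coe_neg, tangR_reflect, uR_reflect] at h5
    simp only [neg_neg] at h5
    refine ⟨(h5 hx).1, (h5 hx).2.trans ?_⟩
    ring
  · have h1 : k - i ∈ Icc 1 (k - j) := ⟨by have := hi.2; omega, by have := hi.1; omega⟩
    have h2 : k - (k - i) = i := by have := hi.2; omega
    have h3 := hGtr _ h1 (-x.1, x.2)
    rw [h2, trolleyR_reflect] at h3
    refine ⟨(h3 hx).1, (h3 hx).2.trans ?_⟩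
    rw [tangentLin_reflect, (hC i hi).tangentLin_eq]
  · have h1 : k - i ∈ Icc 1 (k - j) := ⟨by have := hi.2; omega, by have := hi.1; omega⟩
    have h2 : k - (k - i) = i := by have := hi.2; omega
    have h3 := hGC _ h1 (-x.1, x.2)
    simp only [h2, mem_preimage, neg_neg] at h3
    exact h3 hx

/-! ### Slopes of left tangent domains -/

/-- The slope function on a left tangent domain whose force is `frcL f ε K`. -/
def slopeL (f : ℝ → ℝ) (ε K u : ℝ) : ℝ := -slope (fun t => f (-t)) ε K (-u)

section Slopes

variable {f : ℝ → ℝ} {ε : ℝ}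

lemma slopeL_eq (hε : 0 < ε) (K u : ℝ) :
    slopeL f ε K u = deriv f u + ε * (deriv (deriv f) u + frcL f ε K u) := by
  rw [slopeL, slope_eq hε, frcL, deriv2_reflect_apply, neg_neg]
  simp only [deriv_reflect, neg_neg]
  ring

lemma continuous_slopeL (hf : ContDiff ℝ 2 f) (hε : 0 < ε) (K : ℝ) : Continuous (slopeL f ε K) :=
  ((continuous_slope (contDiff_reflect hf) hε K).comp continuous_neg).neg

lemma deriv_slopeL (K : ℝ) :
    deriv (slopeL f ε K) = fun u => deriv (slope (fun t => f (-t)) ε K) (-u) := by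
  funext u
  unfold slopeL
  rw [deriv.fun_neg, deriv_comp_neg, neg_neg]

lemma deriv_deriv_slopeL (hf : ContDiff ℝ 2 f) (hε : 0 < ε) (K u : ℝ) :
    deriv (deriv (slopeL f ε K)) u = frcL f ε K u / ε := by
  rw [deriv_slopeL, deriv_comp_neg, deriv_deriv_slope (contDiff_reflect hf) hε, frcL, neg_div]

lemma isStdTangR_slope (hf : ContDiff ℝ 2 f) (hε : 0 < ε) {c d : EReal} {Z : Set ℝ} {K : ℝ}
    {B : ℝ × ℝ → ℝ}
    (hB : ∀ x ∈ tangR ε c d, B x = slope f ε K (uR ε x) * (x.1 - uR ε x) + f (uR ε x))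
    (hs : ∀ u : ℝ, c < u → (u : EReal) < d → frc f ε K u ≤ 0 ∧ (u ∉ Z → frc f ε K u < 0))
    (hinf : c = ⊥ → ∀ u : ℝ, slope f ε K u =
      ε⁻¹ * Real.exp (-u / ε) * ∫ t in Iic u, deriv f t * Real.exp (t / ε)) :
    IsStdTangR f ε c d Z (slope f ε K) B where
  formula := hB
  continuous := (continuous_slope hf hε K).continuousOn
  ode u _ _ := ⟨(hasDerivAt_slope hf hε K u).differentiableAt, slope_ode hf hε K u⟩
  concave u h1 h2 := by
    rw [deriv_deriv_slope hf hε]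
    exact ⟨div_nonpos_of_nonpos_of_nonneg (hs u h1 h2).1 hε.le,
      fun hu => div_neg_of_neg_of_pos ((hs u h1 h2).2 hu) hε⟩
  atInfinity h u _ := hinf h u

lemma isStdTangL_slopeL (hf : ContDiff ℝ 2 f) (hε : 0 < ε) {c d : EReal} {Z : Set ℝ} {K : ℝ}
    {B : ℝ × ℝ → ℝ}
    (hB : ∀ x ∈ tangL ε c d, B x = slopeL f ε K (uL ε x) * (x.1 - uL ε x) + f (uL ε x))
    (hs : ∀ u : ℝ, c < u → (u : EReal) < d → 0 ≤ frcL f ε K u ∧ (u ∉ Z → 0 < frcL f ε K u))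
    (hinf : d = ⊤ → ∀ u : ℝ, slopeL f ε K u =
      ε⁻¹ * Real.exp (u / ε) * ∫ t in Ioi u, deriv f t * Real.exp (-t / ε)) :
    IsStdTangL f ε c d Z (slopeL f ε K) B where
  formula := hB
  continuous := (continuous_slopeL hf hε K).continuousOn
  ode u _ _ := by
    have h1 := ((hasDerivAt_slope (contDiff_reflect hf) hε K (-u)).comp u
      (hasDerivAt_neg u)).fun_neg
    refine ⟨h1.differentiableAt, ?_⟩
    have h2 := slope_ode (contDiff_reflect hf) hε K (-u)
    rw [deriv_slopeL, slopeL]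
    simp only [deriv_reflect, neg_neg] at h2 ⊢
    linarith
  concave u h1 h2 := by
    rw [deriv_deriv_slopeL hf hε]
    exact ⟨div_nonneg (hs u h1 h2).1 hε.le, fun hu => div_pos ((hs u h1 h2).2 hu) hε⟩
  atInfinity h u _ := hinf h u

end Slopes

/-! ### The disintegrated candidate -/

lemma isStdLinear_tangentLin {f : ℝ → ℝ} {w β : ℝ} {D : Set (ℝ × ℝ)} {G : ℝ × ℝ → ℝ}
    (hG : ∀ x ∈ D, G x = tangentLin f w β x) : IsStdLinear f {w} D G := by
  refine ⟨f w - w * deriv f w + β * w ^ 2, deriv f w - 2 * β * w, β,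
    fun x hx => ?_, fun t ht => ?_⟩
  · rw [hG x hx, tangentLin]; ring
  · rw [mem_singleton_iff.1 ht]
    exact ⟨rfl, rfl⟩

lemma eq_of_uR_le_uL {ε w : ℝ} (hε : 0 < ε) {x : ℝ × ℝ} (hx : x ∈ strip ε) (h1 : uR ε x ≤ w)
    (h2 : w ≤ uL ε x) : uR ε x = w ∧ x.1 = w := by
  obtain ⟨s, hs0, hsε, hs, hR, hL⟩ := strip_spec hε hx
  constructor <;> linarith

/-- Forces equal to D_L and D_R at the ends of a chord mean slopes f' - ε⟨f''⟩ there (f' + ε⟨f''⟩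
for left forces), which is the matching condition with the affine function on the trolleybus. The
angle joins the right and left halves thanks to the balance equation at w. -/
theorem IsForceConfig.exists_candidate {f : ℝ → ℝ} {ε : ℝ} {k j : ℕ} {w : ℝ} {u₁ u₂ : EReal}
    {a b : ℕ → ℝ → ℝ} {l KR KL : ℕ → ℝ} {Z : Set ℝ}
    (h : IsForceConfig f ε k j w u₁ u₂ a b l KR KL Z) (hf : ContDiff ℝ 2 f) (hε : 0 < ε)
    (hj : j ∈ Icc 1 k) {lam : ℕ → ℝ} {B : ℝ × ℝ → ℝ}
    (hch : ∀ i ∈ Ico 1 k, IsStdChordal f (a i) (b i) (lam i) (l i) B)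
    (hcont : ∀ i ∈ Ico 1 k, ContinuousOn B (chordal (a i) (b i) (lam i) (l i)))
    (hlen : ∀ i ∈ Ico 1 k, l i ≤ 2 * ε)
    (hord : ∀ i ∈ Ico 1 k, i + 1 < k → b i (l i) ≤ a (i + 1) (l (i + 1)))
    {gR gL : ℝ → ℝ} (hgR : ∀ v : ℝ, u₁ < v → gR v = frc f ε (KR 1) v)
    (hgL : ∀ v : ℝ, (v : EReal) < u₂ → gL v = frcL f ε (KL k) v)
    (hinfR : u₁ = ⊥ → ∀ u : ℝ, slope f ε (KR 1) u =
      ε⁻¹ * Real.exp (-u / ε) * ∫ t in Iic u, deriv f t * Real.exp (t / ε))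
    (hinfL : u₂ = ⊤ → ∀ u : ℝ, slopeL f ε (KL k) u =
      ε⁻¹ * Real.exp (u / ε) * ∫ t in Ioi u, deriv f t * Real.exp (-t / ε)) :
    ∃ G, IsDisintegratedCandidate f ε k j w u₁ u₂ a b lam l Z gR gL G := by
  obtain ⟨hj1, hjk⟩ := hj
  have hpiece : ∀ i ∈ Ico 1 k, IsChordPiece f ε (a i (l i)) (b i (l i))
      (chordMean f (a i) (b i) (l i)) (chordal (a i) (b i) (lam i) (l i)) B := fun i hi =>
    (hch i hi).isChordPiece hf (hlen i hi) (hcont i hi)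
  have hcf : Continuous f := hf.continuous
  obtain ⟨D₁, G₁, hD₁c, hG₁c, hD₁, hG₁u, hG₁t, hG₁tr, hG₁C⟩ := exists_right_half hε hcf u₁
    -- Putting w in place of the left end of the j-th chord makes the last right tangent domain stop
    -- at the angle.
    (fun i => if i < j then a i (l i) else w) (fun i => b i (l i))
    (fun i => chordMean f (a i) (b i) (l i)) (fun i => slope f ε (KR i))
    (fun i => continuous_slope hf hε _) (fun i => chordal (a i) (b i) (lam i) (l i)) B (j - 1)
    (fun i hi => by
      have h1 : i < j := by have := hi.2; omega
      simp only [if_pos h1]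
      exact hpiece i ⟨hi.1, h1.trans_le hjk⟩)
    (fun i hi => by
      have h0 := hi.1
      rcases lt_or_ge (i + 1) j with h1 | h1
      · simp only [if_pos h1]
        exact hord i ⟨h0, by omega⟩ (by omega)
      · have h2 : i = j - 1 := by have := hi.2; omega
        have h3 := h.left_le
        rw [← h2, bExt_of_pos _ _ _ (by have := hi.1; omega), EReal.coe_le_coe_iff] at h3
        simpa only [if_neg (not_lt.2 h1)] using h3)
    (fun i hi => by
      have h1 : i < j := by have := hi.1; have := hi.2; omega
      simp only [if_pos h1]
      rw [slope_eq hε, h.right_a i ⟨hi.1, h1⟩, DL, chordMean]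
      ring)
    (fun i hi => by
      have h1 : i < j := by have := hi.1; have := hi.2; omega
      rw [slope_eq hε, h.right_b i ⟨hi.1, h1⟩, DR, chordMean]
      ring)
  have ej : j - 1 + 1 = j := by omega
  simp only [ej, lt_irrefl, if_false] at hD₁ hG₁u
  obtain ⟨D₂, G₂, hD₂c, hG₂c, hD₂, hG₂u, hG₂t, hG₂tr, hG₂C⟩ := exists_left_half hε hcf u₂
    (fun i => a i (l i)) (fun i => if i < j then w else b i (l i))
    (fun i => chordMean f (a i) (b i) (l i)) (fun i => slopeL f ε (KL i))
    (fun i => continuous_slopeL hf hε _) (fun i => chordal (a i) (b i) (lam i) (l i)) B hj1 hjk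
    (fun i hi => by
      simp only [if_neg (not_lt.2 hi.1)]
      exact hpiece i ⟨hj1.trans hi.1, hi.2⟩)
    (fun i hi => by
      rcases hi.1.eq_or_lt with h1 | h1
      · have h2 := h.le_right
        rw [h1, aExt_of_lt _ _ _ hi.2, EReal.coe_le_coe_iff] at h2
        have h3 : i - 1 < j := by omega
        simpa only [if_pos h3] using h2
      · have h3 : ¬ i - 1 < j := by omega
        have h4 : i - 1 + 1 = i := by omega
        simp only [if_neg h3]
        have h5 := hord (i - 1) ⟨by omega, by have := hi.2; omega⟩ (by have := hi.2; omega)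
        rwa [h4] at h5)
    (fun i hi => by
      rw [slopeL_eq hε, h.left_a i hi, DL, chordMean]
      ring)
    (fun i hi => by
      simp only [if_neg (not_lt.2 hi.1)]
      rw [slopeL_eq hε, h.left_b i hi, DR, chordMean]
      ring)
  have ej' : j - 1 < j := by omega
  simp only [if_pos ej'] at hD₂ hG₂u
  -- Matching with the right tangent domain forces this coefficient; the left one asks for f'' plus
  -- the left force, halved, which is the same number because the balance vanishes.
  set β := (deriv (deriv f) w - frc f ε (KR j) w) / 2 with hβ
  have hangR : ∀ x ∈ strip ε, uR ε x = w →
      tangentLin f w β x = slope f ε (KR j) w * (x.1 - w) + f w := by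
    intro x hx hu
    rw [tangentLin_of_uR hε hx hu, slope_eq hε, hβ]
    ring
  have hangL : ∀ x ∈ strip ε, uL ε x = w →
      tangentLin f w β x = slopeL f ε (KL j) w * (x.1 - w) + f w := by
    intro x hx hu
    have hb := h.balanced
    rw [balance] at hb
    rw [tangentLin_of_uL hε hx hu, slopeL_eq hε, hβ, eq_neg_of_add_eq_zero_left hb]
    ring
  obtain ⟨G₃, hG₃c, hG₃1, hG₃a⟩ := exists_glue hD₁c (isClosed_angle ε w) hG₁c
    (continuous_tangentLin f w β).continuousOn (fun x hx hxa => by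
      have hu := le_antisymm (hD₁ x hx).2 (uR_of_mem_angle hε hxa).1
      rw [hG₁u x hx hu, hangR x (hD₁ x hx).1 hu])
  obtain ⟨G, hGc, hG3, hG2⟩ := exists_glue (hD₁c.union (isClosed_angle ε w)) hD₂c hG₃c hG₂c
    (fun x hx hx2 => by
      rcases hx with hx | hx
      -- The two halves have at most the point (w, w²) in common, where both values are f(w).
      · have hu := eq_of_uR_le_uL hε (hD₁ x hx).1 (hD₁ x hx).2 (hD₂ x hx2).2
        have hu2 : uL ε x = w := by
          obtain ⟨s, hs0, hsε, hs, hR, hL⟩ := strip_spec hε (hD₁ x hx).1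
          have := (hD₂ x hx2).2
          have := hu.1
          have := hu.2
          linarith
        rw [hG₃1 x hx, hG₁u x hx hu.1, hG₂u x hx2 hu2, hu.2, sub_self, mul_zero, mul_zero]
      · have hu := le_antisymm (uR_of_mem_angle hε hx).2 (hD₂ x hx2).2
        rw [hG₃a x hx, hG₂u x hx2 hu, hangL x (hD₂ x hx2).1 hu])
  have hG1 : ∀ x ∈ D₁, G x = G₁ x := fun x hx => (hG3 x (Or.inl hx)).trans (hG₃1 x hx)
  have hGa : ∀ x ∈ angle ε w, G x = tangentLin f w β x := fun x hx =>
    (hG3 x (Or.inr hx)).trans (hG₃a x hx)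
  have hTR : ∀ i ∈ Ico 0 (j - 1), ∀ x ∈ tangR ε (bExt u₁ b l i) (aExt k u₂ a l (i + 1)),
      x ∈ D₁ ∧ G x = slope f ε (KR (i + 1)) (uR ε x) * (x.1 - uR ε x) + f (uR ε x) := by
    intro i hi x hx
    have h1 : i + 1 < j := by have := hi.2; omega
    have h2 := hG₁t i ⟨hi.1, hi.2.le⟩ x
    rw [aExt_of_lt _ _ _ (h1.trans_le hjk)] at hx
    simp only [if_pos h1] at h2
    have h3 := h2 hx
    exact ⟨h3.1, (hG1 x h3.1).trans h3.2⟩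
  have hTRw : ∀ x ∈ tangR ε (bExt u₁ b l (j - 1)) w,
      x ∈ D₁ ∧ G x = slope f ε (KR j) (uR ε x) * (x.1 - uR ε x) + f (uR ε x) := by
    intro x hx
    have h2 := hG₁t (j - 1) ⟨Nat.zero_le _, le_rfl⟩ x
    simp only [ej, lt_irrefl, if_false] at h2
    have h3 := h2 hx
    exact ⟨h3.1, (hG1 x h3.1).trans h3.2⟩
  have hTLw : ∀ x ∈ tangL ε w (aExt k u₂ a l j),
      x ∈ D₂ ∧ G x = slopeL f ε (KL j) (uL ε x) * (x.1 - uL ε x) + f (uL ε x) := by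
    intro x hx
    have h2 := hG₂t j ⟨le_rfl, hjk⟩ x
    simp only [if_pos ej'] at h2
    have h3 := h2 hx
    exact ⟨h3.1, (hG2 x h3.1).trans h3.2⟩
  have hTL : ∀ i ∈ Ico j k, ∀ x ∈ tangL ε (bExt u₁ b l i) (aExt k u₂ a l (i + 1)),
      x ∈ D₂ ∧ G x = slopeL f ε (KL (i + 1)) (uL ε x) * (x.1 - uL ε x) + f (uL ε x) := by
    intro i hi x hx
    have h2 := hG₂t (i + 1) ⟨hi.1.trans i.le_succ, hi.2⟩ x
    rw [bExt_of_pos _ _ _ (hj1.trans hi.1)] at hx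
    simp only [Nat.add_sub_cancel, if_neg (not_lt.2 hi.1)] at h2
    have h3 := h2 hx
    exact ⟨h3.1, (hG2 x h3.1).trans h3.2⟩
  have hVR : ∀ i ∈ Ico 1 j, ∀ x ∈ trolleyR ε (a i (l i)) (b i (l i)), x ∈ D₁ ∧
      G x = tangentLin f (a i (l i)) (chordMean f (a i) (b i) (l i) / 2) x := by
    intro i hi x hx
    have h2 := hG₁tr i ⟨hi.1, by have := hi.2; omega⟩ x
    simp only [if_pos hi.2] at h2
    have h3 := h2 hx
    exact ⟨h3.1, (hG1 x h3.1).trans h3.2⟩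
  have hVL : ∀ i ∈ Ico j k, ∀ x ∈ trolleyL ε (a i (l i)) (b i (l i)), x ∈ D₂ ∧
      G x = tangentLin f (a i (l i)) (chordMean f (a i) (b i) (l i) / 2) x := by
    intro i hi x hx
    have h2 := hG₂tr i hi x
    simp only [if_neg (not_lt.2 hi.1)] at h2
    have h3 := h2 hx
    exact ⟨h3.1, (hG2 x h3.1).trans h3.2⟩
  have hCh : ∀ i ∈ Ico 1 k, ∀ x ∈ chordal (a i) (b i) (lam i) (l i),
      x ∈ D₁ ∪ angle ε w ∪ D₂ ∧ G x = B x := by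
    intro i hi x hx
    rcases lt_or_ge i j with hij | hij
    · have h3 := hG₁C i ⟨hi.1, by omega⟩ x hx
      exact ⟨Or.inl (Or.inl h3.1), (hG1 x h3.1).trans h3.2⟩
    · have h3 := hG₂C i ⟨hij, hi.2⟩ x hx
      exact ⟨Or.inr h3.1, (hG2 x h3.1).trans h3.2⟩
  have hforceR : ∀ c d : EReal, c = u₁ → HasForce ε c d (slope f ε (KR 1)) gR := by
    intro c d hc v hv _
    rw [deriv_deriv_slope hf hε, hgR v (hc ▸ hv)]
    field_simp
  have hforceL : ∀ c d : EReal, d = u₂ → HasForce ε c d (slopeL f ε (KL k)) gL := by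
    intro c d hd v _ hv
    rw [deriv_deriv_slopeL hf hε, hgL v (hd ▸ hv)]
    field_simp
  have hbot : ∀ i, bExt u₁ b l i = ⊥ → i = 0 ∧ u₁ = ⊥ := by
    intro i hi
    rcases Nat.eq_zero_or_pos i with h0 | h0
    · subst h0
      exact ⟨rfl, by rwa [bExt_zero] at hi⟩
    · rw [bExt_of_pos _ _ _ h0] at hi
      exact absurd hi (EReal.coe_ne_bot _)
  have htop : ∀ i, i ≤ k → aExt k u₂ a l i = ⊤ → i = k ∧ u₂ = ⊤ := by
    intro i hik hi
    rcases hik.eq_or_lt with h0 | h0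
    · subst h0
      exact ⟨rfl, by rwa [aExt_self] at hi⟩
    · rw [aExt_of_lt _ _ _ h0] at hi
      exact absurd hi (EReal.coe_ne_top _)
  refine ⟨G, ?_, ?_, ?_, ?_, ?_, ?_, ?_, ?_, ?_⟩
  · refine hGc.mono ?_
    rintro x (((((((hx | hx) | hx) | hx) | hx) | hx) | hx) | hx)
    · obtain ⟨i, hi, hx⟩ := mem_iUnion₂.1 hx
      exact Or.inl (Or.inl (hTR i hi x hx).1)
    · obtain ⟨i, hi, hx⟩ := mem_iUnion₂.1 hx
      exact Or.inl (Or.inl (hVR i hi x hx).1)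
    · exact Or.inl (Or.inl (hTRw x hx).1)
    · exact Or.inl (Or.inr hx)
    · exact Or.inr (hTLw x hx).1
    · obtain ⟨i, hi, hx⟩ := mem_iUnion₂.1 hx
      exact Or.inr (hVL i hi x hx).1
    · obtain ⟨i, hi, hx⟩ := mem_iUnion₂.1 hx
      exact Or.inr (hTL i hi x hx).1
    · obtain ⟨i, hi, hx⟩ := mem_iUnion₂.1 hx
      exact (hCh i hi x hx).1
  · intro i hi
    have h1 : i + 1 < j := by have := hi.2; omega
    refine ⟨slope f ε (KR (i + 1)), isStdTangR_slope hf hε (fun x hx => (hTR i hi x hx).2)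
      (fun v hv hv' => ?_) (fun hb => ?_), fun h0 => ?_⟩
    · rw [aExt_of_lt _ _ _ (h1.trans_le hjk), EReal.coe_lt_coe_iff] at hv'
      exact h.sign_right (i + 1) ⟨by omega, h1⟩ v hv hv'
    · rw [(hbot i hb).1]
      exact hinfR (hbot i hb).2
    · subst h0
      exact hforceR _ _ (bExt_zero ..)
  · intro i hi
    exact (hpiece i ⟨hi.1, hi.2.trans_le hjk⟩).isStdLinear fun x hx => (hVR i hi x hx).2
  · refine ⟨slope f ε (KR j), isStdTangR_slope hf hε (fun x hx => (hTRw x hx).2)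
      (fun v hv hv' => h.sign_right_last v hv (EReal.coe_lt_coe_iff.1 hv')) (fun hb => ?_),
      fun h0 => ?_⟩
    · have := (hbot _ hb).1
      have : j = 1 := by omega
      subst this
      exact hinfR (hbot _ hb).2
    · subst h0
      exact hforceR _ _ (bExt_zero ..)
  · exact isStdLinear_tangentLin hGa
  · refine ⟨slopeL f ε (KL j), isStdTangL_slopeL hf hε (fun x hx => (hTLw x hx).2)
      (fun v hv hv' => h.sign_left_first v (EReal.coe_lt_coe_iff.1 hv) hv') (fun hb => ?_),
      fun h0 => ?_⟩
    · rw [(htop _ hjk hb).1]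
      exact hinfL (htop _ hjk hb).2
    · subst h0
      exact hforceL _ _ (aExt_self ..)
  · intro i hi
    exact (hpiece i ⟨hj1.trans hi.1, hi.2⟩).isStdLinear fun x hx => (hVL i hi x hx).2
  · intro i hi
    refine ⟨slopeL f ε (KL (i + 1)), isStdTangL_slopeL hf hε (fun x hx => (hTL i hi x hx).2)
      (fun v hv hv' => ?_) (fun hb => ?_), fun h0 => ?_⟩
    · rw [bExt_of_pos _ _ _ (hj1.trans hi.1), EReal.coe_lt_coe_iff] at hv
      exact h.sign_left i hi v hv hv'
    · have e : i + 1 = k := (htop _ hi.2 hb).1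
      rw [e]
      exact hinfL (htop _ hi.2 hb).2
    · subst h0
      exact hforceL _ _ (aExt_self ..)
  · intro i hi
    exact (hch i hi).mono ⟨(hch i hi).lt, le_rfl⟩ fun x hx => (hCh i hi x hx).2

/-! ### Forces of sources -/

/-- The integration constant of the right force generated by a source. -/
def sourceR (f : ℝ → ℝ) (ε : ℝ) : ForceSource → ℝ
  | .chord a b => kap f ε b (avg (deriv (deriv f)) a b)
  | .infinity => stieltjesInt (deriv (deriv f)) (fun t => Real.exp (t / ε)) (Iic 0) -
      deriv (deriv f) 0

/-- The integration constant of the left force generated by a source. -/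
def sourceL (f : ℝ → ℝ) (ε : ℝ) : ForceSource → ℝ
  | .chord a b => kap (fun t => f (-t)) ε (-a) (avg (deriv (deriv f)) a b)
  | .infinity => -stieltjesInt (deriv (deriv f)) (fun t => Real.exp (-t / ε)) (Ioi 0) -
      deriv (deriv f) 0

/-- The point where the right force generated by a source starts. -/
def startR : ForceSource → EReal
  | .chord _ b => b
  | .infinity => ⊥

/-- The point where the left force generated by a source starts. -/
def startL : ForceSource → EReal
  | .chord a _ => a
  | .infinity => ⊤

section Forces

variable {f : ℝ → ℝ} {E ε : ℝ}

lemma hasDerivAt_exp_div (ε t : ℝ) :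
    HasDerivAt (fun t => Real.exp (t / ε)) (Real.exp (t / ε) / ε) t :=
  ((hasDerivAt_id' t).div_const ε).exp.congr_deriv (by ring)

lemma integral_exp_div_mul (hf : ContDiff ℝ 2 f) (ε b v : ℝ) :
    ∫ t in b..v, Real.exp (t / ε) / ε * deriv (deriv f) t =
      (primJ f ε v - primJ f ε b) / ε := by
  have hc : Continuous fun t => Real.exp (t / ε) * deriv (deriv f) t :=
    (by fun_prop : Continuous fun t : ℝ => Real.exp (t / ε)).mul (continuous_deriv2_of_two hf)
  rw [primJ, primJ, intervalIntegral.integral_interval_sub_left (hc.intervalIntegrable _ _)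
    (hc.intervalIntegrable _ _), ← intervalIntegral.integral_div]
  congr 1; funext t; ring

lemma integral_exp_neg_div_mul (hf : ContDiff ℝ 2 f) (ε v a : ℝ) :
    ∫ t in v..a, -Real.exp (-t / ε) / ε * deriv (deriv f) t =
      -(primJ (fun t => f (-t)) ε (-v) - primJ (fun t => f (-t)) ε (-a)) / ε := by
  rw [neg_div, ← integral_exp_div_mul (contDiff_reflect hf), deriv2_reflect,
    ← intervalIntegral.integral_comp_neg (a := v) (b := a)
      (f := fun t => Real.exp (t / ε) / ε * deriv (deriv f) (-t)),
    ← intervalIntegral.integral_neg]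
  congr 1; funext t
  rw [neg_neg]; ring

lemma stieltjesInt_exp_Ioc (hreg : Regular f) (ε : ℝ) {b v : ℝ} (hbv : b ≤ v) :
    stieltjesInt (deriv (deriv f)) (fun t => Real.exp (t / ε)) (Ioc b v) =
      Real.exp (v / ε) * deriv (deriv f) v - Real.exp (b / ε) * deriv (deriv f) b -
        (primJ f ε v - primJ f ε b) / ε := by
  rw [stieltjesInt_Ioc hreg.continuous_deriv2 hreg.locallyBoundedVariationOn
    (hasDerivAt_exp_div ε) (by fun_prop) hbv, integral_exp_div_mul hreg.1]

lemma stieltjesInt_exp_neg_Ioc (hreg : Regular f) (ε : ℝ) {v a : ℝ} (hva : v ≤ a) :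
    stieltjesInt (deriv (deriv f)) (fun t => Real.exp (-t / ε)) (Ioc v a) =
      Real.exp (-a / ε) * deriv (deriv f) a - Real.exp (-v / ε) * deriv (deriv f) v +
        (primJ (fun t => f (-t)) ε (-v) - primJ (fun t => f (-t)) ε (-a)) / ε := by
  rw [stieltjesInt_Ioc hreg.continuous_deriv2 hreg.locallyBoundedVariationOn
    (hasDerivAt_exp_neg_div ε) (by fun_prop) hva, integral_exp_neg_div_mul hreg.1]
  ring

lemma exp_neg_div_mul_exp (v ε : ℝ) : Real.exp (-v / ε) * Real.exp (v / ε) = 1 := by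
  rw [← Real.exp_add]; simp [neg_div]

lemma primJ_zero (f : ℝ → ℝ) (ε : ℝ) : primJ f ε 0 = 0 := by
  rw [primJ, intervalIntegral.integral_same]

/-- Integration by parts moves the differential off f''. For the source at -∞ the integral is split
at 0, the base point of `primJ`, which explains the term -f''(0) in the constant. -/
lemma forceR_eq (hreg : Regular f) (hsum : Summability f E) (hε : 0 < ε) (hεE : ε ≤ E)
    (src : ForceSource) {v : ℝ} (hv : startR src ≤ v) :
    forceR f ε src v = frc f ε (sourceR f ε src) v := by
  have h1 := exp_neg_div_mul_exp v ε
  cases src with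
  | chord a b =>
    have hbv : b ≤ v := EReal.coe_le_coe_iff.1 hv
    have h2 : Real.exp ((b - v) / ε) = Real.exp (-v / ε) * Real.exp (b / ε) := by
      rw [← Real.exp_add]; ring_nf
    simp only [forceR, chordForceR, sourceR, frc, kap, stieltjesInt_exp_Ioc hreg ε hbv, h2, DR]
    linear_combination deriv (deriv f) v * h1
  | infinity =>
    have hS : stieltjesInt (deriv (deriv f)) (fun t => Real.exp (t / ε)) (Iic v) =
        stieltjesInt (deriv (deriv f)) (fun t => Real.exp (t / ε)) (Iic 0) +
          (Real.exp (v / ε) * deriv (deriv f) v - deriv (deriv f) 0 - primJ f ε v / ε) := by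
      have hint := hsum.integrableOn_Iic hε hεE
      rcases le_total 0 v with h | h
      · rw [stieltjesInt_Iic_sub hint h, stieltjesInt_exp_Ioc hreg ε h, primJ_zero, zero_div,
          Real.exp_zero]
        ring
      · rw [stieltjesInt_Iic_sub hint h, stieltjesInt_exp_Ioc hreg ε h, primJ_zero, zero_div,
          Real.exp_zero]
        ring
    simp only [forceR, infForceR, sourceR, frc, hS]
    linear_combination deriv (deriv f) v * h1

lemma forceL_eq (hreg : Regular f) (hsum : Summability f E) (hε : 0 < ε) (hεE : ε ≤ E)
    (src : ForceSource) {v : ℝ} (hv : (v : EReal) ≤ startL src) :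
    forceL f ε src v = frcL f ε (sourceL f ε src) v := by
  have h1 := exp_neg_div_mul_exp v ε
  cases src with
  | chord a b =>
    have hva : v ≤ a := EReal.coe_le_coe_iff.1 hv
    have h2 : Real.exp ((v - a) / ε) = Real.exp (v / ε) * Real.exp (-a / ε) := by
      rw [← Real.exp_add]; ring_nf
    simp only [forceL, chordForceL, sourceL, frcL, frc, kap, stieltjesInt_exp_neg_Ioc hreg ε hva,
      h2, DL, deriv2_reflect, neg_neg]
    linear_combination (-deriv (deriv f) v) * h1
  | infinity =>
    have hS : stieltjesInt (deriv (deriv f)) (fun t => Real.exp (-t / ε)) (Ioi v) =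
        stieltjesInt (deriv (deriv f)) (fun t => Real.exp (-t / ε)) (Ioi 0) +
          (deriv (deriv f) 0 - Real.exp (-v / ε) * deriv (deriv f) v +
            primJ (fun t => f (-t)) ε (-v) / ε) := by
      have hint := hsum.integrableOn_Ioi hε hεE
      rcases le_total v 0 with h | h
      · rw [stieltjesInt_Ioi_sub hint h, stieltjesInt_exp_neg_Ioc hreg ε h, neg_zero, primJ_zero,
          zero_div, Real.exp_zero]
        ring
      · rw [stieltjesInt_Ioi_sub hint h, stieltjesInt_exp_neg_Ioc hreg ε h, neg_zero, primJ_zero,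
          zero_div, Real.exp_zero]
        ring
    simp only [forceL, infForceL, sourceL, frcL, frc, hS, deriv2_reflect, neg_neg]
    linear_combination (-deriv (deriv f) v) * h1

lemma SourceLeftOf.startR_le {u : EReal} {src : ForceSource} (h : SourceLeftOf f u src) :
    startR src ≤ u := by
  cases src with
  | chord a b => exact h.2.2
  | infinity => exact bot_le

lemma SourceRightOf.le_startL {u : EReal} {src : ForceSource} (h : SourceRightOf f u src) :
    u ≤ startL src := by
  cases src with
  | chord a b => exact h.2.2
  | infinity => exact le_top

/-! ### Tails -/

lemma forceR_neg_of_lt_tailEndR {src : ForceSource} {v : ℝ} (h1 : startR src < v)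
    (h2 : (v : EReal) < tailEndR f ε src) : forceR f ε src v < 0 := by
  cases src with
  | chord a b =>
    obtain ⟨_, ⟨t, ht, rfl⟩, hvt⟩ := lt_sSup_iff.1 h2
    exact ht.2 v ⟨EReal.coe_lt_coe_iff.1 h1, EReal.coe_lt_coe_iff.1 hvt⟩
  | infinity =>
    obtain ⟨_, ⟨t, ht, rfl⟩, hvt⟩ := lt_sSup_iff.1 h2
    exact ht v (EReal.coe_lt_coe_iff.1 hvt)

lemma le_tailEndR {src : ForceSource} {t : ℝ} (h1 : startR src < t)
    (h2 : ∀ v : ℝ, startR src < v → v < t → forceR f ε src v < 0) :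
    (t : EReal) ≤ tailEndR f ε src := by
  cases src with
  | chord a b =>
    exact le_sSup ⟨t, ⟨EReal.coe_lt_coe_iff.1 h1, fun s hs =>
      h2 s (EReal.coe_lt_coe_iff.2 hs.1) hs.2⟩, rfl⟩
  | infinity => exact le_sSup ⟨t, fun s hs => h2 s (EReal.bot_lt_coe s) hs, rfl⟩

lemma forceL_pos_of_tailEndL_lt {src : ForceSource} {v : ℝ} (h1 : (v : EReal) < startL src)
    (h2 : tailEndL f ε src < v) : 0 < forceL f ε src v := by
  cases src with
  | chord a b =>
    obtain ⟨_, ⟨t, ht, rfl⟩, hvt⟩ := sInf_lt_iff.1 h2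
    exact ht.2 v ⟨EReal.coe_lt_coe_iff.1 hvt, EReal.coe_lt_coe_iff.1 h1⟩
  | infinity =>
    obtain ⟨_, ⟨t, ht, rfl⟩, hvt⟩ := sInf_lt_iff.1 h2
    exact ht v (EReal.coe_lt_coe_iff.1 hvt)

lemma tailEndL_le {src : ForceSource} {t : ℝ} (h1 : (t : EReal) < startL src)
    (h2 : ∀ v : ℝ, (v : EReal) < startL src → t < v → 0 < forceL f ε src v) :
    tailEndL f ε src ≤ t := by
  cases src with
  | chord a b =>
    exact sInf_le ⟨t, ⟨EReal.coe_lt_coe_iff.1 h1, fun s hs =>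
      h2 s (EReal.coe_lt_coe_iff.2 hs.2) hs.1⟩, rfl⟩
  | infinity => exact sInf_le ⟨t, fun s hs => h2 s (EReal.coe_lt_top s) hs, rfl⟩

lemma tailR_subset (f : ℝ → ℝ) (ε : ℝ) (src : ForceSource) :
    tailR f ε src ⊆ Iio (tailEndR f ε src) := by
  cases src with
  | chord a b => exact fun x hx => hx.2
  | infinity => exact subset_rfl

lemma tailL_subset (f : ℝ → ℝ) (ε : ℝ) (src : ForceSource) :
    tailL f ε src ⊆ Ioi (tailEndL f ε src) := by
  cases src with
  | chord a b => exact fun x hx => hx.1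
  | infinity => exact subset_rfl

/-! ### Force flows as inputs -/

/-- A decreasing family of right forces `frc f ε (K ε)` that start at the points `S ε` on the left of
`u` and have the tails `(S ε, T ε)`. -/
lemma isRightInput_of_tails (hf : ContDiff ℝ 2 f) {u : EReal} {c M₀ η₁ η₂ η₃ : ℝ} (hη : 0 < η₁)
    (h12 : η₁ ≤ η₂) (h23 : η₂ < η₃) (huc : u < c) {K : ℝ → ℝ} {S T : ℝ → EReal}
    (hcont : ContinuousOn (fun ε => frc f ε (K ε) c) (Icc η₁ η₃))
    (hS : ∀ ε ∈ Icc η₁ η₃, S ε ≤ u)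
    (hneg : ∀ ε ∈ Icc η₁ η₃, ∀ v : ℝ, S ε < v → (v : EReal) < T ε → frc f ε (K ε) v < 0)
    (hle : ∀ ε ∈ Icc η₁ η₃, ∀ t : ℝ, S ε < t →
      (∀ v : ℝ, S ε < v → v < t → frc f ε (K ε) v < 0) → (t : EReal) ≤ T ε)
    (hu : ∀ ε ∈ Ioo η₁ η₃, u < T ε)
    (hmono : ∀ η ∈ Icc η₁ η₃, ∀ η' ∈ Icc η₁ η₃, η < η' → ∀ v : ℝ, u ≤ v → (v : EReal) ≤ T η →
      frc f η' (K η') v < frc f η (K η) v)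
    (hc : (c : EReal) ≤ T η₁) (hinit : frc f η₁ (K η₁) c = deriv (deriv f) c - M₀) :
    IsRightInput f u c M₀ η₁ η₂ K := by
  have hm₁ : η₁ ∈ Icc η₁ η₃ := ⟨le_rfl, (h12.trans_lt h23).le⟩
  have hneg₁ : ∀ v : ℝ, u < v → v < c → frc f η₁ (K η₁) v < 0 := fun v h1 h2 =>
    hneg η₁ hm₁ v ((hS η₁ hm₁).trans_lt h1) ((EReal.coe_lt_coe_iff.2 h2).trans_le hc)
  have hle₁ : ∀ v : ℝ, u < v → v ≤ c → frc f η₁ (K η₁) v ≤ 0 := by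
    intro v h1 h2
    obtain ⟨q, hq1, hq2⟩ := EReal.lt_iff_exists_real_btwn.1 h1
    have hq2' : q < v := EReal.coe_lt_coe_iff.1 hq2
    have hcl : v ∈ closure (Ioo q v) := by rw [closure_Ioo hq2'.ne]; exact ⟨hq2'.le, le_rfl⟩
    exact closure_minimal (s := Ioo q v) (t := {v | frc f η₁ (K η₁) v ≤ 0})
      (fun s hs => (hneg₁ s (hq1.trans (EReal.coe_lt_coe_iff.2 hs.1)) (hs.2.trans_le h2)).le)
      (isClosed_le (continuous_frc hf hη _) continuous_const) hcl
  have hneg' : ∀ ε ∈ Ioo η₁ η₃, ∀ v : ℝ, u < v → v ≤ c → frc f ε (K ε) v < 0 := fun ε hε v h1 h2 =>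
    (hmono η₁ hm₁ ε (Ioo_subset_Icc_self hε) hε.1 v h1.le
      ((EReal.coe_le_coe_iff.2 h2).trans hc)).trans_le (hle₁ v h1 h2)
  -- The tail reaches u by the definition of a flow, and from u to c the force lies below the one at
  -- η₁. This opens the monotonicity of the flow at c for all ε, not only for η₁; ε = η₃ is excluded
  -- because there the tail need not contain u.
  have hcT : ∀ ε ∈ Ico η₁ η₃, (c : EReal) ≤ T ε := by
    intro ε hε
    rcases hε.1.eq_or_lt with rfl | hlt
    · exact hc
    have hε' : ε ∈ Ioo η₁ η₃ := ⟨hlt, hε.2⟩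
    have hεc := Ioo_subset_Icc_self hε'
    refine hle ε hεc c ((hS ε hεc).trans_lt huc) fun v h1 h2 => ?_
    rcases le_or_gt (v : EReal) u with h3 | h3
    · exact hneg ε hεc v h1 (h3.trans_lt (hu ε hε'))
    · exact hneg' ε hε' v h3 h2.le
  refine ⟨huc, ?_, ?_, hinit, hneg₁, fun ε hε => hneg' ε ⟨hε.1, hε.2.trans_lt h23⟩⟩
  -- The flow is continuous as a force, not a priori as a constant; the constant is recovered from
  -- the force at c.
  · have h1 : ∀ ε, K ε = kap f ε c (deriv (deriv f) c - frc f ε (K ε) c) := fun ε =>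
      (frc_eq_iff ε (K ε) c _).1 (by ring)
    refine ContinuousOn.congr (f := fun ε => kap f ε c (deriv (deriv f) c - frc f ε (K ε) c)) ?_
      fun ε _ => h1 ε
    exact continuousOn_kap hf (fun ε hε => hη.trans_le hε.1)
      (continuousOn_const.sub (hcont.mono (Icc_subset_Icc_right h23.le))) continuousOn_const
  · intro ε hε ε' hε' hlt
    exact hmono ε ⟨hε.1, hε.2.trans h23.le⟩ ε' ⟨hε'.1, hε'.2.trans h23.le⟩ hlt c huc.le
      (hcT ε ⟨hε.1, hε.2.trans_lt h23⟩)

lemma IsRightForceFlow.eq_frc (hreg : Regular f) (hsum : Summability f E) {u : EReal}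
    {η₁ η₃ : ℝ} (hη : 0 < η₁) (h3E : η₃ ≤ E) {src : ℝ → ForceSource} {F : ℝ → ℝ → ℝ}
    (h : IsRightForceFlow f u η₁ η₃ src F) (hε : ε ∈ Icc η₁ η₃) {v : ℝ} (hv : u ≤ v) :
    F v ε = frc f ε (sourceR f ε (src ε)) v := by
  rw [h.force ε hε v hv]
  exact forceR_eq hreg hsum (hη.trans_le hε.1) (hε.2.trans h3E) _
    ((h.source ε hε).startR_le.trans hv)

lemma IsLeftForceFlow.eq_frcL (hreg : Regular f) (hsum : Summability f E) {u : EReal}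
    {η₁ η₃ : ℝ} (hη : 0 < η₁) (h3E : η₃ ≤ E) {src : ℝ → ForceSource} {F : ℝ → ℝ → ℝ}
    (h : IsLeftForceFlow f u η₁ η₃ src F) (hε : ε ∈ Icc η₁ η₃) {v : ℝ} (hv : (v : EReal) ≤ u) :
    F v ε = frcL f ε (sourceL f ε (src ε)) v := by
  rw [h.force ε hε v hv]
  exact forceL_eq hreg hsum (hη.trans_le hε.1) (hε.2.trans h3E) _
    (hv.trans (h.source ε hε).le_startL)

lemma IsRightForceFlow.isRightInput (hreg : Regular f) (hsum : Summability f E) {u : EReal}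
    {c M₀ η₁ η₂ η₃ : ℝ} (hη : 0 < η₁) (h12 : η₁ ≤ η₂) (h23 : η₂ < η₃) (h3E : η₃ ≤ E)
    (huc : u < c) {src : ℝ → ForceSource} {F : ℝ → ℝ → ℝ}
    (h : IsRightForceFlow f u η₁ η₃ src F) (hc : (c : EReal) ∈ closure (tailR f η₁ (src η₁)))
    (hinit : F c η₁ = deriv (deriv f) c - M₀) :
    IsRightInput f u c M₀ η₁ η₂ fun ε => sourceR f ε (src ε) := by
  have hm₁ : η₁ ∈ Icc η₁ η₃ := ⟨le_rfl, (h12.trans_lt h23).le⟩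
  have hF : ∀ ε ∈ Icc η₁ η₃, ∀ v : ℝ, startR (src ε) < v →
      forceR f ε (src ε) v = frc f ε (sourceR f ε (src ε)) v := fun ε hε v hv =>
    forceR_eq hreg hsum (hη.trans_le hε.1) (hε.2.trans h3E) _ hv.le
  refine isRightInput_of_tails hreg.1 hη h12 h23 huc (S := fun ε => startR (src ε))
    (T := fun ε => tailEndR f ε (src ε)) ?_ (fun ε hε => (h.source ε hε).startR_le)
    (fun ε hε v h1 h2 => ?_) (fun ε hε t h1 h2 => ?_) (fun ε hε => tailR_subset _ _ _ (h.tail ε hε))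
    (fun η hηm η' hη' hlt v h1 h2 => ?_) ?_ ?_
  · have h1 : ContinuousOn (fun ε => F c ε) (Icc η₁ η₃) :=
      h.continuous.comp (f := fun ε => (c, ε)) (by fun_prop) fun ε hε => ⟨huc, hε⟩
    exact h1.congr fun ε hε => (h.eq_frc hreg hsum hη h3E hε huc.le).symm
  · rw [← hF ε hε v h1]
    exact forceR_neg_of_lt_tailEndR h1 h2
  · exact le_tailEndR h1 fun v h3 h4 => by rw [hF ε hε v h3]; exact h2 v h3 h4
  · have := h.monotone η hηm η' hη' hlt v h1 h2
    rwa [h.eq_frc hreg hsum hη h3E hηm h1, h.eq_frc hreg hsum hη h3E hη' h1] at this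
  · exact closure_minimal ((tailR_subset _ _ _).trans Iio_subset_Iic_self) isClosed_Iic hc
  · rw [← h.eq_frc hreg hsum hη h3E hm₁ huc.le, hinit]

lemma IsLeftForceFlow.isRightInput (hreg : Regular f) (hsum : Summability f E) {u : EReal}
    {c M₀ η₁ η₂ η₃ : ℝ} (hη : 0 < η₁) (h12 : η₁ ≤ η₂) (h23 : η₂ < η₃) (h3E : η₃ ≤ E)
    (hcu : (c : EReal) < u) {src : ℝ → ForceSource} {F : ℝ → ℝ → ℝ}
    (h : IsLeftForceFlow f u η₁ η₃ src F) (hc : (c : EReal) ∈ closure (tailL f η₁ (src η₁)))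
    (hinit : F c η₁ = M₀ - deriv (deriv f) c) :
    IsRightInput (fun t => f (-t)) (-u) (-c) M₀ η₁ η₂ fun ε => sourceL f ε (src ε) := by
  have hm₁ : η₁ ∈ Icc η₁ η₃ := ⟨le_rfl, (h12.trans_lt h23).le⟩
  have hfrc : ∀ ε K v, frc (fun t => f (-t)) ε K v = -frcL f ε K (-v) := fun ε K v => by
    rw [frcL, neg_neg, neg_neg]
  have hF : ∀ ε ∈ Icc η₁ η₃, ∀ v : ℝ, (v : EReal) < startL (src ε) →
      forceL f ε (src ε) v = frcL f ε (sourceL f ε (src ε)) v := fun ε hε v hv =>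
    forceL_eq hreg hsum (hη.trans_le hε.1) (hε.2.trans h3E) _ hv.le
  have hcu' : -u < ((-c : ℝ) : EReal) := by rw [EReal.coe_neg]; exact EReal.neg_lt_neg_iff.2 hcu
  refine isRightInput_of_tails (contDiff_reflect hreg.1) hη h12 h23 hcu'
    (S := fun ε => -startL (src ε)) (T := fun ε => -tailEndL f ε (src ε)) ?_
    (fun ε hε => EReal.neg_le_neg_iff.2 (h.source ε hε).le_startL)
    (fun ε hε v h1 h2 => ?_) (fun ε hε t h1 h2 => ?_)
    (fun ε hε => EReal.neg_lt_neg_iff.2 (tailL_subset _ _ _ (h.tail ε hε)))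
    (fun η hηm η' hη' hlt v h1 h2 => ?_) ?_ ?_
  · have h1 : ContinuousOn (fun ε => -F c ε) (Icc η₁ η₃) :=
      (h.continuous.comp (f := fun ε => (c, ε)) (by fun_prop) fun ε hε => ⟨hcu, hε⟩).neg
    exact h1.congr fun ε hε => by
      simp only [hfrc, neg_neg, h.eq_frcL hreg hsum hη h3E hε hcu.le]
  · have h3 : ((-v : ℝ) : EReal) < startL (src ε) := by
      rw [EReal.coe_neg]; exact EReal.neg_lt_comm.1 h1
    have h4 : tailEndL f ε (src ε) < ((-v : ℝ) : EReal) := by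
      rw [EReal.coe_neg]; exact EReal.lt_neg_comm.1 h2
    rw [hfrc, ← hF ε hε _ h3, neg_lt_zero]
    exact forceL_pos_of_tailEndL_lt h3 h4
  · have h3 : ((-t : ℝ) : EReal) < startL (src ε) := by
      rw [EReal.coe_neg]; exact EReal.neg_lt_comm.1 h1
    have h4 : tailEndL f ε (src ε) ≤ ((-t : ℝ) : EReal) := by
      refine tailEndL_le h3 fun v hv1 hv2 => ?_
      have h5 := h2 (-v) (by rw [EReal.coe_neg]; exact EReal.neg_lt_neg_iff.2 hv1)
        (by linarith)
      rw [hfrc, neg_neg, neg_lt_zero] at h5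
      rwa [hF ε hε v hv1]
    rw [EReal.coe_neg] at h4
    exact EReal.le_neg_of_le_neg h4
  · have h3 : ((-v : ℝ) : EReal) ≤ u := by rw [EReal.coe_neg]; exact EReal.neg_le.1 h1
    have h4 : tailEndL f η (src η) ≤ ((-v : ℝ) : EReal) := by
      rw [EReal.coe_neg]; exact EReal.le_neg_of_le_neg h2
    have := h.monotone η hηm η' hη' hlt (-v) h3 h4
    rw [h.eq_frcL hreg hsum hη h3E hηm h3, h.eq_frcL hreg hsum hη h3E hη' h3] at this
    rw [hfrc, hfrc]
    exact neg_lt_neg this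
  · have : tailEndL f η₁ (src η₁) ≤ c :=
      closure_minimal ((tailL_subset _ _ _).trans Ioi_subset_Ici_self) isClosed_Ici hc
    rw [EReal.coe_neg]
    exact EReal.neg_le_neg_iff.2 this
  · rw [hfrc, neg_neg, ← h.eq_frcL hreg hsum hη h3E hm₁ hcu.le, hinit, deriv2_reflect_apply,
      neg_neg, neg_sub]

/-! ### The slope functions on infinite tangent domains -/

/-- Both derivatives grow at most like e^{(1/E + δ)|t|}, with δ half of the gap 1/ε - 1/E: one half
absorbs the factor |t| from integrating f'', the other leaves the decay e^{δt} at -∞. Positive t ≤ u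
are paid for by e^{2|u|/ε}. -/
lemma exists_growth_deriv (hf : ContDiff ℝ 2 f) {C : ℝ} (hE : 0 < E) (hεE : ε < E) (hε : 0 < ε)
    (hC : ∀ t, |deriv (deriv f) t| ≤ C * Real.exp (|t| / E)) :
    ∃ D δ : ℝ, 0 < δ ∧ ∀ u t, t ≤ u → |deriv f t| * Real.exp (t / ε) ≤
        D * Real.exp (2 * |u| / ε) * Real.exp (δ * t) ∧
      |deriv (deriv f) t| * Real.exp (t / ε) ≤ D * Real.exp (2 * |u| / ε) * Real.exp (δ * t) := by
  have hC0 : 0 ≤ C := by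
    have := (abs_nonneg _).trans (hC 0)
    simpa using this
  set δ := (1 / ε - 1 / E) / 2 with hδ
  have hδ0 : 0 < δ := by
    have := one_div_lt_one_div_of_lt hε hεE
    rw [hδ]; linarith
  have hδε : 1 / ε - δ = 1 / E + δ := by rw [hδ]; ring
  have hE0 : 0 < 1 / E := one_div_pos.2 hE
  have h1 : ∀ t, |deriv f t - deriv f 0| ≤ C * Real.exp (|t| / E) * |t| := by
    intro t
    have := (convex_Icc (-|t|) |t|).norm_image_sub_le_of_norm_deriv_le (f := deriv f)
      (C := C * Real.exp (|t| / E)) (x := 0) (y := t)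
      (fun x _ => (hasDerivAt_deriv_of_two hf x).differentiableAt)
      (fun x hx => (hC x).trans (by
        have : |x| ≤ |t| := abs_le.2 hx
        gcongr))
      ⟨neg_nonpos.2 (abs_nonneg t), abs_nonneg t⟩ ⟨neg_abs_le t, le_abs_self t⟩
    simpa using this
  have h2 : ∀ t, |t| ≤ δ⁻¹ * Real.exp (δ * |t|) := by
    intro t
    have := Real.add_one_le_exp (δ * |t|)
    rw [inv_mul_eq_div, le_div_iff₀ hδ0]
    linarith
  set D := |deriv f 0| + C * δ⁻¹ + C with hD
  have hD0 : 0 ≤ C * δ⁻¹ := mul_nonneg hC0 (inv_nonneg.2 hδ0.le)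
  have h3 : ∀ t, |deriv f t| ≤ D * Real.exp ((1 / ε - δ) * |t|) ∧
      |deriv (deriv f) t| ≤ D * Real.exp ((1 / ε - δ) * |t|) := by
    intro t
    have e1 : Real.exp (|t| / E) * Real.exp (δ * |t|) = Real.exp ((1 / ε - δ) * |t|) := by
      rw [← Real.exp_add, hδε]; ring_nf
    have e2 : 1 ≤ Real.exp ((1 / ε - δ) * |t|) := by
      rw [hδε]; exact Real.one_le_exp (by positivity)
    have e3 : Real.exp (|t| / E) ≤ Real.exp ((1 / ε - δ) * |t|) := by
      rw [← e1]
      exact le_mul_of_one_le_right (Real.exp_pos _).le (Real.one_le_exp (by positivity))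
    constructor
    · have e4 : |deriv f t| ≤ |deriv f 0| + |deriv f t - deriv f 0| := by
        have := abs_add_le (deriv f 0) (deriv f t - deriv f 0)
        rwa [add_sub_cancel] at this
      have e5 : C * Real.exp (|t| / E) * |t| ≤ C * δ⁻¹ * Real.exp ((1 / ε - δ) * |t|) := by
        rw [← e1]
        have := mul_le_mul_of_nonneg_left (h2 t) (mul_nonneg hC0 (Real.exp_pos (|t| / E)).le)
        linarith
      have e6 : |deriv f 0| * 1 ≤ |deriv f 0| * Real.exp ((1 / ε - δ) * |t|) := by gcongr
      have e7 : 0 ≤ C * Real.exp ((1 / ε - δ) * |t|) := by positivity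
      rw [hD]
      linarith [h1 t]
    · refine (hC t).trans ((mul_le_mul_of_nonneg_left e3 hC0).trans ?_)
      gcongr
      rw [hD]
      linarith [abs_nonneg (deriv f 0)]
  have hD1 : 0 ≤ D := by rw [hD]; positivity
  have h4 : ∀ u t, t ≤ u → D * Real.exp ((1 / ε - δ) * |t|) * Real.exp (t / ε) ≤
      D * Real.exp (2 * |u| / ε) * Real.exp (δ * t) := by
    intro u t htu
    rw [mul_assoc, mul_assoc, ← Real.exp_add, ← Real.exp_add]
    refine mul_le_mul_of_nonneg_left (Real.exp_le_exp.2 ?_) hD1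
    have e1 : |t| ≤ -t + 2 * |u| := by
      have := le_abs_self u
      have := abs_nonneg u
      rcases abs_cases t with ⟨h, _⟩ | ⟨h, _⟩ <;> linarith
    have e2 : 0 ≤ 1 / ε - δ := by rw [hδε]; positivity
    have e3 := mul_le_mul_of_nonneg_left e1 e2
    have e4 : 0 ≤ δ * |u| := by positivity
    have e5 : t / ε = 1 / ε * t := by ring
    have e6 : 2 * |u| / ε = 1 / ε * (2 * |u|) := by ring
    rw [e5, e6]
    linarith
  exact ⟨D, δ, hδ0, fun u t htu =>
    ⟨(mul_le_mul_of_nonneg_right (h3 t).1 (Real.exp_pos _).le).trans (h4 u t htu),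
      (mul_le_mul_of_nonneg_right (h3 t).2 (Real.exp_pos _).le).trans (h4 u t htu)⟩⟩

/-- The equation for m says (ε m e^{t/ε})' = f' e^{t/ε}. The boundary term at -∞ vanishes because m
= f' - ε(f'' - F): the growth bounds handle f' and f'', and the hypothesis on F handles the force.
-/
lemma slope_eq_integral (hf : ContDiff ℝ 2 f) {C K : ℝ} (hE : 0 < E) (hεE : ε < E) (hε : 0 < ε)
    (hC : ∀ t, |deriv (deriv f) t| ≤ C * Real.exp (|t| / E))
    (hK : Filter.Tendsto (fun t => frc f ε K t * Real.exp (t / ε)) Filter.atBot (𝓝 0)) (u : ℝ) :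
    slope f ε K u = ε⁻¹ * Real.exp (-u / ε) * ∫ t in Iic u, deriv f t * Real.exp (t / ε) := by
  obtain ⟨D, δ, hδ, hb⟩ := exists_growth_deriv hf hE hεE hε hC
  have hc1 := continuous_deriv_of_two hf
  have hexp : Continuous fun t : ℝ => Real.exp (t / ε) := by fun_prop
  have hlim : Filter.Tendsto (fun t => D * Real.exp (2 * |u| / ε) * Real.exp (δ * t))
      Filter.atBot (𝓝 0) := by
    have h1 : Filter.Tendsto (fun t : ℝ => δ * t) Filter.atBot Filter.atBot :=
      Filter.tendsto_id.const_mul_atBot hδ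
    simpa using (Real.tendsto_exp_atBot.comp h1).const_mul (D * Real.exp (2 * |u| / ε))
  have hl : ∀ h : ℝ → ℝ, (∀ t, t ≤ u → |h t| * Real.exp (t / ε) ≤
      D * Real.exp (2 * |u| / ε) * Real.exp (δ * t)) →
      Filter.Tendsto (fun t => h t * Real.exp (t / ε)) Filter.atBot (𝓝 0) := by
    intro h hh
    refine squeeze_zero_norm' ?_ hlim
    filter_upwards [Filter.eventually_le_atBot u] with t ht
    rw [Real.norm_eq_abs, abs_mul, abs_of_pos (Real.exp_pos _)]
    exact hh t ht
  have hlim1 := hl _ fun t ht => (hb u t ht).1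
  have hlim2 := hl _ fun t ht => (hb u t ht).2
  have hint : IntegrableOn (fun t => deriv f t * Real.exp (t / ε)) (Iic u) := by
    refine Integrable.mono' ((integrableOn_exp_mul_Iic hδ u).const_mul
      (D * Real.exp (2 * |u| / ε))) (hc1.mul hexp).aestronglyMeasurable ?_
    filter_upwards [ae_restrict_mem measurableSet_Iic] with t ht
    rw [Real.norm_eq_abs, abs_mul, abs_of_pos (Real.exp_pos _)]
    exact (hb u t ht).1
  have hd : ∀ t, HasDerivAt (fun t => ε * (slope f ε K t * Real.exp (t / ε)))
      (deriv f t * Real.exp (t / ε)) t := by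
    intro t
    refine (((hasDerivAt_slope hf hε K t).fun_mul (hasDerivAt_exp_div ε t)).const_mul
      ε).congr_deriv ?_
    rw [slope_eq hε]
    field_simp
    ring
  have hH : Filter.Tendsto (fun t => ε * (slope f ε K t * Real.exp (t / ε))) Filter.atBot
      (𝓝 0) := by
    have h1 := (hlim1.sub ((hlim2.sub hK).const_mul ε)).const_mul ε
    simp only [sub_zero, mul_zero] at h1
    refine h1.congr fun t => ?_
    rw [slope_eq hε]
    ring
  rw [integral_Iic_of_hasDerivAt_of_tendsto (hd u).continuousAt.continuousWithinAt
    (fun t _ => hd t) hint hH, sub_zero]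
  have := exp_neg_div_mul_exp u ε
  have h1 : ε⁻¹ * ε = 1 := inv_mul_cancel₀ hε.ne'
  linear_combination (-(slope f ε K u * Real.exp (-u / ε) * Real.exp (u / ε))) * h1 -
    slope f ε K u * this

/-- For the source at -∞, F(t) e^{t/ε} is the Stieltjes integral over (-∞, t], which tends to 0. -/
lemma slope_infinity (hreg : Regular f) (hsum : Summability f E) (hε : 0 < ε) (hεE : ε < E)
    (u : ℝ) : slope f ε (sourceR f ε .infinity) u =
      ε⁻¹ * Real.exp (-u / ε) * ∫ t in Iic u, deriv f t * Real.exp (t / ε) := by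
  have hE := hε.trans hεE
  obtain ⟨C, hC⟩ := exists_growth_deriv2 hreg hsum hE
  refine slope_eq_integral hreg.1 hE hεE hε hC
    ((tendsto_stieltjesInt_Iic (hsum.integrableOn_Iic hε hεE.le)).congr fun t => ?_) u
  rw [← forceR_eq hreg hsum hε hεE.le .infinity bot_le]
  simp only [forceR, infForceR]
  linear_combination (-stieltjesInt (deriv (deriv f)) (fun t => Real.exp (t / ε)) (Iic t)) *
    exp_neg_div_mul_exp t ε

lemma slopeL_infinity (hreg : Regular f) (hsum : Summability f E) (hε : 0 < ε) (hεE : ε < E)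
    (u : ℝ) : slopeL f ε (sourceL f ε .infinity) u =
      ε⁻¹ * Real.exp (u / ε) * ∫ t in Ioi u, deriv f t * Real.exp (-t / ε) := by
  have hE := hε.trans hεE
  obtain ⟨C, hC⟩ := exists_growth_deriv2 hreg hsum hE
  have hlim : Filter.Tendsto (fun t => frc (fun t => f (-t)) ε (sourceL f ε .infinity) t *
      Real.exp (t / ε)) Filter.atBot (𝓝 0) := by
    have h1 := ((tendsto_stieltjesInt_Ioi (hsum.integrableOn_Ioi hε hεE.le)).comp
      Filter.tendsto_neg_atBot_atTop).neg
    rw [neg_zero] at h1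
    refine h1.congr fun t => ?_
    have h2 := forceL_eq hreg hsum hε hεE.le .infinity (v := -t) le_top
    rw [frcL, neg_neg] at h2
    rw [← neg_eq_iff_eq_neg.2 h2]
    simp only [forceL, infForceL, Function.comp_def]
    linear_combination (stieltjesInt (deriv (deriv f)) (fun t => Real.exp (-t / ε)) (Ioi (-t))) *
      exp_neg_div_mul_exp t ε
  rw [slopeL, slope_eq_integral (contDiff_reflect hreg.1) hE hεE hε (fun t => by
    rw [deriv2_reflect_apply, ← abs_neg t]; exact hC (-t)) hlim, neg_neg]
  have h3 := integral_comp_neg_Iic (-u) fun t => deriv f t * Real.exp (-t / ε)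
  simp only [neg_neg] at h3
  rw [← h3, deriv_reflect, ← mul_neg, ← integral_neg]
  simp only [neg_mul, neg_neg]

end Forces

/-! ### The configuration of a multibirdie candidate -/

/-- The equation itself makes m' differentiable and expresses the force through m. The cases s = ε
and s = -ε serve right and left tangents. -/
lemma mul_deriv_deriv_of_ode {f m : ℝ → ℝ} (hf : ContDiff ℝ 2 f) {s : ℝ} (hs : s ≠ 0) {U : Set ℝ}
    (hU : IsOpen U)
    (hm : ∀ u ∈ U, DifferentiableAt ℝ m u ∧ s * deriv m u + m u - deriv f u = 0) {u : ℝ}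
    (hu : u ∈ U) : s * deriv (deriv m) u = deriv (deriv f) u - (deriv f u - m u) / s := by
  have h1 : ∀ v ∈ U, deriv m v = (deriv f v - m v) / s := fun v hv => by
    rw [eq_div_iff hs]
    linarith [(hm v hv).2]
  have h2 : deriv m =ᶠ[𝓝 u] fun v => (deriv f v - m v) / s :=
    Filter.eventuallyEq_of_mem (hU.mem_nhds hu) h1
  rw [h2.deriv_eq, (((hasDerivAt_deriv_of_two hf u).fun_sub (hm u hu).1.hasDerivAt).div_const
    s).deriv, h1 u hu]
  field_simp

lemma deriv2_eq_of_deriv_affine {f : ℝ → ℝ} (hf : ContDiff ℝ 2 f) {p q β γ : ℝ} (hpq : p < q)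
    (h : ∀ t ∈ Icc p q, deriv f t = β + γ * t) {t : ℝ} (ht : t ∈ Icc p q) :
    deriv (deriv f) t = γ := by
  have h1 : HasDerivWithinAt (deriv f) γ (Icc p q) t := by
    have h2 := ((hasDerivAt_id' t).const_mul γ).const_add β
    rw [mul_one] at h2
    exact h2.hasDerivWithinAt.congr h (h t ht)
  exact (uniqueDiffOn_Icc hpq t ht).eq_deriv _ (hasDerivAt_deriv_of_two hf t).hasDerivWithinAt h1

/-- A point of the upper boundary lies above all short chords. -/
lemma mem_aboveChord_of_top {ε p q x : ℝ} (hε : 0 ≤ ε) (hpq : p ≤ q) (h : q - p ≤ 2 * ε) :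
    ((x, x ^ 2 + ε ^ 2) : ℝ × ℝ) ∈ aboveChord p q := by
  simp only [aboveChord, mem_ofPred_eq]
  nlinarith [sq_nonneg (2 * x - p - q)]

lemma top_mem_strip (ε x : ℝ) : ((x, x ^ 2 + ε ^ 2) : ℝ × ℝ) ∈ strip ε :=
  ⟨by simp only; nlinarith [sq_nonneg ε], le_rfl⟩

lemma uR_top (ε x : ℝ) : uR ε (x, x ^ 2 + ε ^ 2) = x + ε := by simp [uR]

lemma uL_top (ε x : ℝ) : uL ε (x, x ^ 2 + ε ^ 2) = x - ε := by simp [uL]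

namespace IsMultibirdieCandidate

variable {f : ℝ → ℝ} {ε : ℝ} {k : ℕ} {aL aR : ℕ → ℝ} {u₁ u₂ : EReal} {a b : ℕ → ℝ → ℝ}
  {lam : ℕ → ℝ} {gR gL : ℝ → ℝ} {B : ℝ × ℝ → ℝ}

lemma continuousOn_chordal (h : IsMultibirdieCandidate f ε k aL aR u₁ u₂ a b lam gR gL B) {i : ℕ}
    (hi : i ∈ Ico 1 k) :
    ContinuousOn B (chordal (a i) (b i) (lam i) (aL (i + 1) - aR i)) :=
  h.continuous.mono fun _ hx => Or.inl (Or.inr (mem_iUnion₂.2 ⟨i, hi, hx⟩))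

/-- The linear function on the multibirdie determines the value of `f''` on the arcs, its mean
values over the chords and the forces at the ends. -/
lemma exists_isArcSystem (h : IsMultibirdieCandidate f ε k aL aR u₁ u₂ a b lam gR gL B)
    (hf : ContDiff ℝ 2 f) (hε : 0 < ε) (hk : 1 ≤ k) (harc : ∀ i ∈ Icc 1 k, aL i ≤ aR i)
    (hdisj : ∀ i ∈ Ico 1 k, aR i < aL (i + 1))
    (hchord : ∀ i ∈ Ico 1 k, aL (i + 1) - aR i ≤ 2 * ε)
    (hu₁ : u₁ < (aL 1 : EReal)) (hu₂ : (aR k : EReal) < u₂) {g g' : ℝ → ℝ} (hg : Continuous g)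
    (hg' : Continuous g') (hgR : ∀ v : ℝ, u₁ < v → gR v = g v)
    (hgL : ∀ v : ℝ, (v : EReal) < u₂ → gL v = g' v) :
    ∃ M₀, IsArcSystem f k aL aR a b lam M₀ ∧ gR (aL 1) = deriv (deriv f) (aL 1) - M₀ ∧
      gL (aR k) = M₀ - deriv (deriv f) (aR k) := by
  obtain ⟨β₀, β₁, β₂, hlin, htan⟩ := h.onMultibirdie
  have htan' : ∀ i ∈ Icc 1 k, ∀ t ∈ Icc (aL i) (aR i), β₁ = deriv f t - 2 * β₂ * t ∧
      β₀ = f t - t * deriv f t + β₂ * t ^ 2 := fun i hi t ht =>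
    htan t (mem_iUnion₂.2 ⟨i, hi, ht⟩)
  have hB : ∀ i ∈ Icc 1 k, ∀ t ∈ Icc (aL i) (aR i), ∀ x ∈ multibirdie ε k aL aR,
      B x = tangentLin f t β₂ x := by
    intro i hi t ht x hx
    obtain ⟨h1, h2⟩ := htan' i hi t ht
    rw [hlin x hx, tangentLin, h1, h2]
    ring
  -- Tangency gives f'(t) = β₁ + 2β₂ t at all points of the arcs, so 2β₂ is both f'' on the solid
  -- arcs and the difference quotient of f' across each gap.
  have H : IsArcSystem f k aL aR a b lam (2 * β₂) := by
    refine ⟨harc, fun i hi hlt t ht => ?_, fun i hi => (h.chordalDomains i hi).isChordFamily,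
      h.top_a, h.top_b, fun i hi => ?_⟩
    · exact deriv2_eq_of_deriv_affine hf hlt (β := β₁) (fun t ht => by
        linarith [(htan' i hi t ht).1]) ht
    · have h1 := (htan' i ⟨hi.1, hi.2.le⟩ (aR i) ⟨harc i ⟨hi.1, hi.2.le⟩, le_rfl⟩).1
      have h2 := (htan' (i + 1) ⟨by omega, hi.2⟩ (aL (i + 1))
        ⟨le_rfl, harc (i + 1) ⟨by omega, hi.2⟩⟩).1
      rw [avg_deriv2 hf, div_eq_iff (sub_pos.2 (hdisj i hi)).ne']
      linarith
  have hk1 : 1 ∈ Icc 1 k := ⟨le_rfl, hk⟩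
  have hkk : k ∈ Icc 1 k := ⟨hk, le_rfl⟩
  have hle : aL 1 ≤ aR k := (H.aL_le hk le_rfl).trans (harc k hkk)
  have habove : ∀ x : ℝ, ∀ i, 1 ≤ i → i < k →
      ((x, x ^ 2 + ε ^ 2) : ℝ × ℝ) ∈ aboveChord (aR i) (aL (i + 1)) := fun x i h1 h2 =>
    mem_aboveChord_of_top hε.le (hdisj i ⟨h1, h2⟩).le (hchord i ⟨h1, h2⟩)
  refine ⟨2 * β₂, H, ?_, ?_⟩
  · obtain ⟨m, hm, hmF⟩ := h.right
    -- The tangency point on the upper parabola belongs both to the tangent domain and to the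
    -- multibirdie. Since x₁ - u = -ε is nonzero there, equality of the values yields equality of
    -- the slopes.
    have hx := top_mem_strip ε (aL 1 - ε)
    have hxu : uR ε (aL 1 - ε, (aL 1 - ε) ^ 2 + ε ^ 2) = aL 1 := by rw [uR_top]; ring
    have h1 := hm.formula _ ⟨hx, by rw [hxu]; exact hu₁.le, by rw [hxu]⟩
    rw [hB 1 hk1 (aL 1) ⟨le_rfl, harc 1 hk1⟩ _ ⟨hx, hxu.ge, by rw [uL_top]; linarith, habove _⟩,
      tangentLin_of_uR hε hx hxu, hxu] at h1
    have hma : m (aL 1) = deriv f (aL 1) - ε * (2 * β₂) := by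
      have h2 : (m (aL 1) - (deriv f (aL 1) - ε * (2 * β₂))) * ε = 0 := by
        simp only at h1
        linarith
      linarith [(mul_eq_zero.1 h2).resolve_right hε.ne']
    obtain ⟨q, hq1, hq2⟩ := EReal.lt_iff_exists_real_btwn.1 hu₁
    have hq2' : q < aL 1 := EReal.coe_lt_coe_iff.1 hq2
    have hcm : ContinuousOn m (Icc q (aL 1)) := hm.continuous.mono fun v hv =>
      ⟨hq1.le.trans (EReal.coe_le_coe_iff.2 hv.1), EReal.coe_le_coe_iff.2 hv.2⟩
    have hIoo : ∀ v ∈ Ioo q (aL 1), u₁ < v ∧ (v : EReal) < aL 1 := fun v hv =>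
      ⟨hq1.trans (EReal.coe_lt_coe_iff.2 hv.1), EReal.coe_lt_coe_iff.2 hv.2⟩
    -- The differential equation holds only in the open interval; continuity of the force and of m
    -- carries the relation to the end.
    have heq : EqOn g (fun v => deriv (deriv f) v - (deriv f v - m v) / ε) (Icc q (aL 1)) := by
      refine EqOn.of_subset_closure (s := Ioo q (aL 1)) (fun v hv => ?_) hg.continuousOn
        ((continuous_deriv2_of_two hf).continuousOn.sub
          (((continuous_deriv_of_two hf).continuousOn.sub hcm).div_const ε))
        Ioo_subset_Icc_self (closure_Ioo hq2'.ne).ge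
      have h2 := mul_deriv_deriv_of_ode hf hε.ne' isOpen_Ioo
        (fun v hv => hm.ode v (hIoo v hv).1 (hIoo v hv).2) hv
      rw [hmF v (hIoo v hv).1 (hIoo v hv).2, hgR v (hIoo v hv).1] at h2
      exact h2
    rw [hgR _ hu₁, heq ⟨hq2'.le, le_rfl⟩]
    simp only [hma]
    field_simp
    ring
  · obtain ⟨m, hm, hmF⟩ := h.left
    have hx := top_mem_strip ε (aR k + ε)
    have hxu : uL ε (aR k + ε, (aR k + ε) ^ 2 + ε ^ 2) = aR k := by rw [uL_top]; ring
    have h1 := hm.formula _ ⟨hx, by rw [hxu], by rw [hxu]; exact hu₂.le⟩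
    rw [hB k hkk (aR k) ⟨harc k hkk, le_rfl⟩ _ ⟨hx, by rw [uR_top]; linarith, hxu.le, habove _⟩,
      tangentLin_of_uL hε hx hxu, hxu] at h1
    have hma : m (aR k) = deriv f (aR k) + ε * (2 * β₂) := by
      have h2 : (m (aR k) - (deriv f (aR k) + ε * (2 * β₂))) * ε = 0 := by
        simp only at h1
        linarith
      linarith [(mul_eq_zero.1 h2).resolve_right hε.ne']
    obtain ⟨q, hq1, hq2⟩ := EReal.lt_iff_exists_real_btwn.1 hu₂
    have hq1' : aR k < q := EReal.coe_lt_coe_iff.1 hq1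
    have hcm : ContinuousOn m (Icc (aR k) q) := hm.continuous.mono fun v hv =>
      ⟨EReal.coe_le_coe_iff.2 hv.1, (EReal.coe_le_coe_iff.2 hv.2).trans hq2.le⟩
    have hIoo : ∀ v ∈ Ioo (aR k) q, ((aR k : ℝ) : EReal) < v ∧ (v : EReal) < u₂ := fun v hv =>
      ⟨EReal.coe_lt_coe_iff.2 hv.1, (EReal.coe_lt_coe_iff.2 hv.2).trans hq2⟩
    have heq : EqOn g' (fun v => (m v - deriv f v) / ε - deriv (deriv f) v) (Icc (aR k) q) := by
      refine EqOn.of_subset_closure (s := Ioo (aR k) q) (fun v hv => ?_) hg'.continuousOn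
        (((hcm.sub (continuous_deriv_of_two hf).continuousOn).div_const ε).sub
          (continuous_deriv2_of_two hf).continuousOn)
        Ioo_subset_Icc_self (closure_Ioo hq1'.ne).ge
      have h2 := mul_deriv_deriv_of_ode hf (neg_ne_zero.2 hε.ne') isOpen_Ioo
        (fun v hv => hm.ode v (hIoo v hv).1 (hIoo v hv).2) hv
      have h3 := hmF v (hIoo v hv).1 (hIoo v hv).2
      rw [hgL v (hIoo v hv).2] at h3
      rw [div_neg] at h2
      simp only [sub_div] at h2 ⊢
      linarith
    rw [hgL _ hu₂, heq ⟨le_rfl, hq1'.le⟩]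
    simp only [hma]
    field_simp
    ring

end IsMultibirdieCandidate

lemma eq_infinity_of_sourceLeftOf_bot {f : ℝ → ℝ} {src : ForceSource}
    (h : SourceLeftOf f ⊥ src) : src = .infinity := by
  cases src with
  | chord a b => exact absurd (le_bot_iff.1 h.2.2) (EReal.coe_ne_bot b)
  | infinity => rfl

lemma eq_infinity_of_sourceRightOf_top {f : ℝ → ℝ} {src : ForceSource}
    (h : SourceRightOf f ⊤ src) : src = .infinity := by
  cases src with
  | chord a b => exact absurd (top_le_iff.1 h.2.2) (EReal.coe_ne_top a)
  | infinity => rfl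

lemma IsArcSystem.b_le_a {f : ℝ → ℝ} {k : ℕ} {aL aR : ℕ → ℝ} {a b : ℕ → ℝ → ℝ} {lam : ℕ → ℝ}
    {M₀ : ℝ} (H : IsArcSystem f k aL aR a b lam M₀) {l : ℕ → ℝ}
    (hl : ∀ i ∈ Ico 1 k, l i ∈ Ioc (lam i) (aL (i + 1) - aR i)) {i : ℕ} (hi : 1 ≤ i)
    (hik : i + 1 < k) : b i (l i) ≤ a (i + 1) (l (i + 1)) := by
  have h1 : i ∈ Ico 1 k := ⟨hi, by omega⟩
  have h2 : i + 1 ∈ Ico 1 k := ⟨by omega, hik⟩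
  have hF₁ := H.family i h1
  have hF₂ := H.family (i + 1) h2
  have e1 := hF₁.strictMonoOn.monotoneOn (Ioc_subset_Icc_self (hl i h1)) ⟨hF₁.lt.le, le_rfl⟩
    (hl i h1).2
  have e2 := hF₂.strictAntiOn.antitoneOn (Ioc_subset_Icc_self (hl _ h2)) ⟨hF₂.lt.le, le_rfl⟩
    (hl _ h2).2
  rw [H.top_b i h1] at e1
  rw [H.top_a _ h2] at e2
  exact e1.trans ((H.arc _ ⟨h2.1, h2.2.le⟩).trans e2)

end BellmanStrip

end

/-! ### The theorem on the disintegration of a multibirdie. -/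

theorem mainTheorem9
    (f : ℝ → ℝ) (εinf : ℝ) (hεinf : 0 < εinf)
    (hreg : BellmanStrip.Regular f) (hsum : BellmanStrip.Summability f εinf)
    (η₁ η₃ : ℝ) (hη₁ : 0 < η₁) (hη₁₃ : η₁ < η₃) (hη₃ : η₃ < εinf)
    (k : ℕ) (hk : 1 ≤ k) (aL aR : ℕ → ℝ)
    (harc : ∀ i ∈ Set.Icc 1 k, aL i ≤ aR i)
    (hdisj : ∀ i ∈ Set.Ico 1 k, aR i < aL (i + 1))
    (hchord : ∀ i ∈ Set.Ico 1 k, aL (i + 1) - aR i ≤ 2 * η₁)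
    (u₁ u₂ : EReal) (hu₁ : u₁ < (aL 1 : EReal)) (hu₂ : (aR k : EReal) < u₂)
    (srcR srcL : ℝ → BellmanStrip.ForceSource) (FR FL : ℝ → ℝ → ℝ)
    (hFR : BellmanStrip.IsRightForceFlow f u₁ η₁ η₃ srcR FR)
    (hFL : BellmanStrip.IsLeftForceFlow f u₂ η₁ η₃ srcL FL)
    (htailR : (aL 1 : EReal) ∈ closure (BellmanStrip.tailR f η₁ (srcR η₁)))
    (htailL : (aR k : EReal) ∈ closure (BellmanStrip.tailL f η₁ (srcL η₁)))
    (a b : ℕ → ℝ → ℝ) (lam : ℕ → ℝ) (B : ℝ × ℝ → ℝ)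
    (hB : BellmanStrip.IsMultibirdieCandidate f η₁ k aL aR u₁ u₂ a b lam
      (fun v => FR v η₁) (fun v => FL v η₁) B) :
    ∃ η₂ : ℝ, η₁ < η₂ ∧ η₂ ≤ η₃ ∧
      ∃ l : ℕ → ℝ → ℝ,
        (∀ i ∈ Set.Ico 1 k,
          ContinuousOn (l i) (Set.Icc η₁ η₂) ∧ StrictAntiOn (l i) (Set.Icc η₁ η₂) ∧
          l i η₁ = aL (i + 1) - aR i) ∧
        ∀ ε ∈ Set.Icc η₁ η₂,
          ∃ j ∈ Set.Icc 1 k, ∃ w : ℝ,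
            BellmanStrip.bExt u₁ b (fun i => l i ε) (j - 1) ≤ (w : EReal) ∧
            (w : EReal) ≤ BellmanStrip.aExt k u₂ a (fun i => l i ε) j ∧
            u₁ < (w : EReal) ∧ (w : EReal) < u₂ ∧
            ∃ Bε : ℝ × ℝ → ℝ,
              BellmanStrip.IsDisintegratedCandidate f ε k j w u₁ u₂ a b lam (fun i => l i ε)
                {t | ε = η₁ ∧ t ∈ BellmanStrip.solidArcs k aL aR}
                (fun v => FR v ε) (fun v => FL v ε) Bε := by
  have hf := hreg.1
  have hη₁m : η₁ ∈ Set.Icc η₁ η₃ := ⟨le_rfl, hη₁₃.le⟩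
  have h3E := hη₃.le
  obtain ⟨M₀, H, hR₀, hL₀⟩ := hB.exists_isArcSystem hf hη₁ hk harc hdisj hchord hu₁ hu₂
    (BellmanStrip.continuous_frc hf hη₁ (BellmanStrip.sourceR f η₁ (srcR η₁)))
    ((BellmanStrip.continuous_frc (BellmanStrip.contDiff_reflect hf) hη₁
      (BellmanStrip.sourceL f η₁ (srcL η₁))).comp continuous_neg).neg
    (fun v hv => hFR.eq_frc hreg hsum hη₁ h3E hη₁m hv.le)
    (fun v hv => hFL.eq_frcL hreg hsum hη₁ h3E hη₁m hv.le)
  -- The tails of the flows are controlled only for ε < η₃, so the argument runs on a smaller closed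
  -- range.
  obtain ⟨η, hη, hη'⟩ := exists_between hη₁₃
  obtain ⟨η₂, h12, h2η, l, hl, hconf⟩ := BellmanStrip.exists_forceConfigs hk H hf hη₁ hη hchord
    (hFR.isRightInput hreg hsum hη₁ hη.le hη' h3E hu₁ htailR hR₀)
    (hFL.isRightInput hreg hsum hη₁ hη.le hη' h3E hu₂ htailL hL₀)
  refine ⟨η₂, h12, h2η.trans hη'.le, l, hl, fun ε hε => ?_⟩
  obtain ⟨hlm, j, hj, w, KR, KL, hKR, hKL, hC⟩ := hconf ε hε
  have hε0 : 0 < ε := hη₁.trans_le hε.1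
  have hεm : ε ∈ Set.Icc η₁ η₃ := ⟨hε.1, hε.2.trans (h2η.trans hη'.le)⟩
  refine ⟨j, hj, w, hC.left_le, hC.le_right, hC.lt_w, hC.w_lt, hC.exists_candidate hf hε0 hj
    (B := B) (fun i hi => (hB.chordalDomains i hi).mono (hlm i hi) fun _ _ => rfl)
    (fun i hi => (hB.continuousOn_chordal hi).mono (BellmanStrip.chordal_subset (hlm i hi).2))
    (fun i hi => ?_) (fun i hi hik => H.b_le_a hlm hi.1 hik) (fun v hv => ?_) (fun v hv => ?_)
    (fun hu u => ?_) (fun hu u => ?_)⟩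
  · exact (hlm i hi).2.trans ((hchord i hi).trans (by linarith [hε.1]))
  · rw [hKR]
    exact hFR.eq_frc hreg hsum hη₁ h3E hεm hv.le
  · rw [hKL]
    exact hFL.eq_frcL hreg hsum hη₁ h3E hεm hv.le
  -- No chord lies to the left of -∞, so the source of the force is -∞ itself.
  · subst hu
    rw [hKR, BellmanStrip.eq_infinity_of_sourceLeftOf_bot (hFR.source ε hεm)]
    exact BellmanStrip.slope_infinity hreg hsum hε0 (hεm.2.trans_lt hη₃) u
  · subst hu
    rw [hKL, BellmanStrip.eq_infinity_of_sourceRightOf_top (hFL.source ε hεm)]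
    exact BellmanStrip.slopeL_infinity hreg hsum hε0 (hεm.2.trans_lt hη₃) u
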